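/- **Setting.** Let $\mathcal C_d=C([0,1];\mathbb R^d)$ with the uniform topology and its Borel $\sigma$-algebra. A *signal* is a Borel probability measure $\mu$ on $\mathcal C_d$. A map $f$ of $\mathbb R^d$ acts by $f\cdot\mu:=\mathrm{law}\big((f(x_t))_t\big)$, $x\sim\mu$ (defined when $f\circ x$ is continuous for $\mu$-almost every $x$), and $A\in\mathbb R^{d\times d}$ acts through $u\mapsto Au$. The spatial support $D_\mu$ is the closure of $\bigcup_t\operatorname{supp}\mathrm{law}(x_t)$. $\mathrm M_d$ is the group of monomial matrices (invertible diagonal times permutation), $\|\cdot\|$ the Frobenius norm, $\|\cdot\|_2$ the spectral norm, $\kappa_2(A)=\|A\|_2\|A^{-1}\|_2$, $\operatorname{ddiag}(A)$ the diagonal part of a matrix $A$ (and $\operatorname{ddiag}(a_i)_i$ the diagonal matrix with entries $a_i$), and $\|A\|_\times=\|A-\operatorname{ddiag}(A)\|$. *Coredinates.* Let $\mu$ be concentrated on absolutely continuous paths. Put $\langle\mu\rangle_{i_1\cdots i_m}=\mathbb E_\mu\int_{0\le t_1\le\cdots\le t_m\le1}dx^{i_1}_{t_1}\cdots dx^{i_m}_{t_m}$,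 $[\mu]_0=(\langle\mu\rangle_{ij})_{ij}$, $[\mu]_\nu=(\langle\mu\rangle_{ij\nu})_{ij}$ for $\nu=1,\dots,d$, $C_\mu=\frac12([\mu]_0+[\mu]_0^{\intercal})$, and $N_\mu=\operatorname{ddiag}(\langle\mu\rangle_{ii}^{1/2})_i$. Let $\dot{\mathfrak D}$ be the set of such $\mu$ for which all iterated integrals of orders $2$ and $3$ are integrable and $\langle\mu\rangle_{ii}\ne0$ for all $i$. Let $$\mathcal S_0=\{\mu\in\dot{\mathfrak D}: C_\mu\text{ is invertible and at most one }\langle\mu\rangle_{iii}\text{ vanishes}\},$$ and let $\mathcal S_\star$ be the set of *orthogonal* $\mu\in\mathcal S_0$, i.e. $\langle\mu\rangle_{ij}=0$ unless $i=j$ and $\langle\mu\rangle_{ijk}=0$ unless $i=j=k$. The *IC-defect* is $$\delta_{\perp\!\!\!\perp}(\mu)=\Big(\big\|N_\mu^{-1}\big([\mu]_0-\operatorname{ddiag}[\mu]_0\big)N_\mu^{-1}\big\|^2+\sum_{\nu=1}^d\big\|N_\mu^{-1}\,\langle\mu\rangle_{\nu\nu}^{-1/2}\big([\mu]_\nu-\langle\mu\rangle_{\nu\nu\nu}\,e_\nu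 e_\nu^{\intercal}\big)N_\mu^{-1}\big\|^2\Big)^{1/2}.$$ *Contrast and inversion map.* Fix $\kappa_0\in\mathbb R$ and let $\Xi_1$ be the set of $\theta\in\mathrm{GL}_d$ with Euclidean unit rows and $\kappa_2(\theta)\le\kappa_0$. For $\chi\in\dot{\mathfrak D}$ with $C_\chi$ invertible let $R=C_\chi^{-1/2}$ and, with $\chi_\theta:=\theta R\cdot\chi$, $$\phi_\chi(\theta)=\big\|N_{\chi_\theta}^{-1}[\chi_\theta]_0N_{\chi_\theta}^{-1}\big\|_\times^2+\sum_{\nu=1}^d\big\|N_{\chi_\theta}^{-1}\langle\chi_\theta\rangle_{\nu\nu}^{-1/2}[\chi_\theta]_\nu N_{\chi_\theta}^{-1}\big\|_\times^2,\qquad \hat\Phi(\chi)=\big[\operatorname*{argmin}_{\theta\in\Xi_1}\phi_\chi(\theta)\big]\cdot R .$$ *Causes.* $\mathfrak C$ is the set of pairs $(S,f)$ of a signal $S$ and a map $f$ of $\mathbb R^d$ that restricts to a homeomorphism from $D_S$ onto its image. For $\mathcal I\subseteq\mathfrak C$, $(X,S,f)$ is a *BSS-triple on* $\mathcal I$ if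 $(S,f)\in\mathcal I$ and $X=f\cdot S$, and $\langle X\rangle_{\mathcal I}$ is the set of all $g\cdot X$ with $g$ restricting to a homeomorphism of $D_X$ onto its image and $(g\cdot X,g^{-1})\in\mathcal I$. The *deviance* is $$\partial_{\hat\Phi}(S,f)=\sup_{B\in\hat\Phi(f\cdot S)}\ \inf_{M\in\mathrm M_d,\,v\in\mathbb R^d}\ \sup_{u\in v+D_S}\frac{|Bf(u-v)-Mu|}{|Mu|}\in[0,\infty],$$ the quotient being $0$ where $Mu=0$. *ICA-solutions.* $(\mathcal I,\Phi)$ is an *ICA-solution* if the following three conditions hold. 1. $\mathcal I=\mathcal S\times\mathrm{GL}_d\subseteq\mathfrak C$, where $\mathcal S$ contains every mean-stationary signal $\mu\in\dot{\mathfrak D}$ with $\mathbb E_\mu\big(|x_0|+\int_0^1|\dot x_t|\,dt\big)^3<\infty$, independent components, at most one vanishing $\mathbb E_\mu(x_1^i-x_0^i)^3$, and $\big(\operatorname{Cov}_\mu(x_0^i,x_1^j)\big)_{ij}$ having $d$ distinct (real) eigenvalues. Moreover $\langle X\rangle_{\mathcal I}\subseteq\{M\cdot S: M\in\mathrm M_d\}$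 for every BSS-triple $(X,S,f)$ on $\mathcal I$. 2. $\Phi$ takes values in sets of Borel maps and, for all $(S,f)\in\mathcal I$, $\Phi(f\cdot S)\neq\emptyset$ and each $B\circ f$ with $B\in\Phi(f\cdot S)$ has the form $u\mapsto Mu+b$ with $M\in\mathrm M_d$, $b\in\mathbb R^d$. 3. $\emptyset\ne\{B\cdot X:B\in\Phi(X)\}\subseteq\langle X\rangle_{\mathcal I}$ for every BSS-triple $(X,S,f)$ on $\mathcal I$. *Constants.* For $d\ge2$ and a BSS-triple $(\chi,\zeta,A)$ on $\mathcal S_0\times\mathrm{GL}_d$, choose an enumeration $\sigma(1),\dots,\sigma(d)$ of $\{1,\dots,d\}$ with $\langle\zeta\rangle_{\sigma(i)\sigma(i)\sigma(i)}\neq0$ for $i\ge2$ (the term $i=1$ of $\varsigma_1$ below is $0$), and pass to the standardised cause $\tilde\zeta=N_\zeta^{-1}\cdot\zeta$, $\tilde A=AN_\zeta$, so that $\chi=A\cdot\zeta=\tilde A\cdot\tilde\zeta$ (and $\tilde\zeta=\zeta$, $\tilde A=A$ if $\langle\zeta\rangle_{ii}=1$ for all $i$). Put $A_R=R\tilde A$,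 $B_R=A_R^{-1}$, $\gamma=1+\sqrt5$, $k_d=\sqrt{\tfrac16(d-1)d(2d-1)}$, $$\varsigma_1=\tfrac1{k_d}\sqrt{\sum_{i=1}^d\frac{(i-1)^2\langle\tilde\zeta\rangle_{\sigma(i)\sigma(i)}^3}{\langle\tilde\zeta\rangle_{\sigma(i)\sigma(i)\sigma(i)}^2}},\qquad \varsigma=\sqrt{\sum_{i=1}^d\frac{\langle\tilde\zeta\rangle_{iii}^2}{\langle\tilde\zeta\rangle_{ii}^3}},\qquad \xi=\sqrt{\sum_{\nu=1}^d\|[A_R\cdot\tilde\zeta]_\nu\|^2},$$ $$r_0=\kappa_0\varsigma_1\Big[\tfrac{\|B_R\|}{\sqrt d}\big(1+\kappa_0+(1+\xi d)\kappa_0\kappa_2(B_R)\big)+\kappa_2(B_R)\varsigma\Big],$$ $$q_0=(\gamma k_dr_0)^{-1},\quad \varepsilon_0=\frac{q_0}{1+q_0},\quad c_1=2dk_dr_0,\quad c_2=\sqrt d\,\kappa_2(B_R)\,c_1 .$$ **Theorem (Blind Inversion).** (a) Let $d\ge2$, let $(\chi,\zeta,A)$ be a BSS-triple on $\mathcal S_0\times\mathrm{GL}_d$,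 and let $\kappa_0\ge\kappa_2(\bar B)$, where $\bar B$ is $(RA)^{-1}$ with its rows rescaled to unit length. If $\delta:=\delta_{\perp\!\!\!\perp}(\zeta)\le\varepsilon_0$, then $\hat\Phi(\chi)\neq\emptyset$, and for every $\theta_\star\in\hat\Phi(\chi)$ there are $M\in\mathrm M_d$ and $E\in\mathbb R^{d\times d}$ with $$\theta_\star=M(\mathrm I+E)\tilde A^{-1},\qquad \|E\|\le c_1\frac{\delta}{1-\delta},\qquad \frac{\|\theta_\star-M\tilde A^{-1}\|}{\|M\tilde A^{-1}\|}\le c_2\frac{\delta}{1-\delta}.$$ Note that $M\tilde A^{-1}=(MN_\zeta^{-1})A^{-1}$ with $MN_\zeta^{-1}\in\mathrm M_d$. Moreover $\partial_{\hat\Phi}(\zeta,A)\le c_2\frac{\delta}{1-\delta}$. (b) For every $d\ge0$ and $\kappa_0\ge1$, the pair $(\mathcal S_\star\times\mathrm{GL}_d,\hat\Phi)$ is an ICA-solution. -/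

import Mathlib

open MeasureTheory ProbabilityTheory Matrix
open scoped ENNReal

namespace RobustICA

noncomputable section

/-! ### Signals: laws on path space -/

/-- The state space `ℝ^d` with its Euclidean norm. -/
abbrev State (d : ℕ) : Type := EuclideanSpace ℝ (Fin d)

/-- The space `𝒞_d` of continuous paths `[0,1] → ℝ^d`, with the topology of uniform convergence. -/
abbrev PathSpace (d : ℕ) : Type := C(unitInterval, State d)

/-- Spaces of continuous paths carry their Borel σ-algebra. -/
instance instMeasurableSpacePaths {F : Type} [TopologicalSpace F] :
    MeasurableSpace C(unitInterval, F) := borel _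

instance instBorelSpacePaths {F : Type} [TopologicalSpace F] :
    BorelSpace C(unitInterval, F) := ⟨rfl⟩

/-- The path transformation `x ↦ (f (x_t))_t` induced by a map `f` of the state space. (Paths `x`
for which `f ∘ x` is not continuous get a junk value; for the causes considered below, these
paths form a null set.) -/
def pathMap {d : ℕ} (f : State d → State d) (x : PathSpace d) : PathSpace d :=
  open scoped Classical in
  if h : Continuous (fun t => f (x t)) then ⟨fun t => f (x t), h⟩ else x

/-- The action `f(μ) = μ ∘ f̃⁻¹` of a transformation of the state space on a signal. -/
def push {d : ℕ} (f : State d → State d) (μ : Measure (PathSpace d)) : Measure (PathSpace d) :=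
  μ.map (pathMap f)

/-- The linear map `u ↦ A u` on `ℝ^d`. -/
def linMap {d : ℕ} (A : Matrix (Fin d) (Fin d) ℝ) : State d → State d :=
  fun u => Matrix.toEuclideanCLM (n := Fin d) (𝕜 := ℝ) A u

/-- The spatial support `D_μ`: the closure of the union of the supports of the laws of `x_t`. -/
def spatialSupport {d : ℕ} (μ : Measure (PathSpace d)) : Set (State d) :=
  closure (⋃ t : unitInterval, (μ.map (fun x : PathSpace d => x t)).support)

/-! ### Causes, blind source separation, and ICA -/

/-- `f ∈ C^{0,0}(D)`: the restriction of `f` to `D` is a homeomorphism onto its image. -/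
def IsHomeoOn {d : ℕ} (f : State d → State d) (D : Set (State d)) : Prop :=
  Topology.IsEmbedding (D.domRestrict f)

/-- The causal space `ℭ` of pairs (source, mixing transformation). -/
def causalSpace (d : ℕ) : Set (Measure (PathSpace d) × (State d → State d)) :=
  {p | IsProbabilityMeasure p.1 ∧ IsHomeoOn p.2 (spatialSupport p.1)}

/-- `(X, S, f)` is a BSS-triple on the identifiability assumption `I`. -/
def IsBSSTripleOn {d : ℕ} (I : Set (Measure (PathSpace d) × (State d → State d)))
    (X S : Measure (PathSpace d)) (f : State d → State d) : Prop :=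
  (S, f) ∈ causalSpace d ∧ X = push f S ∧ (S, f) ∈ I

/-- The maximal solution `⟨X⟩_I`: all signals `g(X)` with `g ∈ C^{0,0}(D_X)` and
`(g(X), g⁻¹) ∈ I`. -/
def maximalSolution {d : ℕ} (I : Set (Measure (PathSpace d) × (State d → State d)))
    (X : Measure (PathSpace d)) : Set (Measure (PathSpace d)) :=
  {S' | ∃ g h : State d → State d, IsHomeoOn g (spatialSupport X) ∧
    (∀ u ∈ spatialSupport X, h (g u) = u) ∧ S' = push g X ∧ (S', h) ∈ I}

/-- `I` is sufficient for the accuracy bound `acc`. -/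
def IsSufficient {d : ℕ} (acc : Measure (PathSpace d) → Set (Measure (PathSpace d)))
    (I : Set (Measure (PathSpace d) × (State d → State d))) : Prop :=
  ∀ X S f, IsBSSTripleOn I X S f → maximalSolution I X ⊆ acc S

/-- `Φ` is an inversion map on `I`. -/
def IsInversionMap {d : ℕ} (I : Set (Measure (PathSpace d) × (State d → State d)))
    (Φ : Measure (PathSpace d) → Set (Measure (PathSpace d))) : Prop :=
  ∀ X S f, IsBSSTripleOn I X S f → (Φ X).Nonempty ∧ Φ X ⊆ maximalSolution I X

/-- The monomial matrices: (invertible diagonal matrix) · (permutation matrix). -/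
def IsMonomial {d : ℕ} (M : Matrix (Fin d) (Fin d) ℝ) : Prop :=
  ∃ (c : Fin d → ℝ) (τ : Equiv.Perm (Fin d)), (∀ i, c i ≠ 0) ∧
    M = Matrix.diagonal c * τ.permMatrix ℝ

/-- The monomial orbit `M_d · S` of a signal. -/
def monomialOrbit {d : ℕ} (S : Measure (PathSpace d)) : Set (Measure (PathSpace d)) :=
  {S' | ∃ M : Matrix (Fin d) (Fin d) ℝ, IsMonomial M ∧ S' = push (linMap M) S}

/-- The affine monomial transformations `u ↦ M u + b`. -/
def affineMonomialMaps (d : ℕ) : Set (State d → State d) :=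
  {h | ∃ (M : Matrix (Fin d) (Fin d) ℝ) (b : State d), IsMonomial M ∧ h = fun u => linMap M u + b}

/-- `GL_d`, as a set of transformations of `ℝ^d`. -/
def linearMixings (d : ℕ) : Set (State d → State d) :=
  {f | ∃ A : Matrix (Fin d) (Fin d) ℝ, IsUnit A.det ∧ f = linMap A}

/-! ### Absolutely continuous signals and signature moments -/

/-- The derivative `ẋ^i_t` of the `i`-th component of a path. -/
def velocity {d : ℕ} (x : PathSpace d) (i : Fin d) (t : ℝ) : ℝ :=
  deriv (fun s : ℝ => (Set.IccExtend (zero_le_one' ℝ) x s) i) t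

/-- The path `x` is absolutely continuous on `[0,1]`. -/
def IsAbsCont {d : ℕ} (x : PathSpace d) : Prop :=
  AbsolutelyContinuousOnInterval (Set.IccExtend (zero_le_one' ℝ) x) 0 1

/-- Iterated integrals over `[0,t]`, the letters being listed from the outermost integral
inwards. For absolutely continuous paths, integration against `dx^i_s` is integration
against `ẋ^i_s ds`. -/
def iteratedIntegral {d : ℕ} (x : PathSpace d) : List (Fin d) → ℝ → ℝ
  | [], _ => 1
  | i :: w, t => ∫ s in (0 : ℝ)..t, iteratedIntegral x w s * velocity x i s

/-- The signature coefficient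
`sig_{i₁⋯iₘ}(x) = ∫_{0 ≤ t₁ ≤ ⋯ ≤ tₘ ≤ 1} dx^{i₁}_{t₁} ⋯ dx^{iₘ}_{tₘ}`. -/
def sigCoeff {d : ℕ} (w : List (Fin d)) (x : PathSpace d) : ℝ :=
  iteratedIntegral x w.reverse 1

/-- The signature moment `⟨μ⟩_w`. -/
def sigMoment {d : ℕ} (μ : Measure (PathSpace d)) (w : List (Fin d)) : ℝ :=
  ∫ x, sigCoeff w x ∂μ

/-- The coredinate `[μ]₀ = (⟨μ⟩_{ij})_{ij}`. -/
def core₀ {d : ℕ} (μ : Measure (PathSpace d)) : Matrix (Fin d) (Fin d) ℝ :=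
  Matrix.of fun i j => sigMoment μ [i, j]

/-- The coredinate `[μ]_ν = (⟨μ⟩_{ijν})_{ij}`. -/
def core {d : ℕ} (μ : Measure (PathSpace d)) (ν : Fin d) : Matrix (Fin d) (Fin d) ℝ :=
  Matrix.of fun i j => sigMoment μ [i, j, ν]

/-- The signals `𝔇`: probability measures supported on the absolutely continuous paths. -/
def signals (d : ℕ) : Set (Measure (PathSpace d)) :=
  {μ | IsProbabilityMeasure μ ∧ ∀ᵐ x ∂μ, IsAbsCont x}

/-- The coredinatisable signals `𝔇̇`: all coredinates exist in `ℝ`, and `⟨μ⟩_{ii} ≠ 0`. -/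
def coreSignals (d : ℕ) : Set (Measure (PathSpace d)) :=
  {μ | μ ∈ signals d ∧ (∀ i j, Integrable (sigCoeff [i, j]) μ) ∧
    (∀ i j k, Integrable (sigCoeff [i, j, k]) μ) ∧ ∀ i, sigMoment μ [i, i] ≠ 0}

/-- The symmetrised second coredinate `C_μ = ½([μ]₀ + [μ]₀ᵀ)`. -/
def symCore {d : ℕ} (μ : Measure (PathSpace d)) : Matrix (Fin d) (Fin d) ℝ :=
  (1 / 2 : ℝ) • (core₀ μ + (core₀ μ)ᵀ)

theorem symCore_isHermitian {d : ℕ} (μ : Measure (PathSpace d)) : (symCore μ).IsHermitian := by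
  unfold symCore
  ext i j
  simp [Matrix.conjTranspose_apply, add_comm]
  ring

/-- Third-order orthogonality: the second and third signature moments vanish off the diagonal. -/
def IsOrthogonal {d : ℕ} (μ : Measure (PathSpace d)) : Prop :=
  (∀ i j, i ≠ j → sigMoment μ [i, j] = 0) ∧
    ∀ i j k, ¬(i = j ∧ j = k) → sigMoment μ [i, j, k] = 0

/-- The source class `𝒮₀`. -/
def sources (d : ℕ) : Set (Measure (PathSpace d)) :=
  {μ | μ ∈ coreSignals d ∧ IsUnit (symCore μ).det ∧
    {i : Fin d | sigMoment μ [i, i, i] = 0}.ncard ≤ 1}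

/-- The orthogonal sources `𝒮⋆`. -/
def orthogonalSources (d : ℕ) : Set (Measure (PathSpace d)) :=
  {μ | μ ∈ sources d ∧ IsOrthogonal μ}

/-! ### Matrix quantities -/

/-- The Frobenius norm. -/
def frob {d : ℕ} (A : Matrix (Fin d) (Fin d) ℝ) : ℝ :=
  √(∑ i, ∑ j, A i j ^ 2)

/-- The spectral condition number `κ₂(A) = ‖A‖₂ ‖A⁻¹‖₂`. -/
def cond₂ {d : ℕ} (A : Matrix (Fin d) (Fin d) ℝ) : ℝ :=
  ‖Matrix.toEuclideanCLM (n := Fin d) (𝕜 := ℝ) A‖ *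
    ‖Matrix.toEuclideanCLM (n := Fin d) (𝕜 := ℝ) A⁻¹‖

/-- The off-diagonality `‖A‖_× = ‖A - ddiag(A)‖`. -/
def offDiag {d : ℕ} (A : Matrix (Fin d) (Fin d) ℝ) : ℝ :=
  frob (A - Matrix.diagonal fun i => A i i)

/-- The standardisation `N_μ = ddiag(⟨μ⟩₁₁, …, ⟨μ⟩_dd)^{1/2}`. -/
def stdMatrix {d : ℕ} (μ : Measure (PathSpace d)) : Matrix (Fin d) (Fin d) ℝ :=
  Matrix.diagonal fun i => √(sigMoment μ [i, i])

/-- The whitening matrix `R_(μ) = C_μ^{-1/2} = Q Λ^{-1/2} Qᵀ`, from a spectral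
decomposition `C_μ = Q Λ Qᵀ`. -/
def whitening {d : ℕ} (μ : Measure (PathSpace d)) : Matrix (Fin d) (Fin d) ℝ :=
  let Q : Matrix (Fin d) (Fin d) ℝ := (symCore_isHermitian μ).eigenvectorUnitary
  Q * Matrix.diagonal (fun i => (√((symCore_isHermitian μ).eigenvalues i))⁻¹) * Qᵀ

/-- The matrix `A` with its rows rescaled to unit length. -/
def unitRows {d : ℕ} (A : Matrix (Fin d) (Fin d) ℝ) : Matrix (Fin d) (Fin d) ℝ :=
  (Matrix.diagonal fun i => √(∑ j, A i j ^ 2))⁻¹ * A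

/-- The IC-defect of a signal: the standardised distance of its coredinates to their diagonals. -/
def icDefect {d : ℕ} (μ : Measure (PathSpace d)) : ℝ :=
  √(frob ((stdMatrix μ)⁻¹ *
        (core₀ μ - Matrix.of fun i j => if i = j then sigMoment μ [i, j] else 0) *
        (stdMatrix μ)⁻¹) ^ 2 +
    ∑ ν, frob ((stdMatrix μ)⁻¹ * ((√(sigMoment μ [ν, ν]))⁻¹ •
        (core μ ν - Matrix.of fun i j => if i = j ∧ j = ν then sigMoment μ [i, j, ν] else 0)) *
        (stdMatrix μ)⁻¹) ^ 2)

/-! ### The contrast and the inversion map -/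

/-- The normalised statistic `𝔵₀(θ)` of an observable `χ`. -/
def stat₀ {d : ℕ} (χ : Measure (PathSpace d)) (θ : Matrix (Fin d) (Fin d) ℝ) :
    Matrix (Fin d) (Fin d) ℝ :=
  let μ := push (linMap θ) χ
  (stdMatrix μ)⁻¹ * core₀ μ * (stdMatrix μ)⁻¹

/-- The normalised statistic `𝔵_ν(θ)` of an observable `χ`. -/
def stat {d : ℕ} (χ : Measure (PathSpace d)) (ν : Fin d) (θ : Matrix (Fin d) (Fin d) ℝ) :
    Matrix (Fin d) (Fin d) ℝ :=
  let μ := push (linMap θ) χ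
  (stdMatrix μ)⁻¹ * ((√(sigMoment μ [ν, ν]))⁻¹ • core μ ν) * (stdMatrix μ)⁻¹

/-- The contrast `φ_χ(θ) = ∑_{ν=0}^d ‖𝔵_ν(θ R)‖_×²`. -/
def contrast {d : ℕ} (χ : Measure (PathSpace d)) (θ : Matrix (Fin d) (Fin d) ℝ) : ℝ :=
  offDiag (stat₀ χ (θ * whitening χ)) ^ 2 + ∑ ν, offDiag (stat χ ν (θ * whitening χ)) ^ 2

/-- The optimisation domain `Ξ₁`: invertible matrices with unit rows and `κ₂(θ) ≤ κ₀`. -/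
def domainXi (d : ℕ) (κ₀ : ℝ) : Set (Matrix (Fin d) (Fin d) ℝ) :=
  {θ | (∀ i, √(∑ j, θ i j ^ 2) = 1) ∧ IsUnit θ.det ∧ cond₂ θ ≤ κ₀}

/-- The inversion map `Φ̂(χ) = [argmin_{θ ∈ Ξ₁} φ_χ(θ)] · R_(χ)`. -/
def icaInverse {d : ℕ} (κ₀ : ℝ) (χ : Measure (PathSpace d)) :
    Set (Matrix (Fin d) (Fin d) ℝ) :=
  {θ' | ∃ θ ∈ domainXi d κ₀, (∀ η ∈ domainXi d κ₀, contrast χ θ ≤ contrast χ η) ∧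
    θ' = θ * whitening χ}

/-- The inversion map `Φ̂`, with its values viewed as sets of transformations of `ℝ^d`. -/
def icaInverseMaps {d : ℕ} (κ₀ : ℝ) (χ : Measure (PathSpace d)) : Set (State d → State d) :=
  linMap '' icaInverse κ₀ χ

/-- The deviance `∂_Φ̂(S, f)`, with values in `[0, ∞]`. (The quotient is zero where `M u = 0`.) -/
def deviance {d : ℕ} (Φ : Measure (PathSpace d) → Set (State d → State d))
    (S : Measure (PathSpace d)) (f : State d → State d) : ℝ≥0∞ :=
  ⨆ B ∈ Φ (push f S), ⨅ (M : Matrix (Fin d) (Fin d) ℝ) (_ : IsMonomial M) (v : State d),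
    ⨆ u ∈ (fun s => v + s) '' spatialSupport S,
      ENNReal.ofReal (‖B (f (u - v)) - linMap M u‖ / ‖linMap M u‖)

/-! ### ICA-conditions and ICA-solutions -/

/-- The components of the signal are mutually independent (as random paths). -/
def IsIC {d : ℕ} (μ : Measure (PathSpace d)) : Prop :=
  iIndepFun (fun (i : Fin d) (x : PathSpace d) =>
    (⟨fun t => x t i, by fun_prop⟩ : C(unitInterval, ℝ))) μ

/-- The `1`-variation norm `|x₀| + ∫₀¹ |ẋ_t| dt` of an absolutely continuous path. -/
def oneVar {d : ℕ} (x : PathSpace d) : ℝ≥0∞ :=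
  ENNReal.ofReal ‖x 0‖ +
    ∫⁻ t in Set.Icc (0 : ℝ) 1, ENNReal.ofReal (√(∑ i, velocity x i t ^ 2))

/-- Mean-stationary signals. -/
def IsMeanStationary {d : ℕ} (μ : Measure (PathSpace d)) : Prop :=
  ∀ t : unitInterval, Integrable (fun x : PathSpace d => x t) μ ∧ ∫ x, x t ∂μ = ∫ x, x 0 ∂μ

/-- The class `Ŝ_⊥` of IC signals at most one of whose third incremental moments vanishes and for
which the matrix `Cov(μ₀, μ₁)` has `d` distinct eigenvalues. -/
def smoothICSignals (d : ℕ) : Set (Measure (PathSpace d)) :=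
  {μ | IsProbabilityMeasure μ ∧ IsIC μ ∧
    {i : Fin d | ∫ x : PathSpace d, (x 1 i - x 0 i) ^ 3 ∂μ = 0}.ncard ≤ 1 ∧
    (spectrum ℝ (Matrix.of fun i j : Fin d =>
      covariance (fun x : PathSpace d => x 0 i) (fun x : PathSpace d => x 1 j) μ)).ncard = d}

/-- The signals for which coredinates are available and are diagonal under independence:
mean-stationary, coredinatisable, and with a finite third moment of the `1`-variation norm. -/
def regularSignals (d : ℕ) : Set (Measure (PathSpace d)) :=
  {μ | μ ∈ coreSignals d ∧ IsMeanStationary μ ∧ ∫⁻ x, oneVar x ^ 3 ∂μ < ∞}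

/-- `I` is an ICA-condition: `I = 𝒮 × GL_d`, where `𝒮` contains the regular signals in `Ŝ_⊥`,
and `I` is sufficient for the monomial accuracy bound. -/
def IsICACondition {d : ℕ} (I : Set (Measure (PathSpace d) × (State d → State d))) : Prop :=
  (∃ 𝒮 : Set (Measure (PathSpace d)), I = 𝒮 ×ˢ linearMixings d ∧
    smoothICSignals d ∩ regularSignals d ⊆ 𝒮) ∧
  I ⊆ causalSpace d ∧ IsSufficient monomialOrbit I

/-- `Φ` is an ICA-inversion on `I`: it takes sets of Borel maps as values, and
`∅ ≠ Φ(f(S)) ∘ f ⊆ M̃_d` for each `(S, f) ∈ I`. -/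
def IsICAInversion {d : ℕ} (I : Set (Measure (PathSpace d) × (State d → State d)))
    (Φ : Measure (PathSpace d) → Set (State d → State d)) : Prop :=
  (∀ X, ∀ B ∈ Φ X, Measurable B) ∧
  ∀ S f, (S, f) ∈ I → (Φ (push f S)).Nonempty ∧ ∀ B ∈ Φ (push f S), B ∘ f ∈ affineMonomialMaps d

/-- `(I, Φ)` is an ICA-solution: `I` is an ICA-condition, `Φ` is an ICA-inversion on `I`, and
`X ↦ Φ(X) · X` is an inversion map on `I`. -/
def IsICASolution {d : ℕ} (I : Set (Measure (PathSpace d) × (State d → State d)))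
    (Φ : Measure (PathSpace d) → Set (State d → State d)) : Prop :=
  IsICACondition I ∧ IsICAInversion I Φ ∧ IsInversionMap I fun X => (fun B => push B X) '' Φ X

/-! ### The constants -/

/-- `A_R = R A`, where `R` is the whitening matrix of the observable `A · ζ`. -/
def whitenedMixing {d : ℕ} (ζ : Measure (PathSpace d)) (A : Matrix (Fin d) (Fin d) ℝ) :
    Matrix (Fin d) (Fin d) ℝ :=
  whitening (push (linMap A) ζ) * A

/-- `B_R = (A_R)⁻¹`. -/
def whitenedUnmixing {d : ℕ} (ζ : Measure (PathSpace d)) (A : Matrix (Fin d) (Fin d) ℝ) :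
    Matrix (Fin d) (Fin d) ℝ :=
  (whitenedMixing ζ A)⁻¹

/-- `k_d = √((d-1) d (2d-1) / 6)`. -/
def kConst (d : ℕ) : ℝ := √((1 / 6 : ℝ) * ((d : ℝ) - 1) * d * (2 * (d : ℝ) - 1))

/-- `ς₁ = k_d⁻¹ √(∑_i (i-1)² ⟨ζ⟩_{ii}³ / ⟨ζ⟩_{iii}²)`, where the components of `ζ` are enumerated
in the order `σ(1), …, σ(d)`; the index type `Fin d` starts at zero. -/
def varsigma₁ {d : ℕ} (σ : Equiv.Perm (Fin d)) (ζ : Measure (PathSpace d)) : ℝ :=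
  (kConst d)⁻¹ * √(∑ i : Fin d, ((i : ℕ) : ℝ) ^ 2 * sigMoment ζ [σ i, σ i] ^ 3 /
    sigMoment ζ [σ i, σ i, σ i] ^ 2)

/-- `ς = √(∑_i ⟨ζ⟩_{iii}² / ⟨ζ⟩_{ii}³)`. -/
def varsigma {d : ℕ} (ζ : Measure (PathSpace d)) : ℝ :=
  √(∑ i : Fin d, sigMoment ζ [i, i, i] ^ 2 / sigMoment ζ [i, i] ^ 3)

/-- `ξ = √(∑_ν ‖[A_R · ζ]_ν‖²)`. -/
def xiConst {d : ℕ} (ζ : Measure (PathSpace d)) (A : Matrix (Fin d) (Fin d) ℝ) : ℝ :=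
  √(∑ ν, frob (core (push (linMap (whitenedMixing ζ A)) ζ) ν) ^ 2)

/-- The constant `r₀`. -/
def r₀Const {d : ℕ} (κ₀ : ℝ) (σ : Equiv.Perm (Fin d)) (ζ : Measure (PathSpace d))
    (A : Matrix (Fin d) (Fin d) ℝ) : ℝ :=
  κ₀ * varsigma₁ σ ζ *
    (frob (whitenedUnmixing ζ A) / √d *
        (1 + κ₀ + (1 + xiConst ζ A * d) * κ₀ * cond₂ (whitenedUnmixing ζ A)) +
      cond₂ (whitenedUnmixing ζ A) * varsigma ζ)

/-- `q₀ = (γ k_d r₀)⁻¹` with `γ = 1 + √5`. -/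
def q₀Const {d : ℕ} (κ₀ : ℝ) (σ : Equiv.Perm (Fin d)) (ζ : Measure (PathSpace d))
    (A : Matrix (Fin d) (Fin d) ℝ) : ℝ :=
  ((1 + √5) * kConst d * r₀Const κ₀ σ ζ A)⁻¹

/-- The threshold `ε₀ = q₀ / (1 + q₀)`. -/
def ε₀Const {d : ℕ} (κ₀ : ℝ) (σ : Equiv.Perm (Fin d)) (ζ : Measure (PathSpace d))
    (A : Matrix (Fin d) (Fin d) ℝ) : ℝ :=
  q₀Const κ₀ σ ζ A / (1 + q₀Const κ₀ σ ζ A)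

/-- `c₁ = 2 d k_d r₀`. -/
def c₁Const {d : ℕ} (κ₀ : ℝ) (σ : Equiv.Perm (Fin d)) (ζ : Measure (PathSpace d))
    (A : Matrix (Fin d) (Fin d) ℝ) : ℝ :=
  2 * d * kConst d * r₀Const κ₀ σ ζ A

/-- `c₂ = √d κ₂(B_R) c₁`. -/
def c₂Const {d : ℕ} (κ₀ : ℝ) (σ : Equiv.Perm (Fin d)) (ζ : Measure (PathSpace d))
    (A : Matrix (Fin d) (Fin d) ℝ) : ℝ :=
  √d * cond₂ (whitenedUnmixing ζ A) * c₁Const κ₀ σ ζ A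

/-- The standardised source `ζ̃ = N_ζ⁻¹ · ζ`. -/
def stdSource {d : ℕ} (ζ : Measure (PathSpace d)) : Measure (PathSpace d) :=
  push (linMap (stdMatrix ζ)⁻¹) ζ

/-- The mixing matrix `Ã = A N_ζ` of the standardised source: `A · ζ = Ã · ζ̃`. -/
def stdMixing {d : ℕ} (ζ : Measure (PathSpace d)) (A : Matrix (Fin d) (Fin d) ℝ) :
    Matrix (Fin d) (Fin d) ℝ :=
  A * stdMatrix ζ

end

end RobustICA

/-! Signature moments of orders two and three transform as tensors. For G = θRÃ and the standardised
source z = ζ̃ this reads [G·z]₀ = G[z]₀Gᵀ and [G·z]_ν = G(∑ₖ G_νk [z]ₖ)Gᵀ. On Ξ₁ whitening makes the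
normalisations in the contrast trivial, so φ is the total squared off-diagonality of the coredinates
of G·z. The point B_R = Ã⁻¹R⁻¹ lies in Ξ₁ and sends the observable back to z, hence its contrast is
at most δ², and so is that of every minimiser. Minimisers exist because Ξ₁ is compact.

The rest is approximate joint diagonalisation. For a minimiser both z and G·z are δ-close to
diagonal. The second-order relation makes G nearly orthogonal (`sq_norm_le_of_congruence`). At most
one third moment m_k vanishes, so weights w_k exist for which the numbers l_k = w_k m_k are 0, 1, …,
d-1 in some order. The matching combination of the third-order relations, with Gᵀ replaced by G⁻¹ up
to small errors, becomes G diag(l) - D G = G P with P small (`exists_left_eigenvector_equation`).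
The rows of G are thus left eigenvectors of a small perturbation of a diagonal matrix with gaps at
least 1. Each row concentrates on one column, and an eigenvalue count gives different rows different
columns (`exists_perm_of_left_eigenvectors`). Hence G = M(I+E) with M monomial
(`exists_monomial_mul_one_add`). Since also ME = E'M with E' small, the relative error and the
deviance are controlled by E'. The constants of the theorem enter only through k_d r₀ ≥ 3(|w| + d -
1) (`kConst_mul_r₀Const_ge`, `defect_bounds`).

For orthogonal sources δ = 0, all errors vanish, and the same algebra gives exact identifiability
and exact inversion. Regular signals with independent components are orthogonal
(`IsIC.isOrthogonal`): mean-stationarity gives E ẋ_t = 0 for almost every t, and in every mixed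
moment some velocity factors out with mean zero. -/

namespace RobustICA

/-! ### Approximate joint diagonalisation by congruence; here `‖·‖` is the spectral norm. -/

section LinearAlgebra

open scoped Matrix.Norms.L2Operator

variable {d : ℕ}

theorem frob_nonneg (A : Matrix (Fin d) (Fin d) ℝ) : 0 ≤ frob A := Real.sqrt_nonneg _

theorem frob_sq (A : Matrix (Fin d) (Fin d) ℝ) : frob A ^ 2 = ∑ i, ∑ j, A i j ^ 2 :=
  Real.sq_sqrt (Finset.sum_nonneg fun _ _ => Finset.sum_nonneg fun _ _ => sq_nonneg _)

theorem abs_entry_le_frob (A : Matrix (Fin d) (Fin d) ℝ) (i j : Fin d) : |A i j| ≤ frob A := by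
  refine Real.abs_le_sqrt ?_
  calc A i j ^ 2 ≤ ∑ j, A i j ^ 2 :=
        Finset.single_le_sum (f := fun j => A i j ^ 2) (fun _ _ => sq_nonneg _) (Finset.mem_univ j)
    _ ≤ _ := Finset.single_le_sum (f := fun i => ∑ j, A i j ^ 2)
        (fun _ _ => Finset.sum_nonneg fun _ _ => sq_nonneg _) (Finset.mem_univ i)

theorem sum_mulVec_sq_le (A : Matrix (Fin d) (Fin d) ℝ) (x : Fin d → ℝ) :
    ∑ i, (A *ᵥ x) i ^ 2 ≤ ‖A‖ ^ 2 * ∑ i, x i ^ 2 := by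
  have h := A.l2_opNorm_mulVec (WithLp.toLp 2 x)
  have h2 := pow_le_pow_left₀ (norm_nonneg _) h 2
  rw [mul_pow, EuclideanSpace.norm_sq_eq, EuclideanSpace.norm_sq_eq] at h2
  simpa [EuclideanSpace.equiv] using h2

theorem norm_le_of_sum_mulVec_sq_le (A : Matrix (Fin d) (Fin d) ℝ) (c : ℝ) (hc : 0 ≤ c)
    (h : ∀ x : Fin d → ℝ, ∑ i, (A *ᵥ x) i ^ 2 ≤ c ^ 2 * ∑ i, x i ^ 2) : ‖A‖ ≤ c := by
  rw [Matrix.cstar_norm_def]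
  refine ContinuousLinearMap.opNorm_le_bound _ hc fun x => ?_
  refine (pow_le_pow_iff_left₀ (norm_nonneg _) (by positivity) two_ne_zero).1 ?_
  rw [mul_pow, EuclideanSpace.norm_sq_eq, EuclideanSpace.norm_sq_eq]
  simpa [Matrix.ofLp_toEuclideanCLM] using h x

theorem norm_le_frob (A : Matrix (Fin d) (Fin d) ℝ) : ‖A‖ ≤ frob A := by
  refine norm_le_of_sum_mulVec_sq_le A _ (frob_nonneg A) fun x => ?_
  rw [frob_sq, Finset.sum_mul]
  exact Finset.sum_le_sum fun i _ => Finset.sum_mul_sq_le_sq_mul_sq Finset.univ (A i) x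

theorem norm_transpose_eq (A : Matrix (Fin d) (Fin d) ℝ) : ‖Aᵀ‖ = ‖A‖ := by
  rw [← Matrix.conjTranspose_eq_transpose_of_trivial, Matrix.l2_opNorm_conjTranspose]

theorem norm_mul_transpose_self (A : Matrix (Fin d) (Fin d) ℝ) : ‖A * Aᵀ‖ = ‖A‖ ^ 2 := by
  have := Matrix.l2_opNorm_conjTranspose_mul_self Aᵀ
  rw [Matrix.conjTranspose_eq_transpose_of_trivial, transpose_transpose, norm_transpose_eq] at this
  rw [this, sq]

/-- Only an inequality, because for d = 0 the identity has norm 0. -/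
theorem norm_one_le : ‖(1 : Matrix (Fin d) (Fin d) ℝ)‖ ≤ 1 := by
  refine norm_le_of_sum_mulVec_sq_le 1 1 zero_le_one fun x => ?_
  simp

theorem norm_diagonal_le (v : Fin d → ℝ) (c : ℝ) (hc : 0 ≤ c) (h : ∀ i, |v i| ≤ c) :
    ‖(diagonal v : Matrix (Fin d) (Fin d) ℝ)‖ ≤ c := by
  rw [Matrix.l2_opNorm_diagonal]
  exact (pi_norm_le_iff_of_nonneg hc).2 h

theorem abs_entry_le_norm (A : Matrix (Fin d) (Fin d) ℝ) (i j : Fin d) : |A i j| ≤ ‖A‖ := by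
  have h := sum_mulVec_sq_le A (Pi.single j 1)
  have h1 : ∑ k, (Pi.single j (1:ℝ) : Fin d → ℝ) k ^ 2 = 1 := by
    simp [Pi.single_apply]
  rw [h1, mul_one] at h
  refine abs_le_of_sq_le_sq ?_ (norm_nonneg _)
  refine le_trans ?_ h
  have := Finset.single_le_sum (f := fun k => (A *ᵥ (Pi.single j 1)) k ^ 2)
    (fun _ _ => sq_nonneg _) (Finset.mem_univ i)
  simpa using this

/-- Cauchy–Schwarz in k. Defect and contrast bound sums of squares over ν, and this turns such a
bound into one for any linear combination of the third-order errors. -/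
theorem norm_sum_smul_le (w : Fin d → ℝ) (X : Fin d → Matrix (Fin d) (Fin d) ℝ) :
    ‖∑ k, w k • X k‖ ≤ √(∑ k, w k ^ 2) * √(∑ k, frob (X k) ^ 2) := by
  calc ‖∑ k, w k • X k‖ ≤ ∑ k, |w k| * frob (X k) := by
        refine norm_sum_le_of_le _ fun k _ => ?_
        rw [norm_smul, Real.norm_eq_abs]
        exact mul_le_mul_of_nonneg_left (norm_le_frob _) (abs_nonneg _)
    _ ≤ _ := by
        have := Real.sum_mul_le_sqrt_mul_sqrt Finset.univ (fun k => |w k|) (fun k => frob (X k))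
        simpa only [sq_abs] using this

theorem sum_vecMul_sq_le (A : Matrix (Fin d) (Fin d) ℝ) (x : Fin d → ℝ) :
    ∑ i, (x ᵥ* A) i ^ 2 ≤ ‖A‖ ^ 2 * ∑ i, x i ^ 2 := by
  rw [← norm_transpose_eq, ← mulVec_transpose]
  exact sum_mulVec_sq_le _ _

theorem exists_row_entry_ne_zero {G : Matrix (Fin d) (Fin d) ℝ} (hG : IsUnit G.det) (ν : Fin d) :
    ∃ j, G ν j ≠ 0 := by
  by_contra! h
  exact hG.ne_zero (Matrix.det_eq_zero_of_row_eq_zero ν h)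

theorem sum_row_sq_pos {G : Matrix (Fin d) (Fin d) ℝ} (hG : IsUnit G.det) (ν : Fin d) :
    0 < ∑ j, G ν j ^ 2 := by
  obtain ⟨j, hj⟩ := exists_row_entry_ne_zero hG ν
  exact Finset.sum_pos' (fun _ _ => sq_nonneg _) ⟨j, Finset.mem_univ j, by positivity⟩

/-- The determinant does not change its sign under perturbations that keep it from vanishing. -/
theorem det_diagonal_sub_mul_pos (v : Fin d → ℝ) (P : Matrix (Fin d) (Fin d) ℝ) (hP : ‖P‖ < 1 / 2)
    (hv : ∀ i, 1 / 2 ≤ |v i|) : 0 < (∏ i, v i) * (diagonal v - P).det := by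
  -- The segment from diag(v) to diag(v) - P stays invertible: a null vector x would satisfy
  -- |diag(v)x| = t|Px| < |x|/2 ≤ |diag(v)x|.
  have hne : ∀ t ∈ Set.Icc (0 : ℝ) 1, (diagonal v - t • P).det ≠ 0 := by
    intro t ht h0
    obtain ⟨x, hx, hx0⟩ := Matrix.exists_mulVec_eq_zero_iff.2 h0
    have h1 : diagonal v *ᵥ x = t • (P *ᵥ x) := by
      rw [Matrix.sub_mulVec, Matrix.smul_mulVec, sub_eq_zero] at hx0
      exact hx0
    have h2 := sum_mulVec_sq_le P x
    have hpos : 0 < ∑ i, x i ^ 2 := by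
      obtain ⟨j, hj⟩ := Function.ne_iff.1 hx
      refine Finset.sum_pos' (fun _ _ => sq_nonneg _) ⟨j, Finset.mem_univ j, ?_⟩
      have : x j ≠ 0 := hj
      positivity
    have h3 : ∑ i, (v i * x i) ^ 2 ≤ ∑ i, (P *ᵥ x) i ^ 2 := by
      refine Finset.sum_le_sum fun i _ => ?_
      have := congrFun h1 i
      rw [mulVec_diagonal, Pi.smul_apply, smul_eq_mul] at this
      rw [this, mul_pow]
      have : t ^ 2 ≤ 1 := pow_le_one₀ ht.1 ht.2
      nlinarith [sq_nonneg ((P *ᵥ x) i)]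
    have h4 : (1 / 4) * ∑ i, x i ^ 2 ≤ ∑ i, (v i * x i) ^ 2 := by
      rw [Finset.mul_sum]
      refine Finset.sum_le_sum fun i _ => ?_
      have : (1 / 2 : ℝ) ^ 2 ≤ v i ^ 2 := by
        rw [← sq_abs (v i)]; exact pow_le_pow_left₀ (by norm_num) (hv i) 2
      nlinarith [sq_nonneg (x i)]
    have h5 : ‖P‖ ^ 2 < 1 / 4 := by nlinarith [norm_nonneg P]
    nlinarith
  have hcont : Continuous fun t : ℝ => (diagonal v - t • P).det := by fun_prop
  have h0 : (fun t : ℝ => (diagonal v - t • P).det) 0 = ∏ i, v i := by simp [det_diagonal]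
  have h1 : (fun t : ℝ => (diagonal v - t • P).det) 1 = (diagonal v - P).det := by simp
  rw [← h0, ← h1]
  by_contra! hle
  have hmem : (0 : ℝ) ∈ (fun t : ℝ => (diagonal v - t • P).det) '' Set.Icc 0 1 := by
    rcases mul_nonpos_iff.1 hle with h | h
    · exact intermediate_value_Icc' zero_le_one hcont.continuousOn ⟨h.2, h.1⟩
    · exact intermediate_value_Icc zero_le_one hcont.continuousOn ⟨h.1, h.2⟩
  obtain ⟨t, ht, h⟩ := hmem
  exact hne t ht h

/-- If the rows of an invertible `G` are left eigenvectors of a small perturbation of a diagonal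
matrix with well-separated entries, then `G` is close to a monomial matrix. -/
theorem exists_perm_of_left_eigenvectors (l D : Fin d → ℝ) (G P : Matrix (Fin d) (Fin d) ℝ)
    (hG : IsUnit G.det) (hsep : ∀ i j, i ≠ j → 1 ≤ |l i - l j|)
    (h : G * diagonal l - diagonal D * G = G * P) (ρ : ℝ) (hρ : ρ < 1 / 2) (hP : ‖P‖ ≤ ρ) :
    ∃ τ : Equiv.Perm (Fin d), ∀ ν, G ν (τ ν) ≠ 0 ∧
      (1 - 2 * ρ) * ∑ j ∈ Finset.univ.erase (τ ν), G ν j ^ 2 ≤ ρ ^ 2 * G ν (τ ν) ^ 2 := by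
  have hρ0 : 0 ≤ ρ := (norm_nonneg P).trans hP
  -- Row ν of the relation `h` reads G_νj (l_j - D_ν) = (G_ν P)_j, and P has norm at most ρ.
  have hrow : ∀ ν, ∑ j, (G ν j * (l j - D ν)) ^ 2 ≤ ρ ^ 2 * ∑ j, G ν j ^ 2 := by
    intro ν
    have h1 : ∀ j, G ν j * (l j - D ν) = (G ν ᵥ* P) j := by
      intro j
      have := congrFun (congrFun h ν) j
      rw [Matrix.sub_apply, Matrix.mul_diagonal, Matrix.diagonal_mul] at this
      rw [mul_sub, mul_comm (G ν j) (D ν), this]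
      rfl
    simp_rw [h1]
    refine (sum_vecMul_sq_le P (G ν)).trans ?_
    exact mul_le_mul_of_nonneg_right (pow_le_pow_left₀ (norm_nonneg _) hP 2)
      (Finset.sum_nonneg fun _ _ => sq_nonneg _)
  -- If D_ν were farther than ρ from every l_k, the row would be stretched by more than ρ.
  have hex : ∀ ν, ∃ k, |l k - D ν| ≤ ρ := by
    intro ν
    by_contra! hlt
    have h1 : ∑ j, (G ν j * (l j - D ν)) ^ 2 > ρ ^ 2 * ∑ j, G ν j ^ 2 := by
      rw [Finset.mul_sum]
      have hq : ∀ k, ρ ^ 2 < (l k - D ν) ^ 2 := fun k => by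
        rw [← sq_abs (l k - D ν)]; exact pow_lt_pow_left₀ (hlt k) hρ0 two_ne_zero
      obtain ⟨j, hj⟩ := exists_row_entry_ne_zero hG ν
      refine Finset.sum_lt_sum (fun k _ => ?_) ⟨j, Finset.mem_univ j, ?_⟩
      · nlinarith [hq k, sq_nonneg (G ν k)]
      · have : 0 < G ν j ^ 2 := by positivity
        nlinarith [hq j]
    exact absurd (hrow ν) (not_le.2 h1)
  choose τ hτ using hex
  have hsurj : Function.Surjective τ := by
    intro k
    -- Surjectivity is an eigenvalue count: diag(l) - P is similar to diag(D). At x = l_k ± 1/2 its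
    -- characteristic determinant has the sign of ∏(l_i - x), and this sign changes between the two
    -- points. So ∏(D_ν - x) changes sign as well, which needs some D_ν within 1/2 of l_k.
    have hconj : ∀ x, (diagonal (fun i => l i - x) - P).det = ∏ ν, (D ν - x) := by
      intro x
      have e : G * (diagonal (fun i => l i - x) - P) = diagonal (fun ν => D ν - x) * G := by
        have e1 : (diagonal fun i => l i - x) =
            diagonal l - x • (1 : Matrix (Fin d) (Fin d) ℝ) := by
          rw [smul_one_eq_diagonal, diagonal_sub]
        have e2 : (diagonal fun i => D i - x) =
            diagonal D - x • (1 : Matrix (Fin d) (Fin d) ℝ) := by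
          rw [smul_one_eq_diagonal, diagonal_sub]
        rw [e1, e2, mul_sub, mul_sub, sub_mul, ← h]
        simp only [mul_smul_comm, mul_one, smul_mul_assoc, one_mul]
        abel
      have e' := congrArg Matrix.det e
      rw [det_mul, det_mul, det_diagonal, mul_comm] at e'
      exact mul_right_cancel₀ hG.ne_zero e'
    have hP' : ‖P‖ < 1 / 2 := hP.trans_lt hρ
    have habs : ∀ (η : ℝ), |η| = 1 / 2 → ∀ i, 1 / 2 ≤ |l i - (l k + η)| := by
      intro η hη i
      by_cases hik : i = k
      · subst hik; rw [sub_add_cancel_left, abs_neg, hη]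
      · have h1 := hsep i k hik
        have h2 := abs_sub_abs_le_abs_sub (l i - l k) η
        rw [hη] at h2
        rw [← sub_sub]
        linarith
    have hplus := det_diagonal_sub_mul_pos _ P hP' (habs (1 / 2) (by norm_num))
    have hminus := det_diagonal_sub_mul_pos _ P hP' (habs (-(1 / 2)) (by norm_num))
    rw [hconj] at hplus hminus
    by_contra! hno
    have hfar : ∀ ν, 1 / 4 ≤ (D ν - l k) ^ 2 := by
      intro ν
      by_contra! hlt
      have h1 : |D ν - l k| < 1 / 2 := abs_lt_of_sq_lt_sq (by norm_num; linarith) (by norm_num)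
      have h2 := hno ν
      have h3 := hsep _ _ h2
      have h4 := abs_sub_le (l (τ ν)) (D ν) (l k)
      linarith [hτ ν]
    have hprod := mul_pos hplus hminus
    -- The factor i = k of the combined product is -1/4; the others are (l_i - l_k)² - 1/4 > 0. The
    -- corresponding factors for D are (D_i - l_k)² - 1/4 ≥ 0.
    have hA : (∏ i, (l i - (l k + 1 / 2))) * ∏ i, (l i - (l k + -(1 / 2))) ≤ 0 := by
      rw [← Finset.prod_mul_distrib, ← Finset.mul_prod_erase _ _ (Finset.mem_univ k)]
      refine mul_nonpos_of_nonpos_of_nonneg (by ring_nf; norm_num)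
        (Finset.prod_nonneg fun i hi => ?_)
      have h1 := hsep i k (Finset.ne_of_mem_erase hi)
      have h2 : 1 ≤ (l i - l k) ^ 2 := by
        rw [← sq_abs]; exact one_le_pow₀ h1
      nlinarith
    have hB : 0 ≤ (∏ i, (D i - (l k + 1 / 2))) * ∏ i, (D i - (l k + -(1 / 2))) := by
      rw [← Finset.prod_mul_distrib]
      refine Finset.prod_nonneg fun i _ => ?_
      nlinarith [hfar i]
    nlinarith
  refine ⟨Equiv.ofBijective τ (Finite.surjective_iff_bijective.1 hsurj), fun ν => ?_⟩
  change G ν (τ ν) ≠ 0 ∧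
      (1 - 2 * ρ) * ∑ j ∈ Finset.univ.erase (τ ν), G ν j ^ 2 ≤ ρ ^ 2 * G ν (τ ν) ^ 2
  have hr := hrow ν
  have hsplit : ∑ j, G ν j ^ 2 = G ν (τ ν) ^ 2 + ∑ j ∈ Finset.univ.erase (τ ν), G ν j ^ 2 :=
    (Finset.add_sum_erase _ _ (Finset.mem_univ _)).symm
  -- Off the column τ(ν) the gap to D_ν is at least 1 - ρ. Combined with `hrow`, and with (1-ρ)² -
  -- ρ² = 1 - 2ρ, this gives the claimed concentration.
  have hlow : (1 - ρ) ^ 2 * ∑ j ∈ Finset.univ.erase (τ ν), G ν j ^ 2 ≤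
      ∑ j, (G ν j * (l j - D ν)) ^ 2 := by
    rw [Finset.mul_sum]
    refine (Finset.sum_le_sum fun j hj => ?_).trans (Finset.sum_le_sum_of_subset_of_nonneg
      (Finset.erase_subset (τ ν) Finset.univ) fun _ _ _ => sq_nonneg _)
    have h1 := hsep j (τ ν) (Finset.ne_of_mem_erase hj)
    have h2 := abs_sub_le (l j) (D ν) (l (τ ν))
    rw [abs_sub_comm (D ν)] at h2
    have h3 : 1 - ρ ≤ |l j - D ν| := by linarith [hτ ν]
    have h4 : (1 - ρ) ^ 2 ≤ (l j - D ν) ^ 2 := by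
      rw [← sq_abs (l j - D ν)]; exact pow_le_pow_left₀ (by linarith) h3 2
    nlinarith [sq_nonneg (G ν j)]
  have hmain : (1 - 2 * ρ) * ∑ j ∈ Finset.univ.erase (τ ν), G ν j ^ 2 ≤ ρ ^ 2 * G ν (τ ν) ^ 2 := by
    rw [hsplit] at hr
    nlinarith
  refine ⟨fun h0 => ?_, hmain⟩
  rw [h0] at hmain hsplit
  have := sum_row_sq_pos hG ν
  nlinarith

/-- Here GGᵀ = 1 + O₀ - G D₀ Gᵀ and ‖G‖² = ‖GGᵀ‖, so ‖G‖²(1 - δ) ≤ 1 + δ. The estimate is used for G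
and, with D₀ and O₀ exchanged, for G⁻¹. -/
theorem sq_norm_le_of_congruence {G D₀ O₀ : Matrix (Fin d) (Fin d) ℝ} {δ : ℝ} (hδ : δ < 1)
    (h₀ : G * (1 + D₀) * Gᵀ = 1 + O₀) (hD₀ : ‖D₀‖ ≤ δ) (hO₀ : ‖O₀‖ ≤ δ) :
    ‖G‖ ^ 2 ≤ (1 + δ) / (1 - δ) := by
  have e : G * Gᵀ = 1 + O₀ - G * D₀ * Gᵀ := by
    rw [← h₀]; noncomm_ring
  have h1 : ‖G‖ ^ 2 ≤ 1 + δ + ‖G‖ ^ 2 * δ := by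
    calc ‖G‖ ^ 2 = ‖1 + O₀ - G * D₀ * Gᵀ‖ := by rw [← norm_mul_transpose_self, e]
      _ ≤ ‖(1 : Matrix (Fin d) (Fin d) ℝ)‖ + ‖O₀‖ + ‖G * D₀ * Gᵀ‖ :=
        (norm_sub_le _ _).trans (add_le_add_left (norm_add_le _ _) _)
      _ ≤ 1 + δ + ‖G‖ * ‖D₀‖ * ‖Gᵀ‖ := by
        refine add_le_add (add_le_add norm_one_le hO₀) ((norm_mul_le _ _).trans ?_)
        exact mul_le_mul_of_nonneg_right (norm_mul_le _ _) (norm_nonneg _)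
      _ ≤ _ := by
        rw [norm_transpose_eq]
        nlinarith [mul_le_mul_of_nonneg_left hD₀ (sq_nonneg ‖G‖)]
  rw [le_div_iff₀ (by linarith)]
  linarith

/-- Simultaneous approximate congruence diagonalisation: the diagonalising matrix nearly satisfies
a left eigenvector equation. -/
theorem exists_left_eigenvector_equation {G D₀ O₀ : Matrix (Fin d) (Fin d) ℝ}
    {Δ O : Fin d → Matrix (Fin d) (Fin d) ℝ} {m w l : Fin d → ℝ} {μ : Fin d → Fin d → ℝ}
    {δ L : ℝ} (hG : IsUnit G.det) (hδ0 : 0 ≤ δ) (hδ : δ ≤ 0.095)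
    (h₀ : G * (1 + D₀) * Gᵀ = 1 + O₀)
    (h₃ : ∀ ν, G * (∑ k, G ν k • (diagonal (Pi.single k (m k)) + Δ k)) * Gᵀ =
      diagonal (μ ν) + O ν)
    (hD₀ : ‖D₀‖ ≤ δ) (hO₀ : ‖O₀‖ ≤ δ) (hΔ : √(∑ k, frob (Δ k) ^ 2) ≤ δ)
    (hO : √(∑ k, frob (O k) ^ 2) ≤ δ) (hOdiag : ∀ ν i, O ν i i = 0) (hl : ∀ k, l k = w k * m k)
    (hL0 : 0 ≤ L) (hL : ∀ k, |l k| ≤ L) :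
    ‖G‖ ≤ 1.1 ∧ ‖G⁻¹‖ ≤ 1.1 ∧ ∃ (D : Fin d → ℝ) (P : Matrix (Fin d) (Fin d) ℝ),
      G * diagonal l - diagonal D * G = G * P ∧
      ‖P‖ ≤ 2.5 * (δ / (1 - δ) * (√(∑ k, w k ^ 2) + L)) := by
  have hGH : G * G⁻¹ = 1 := mul_nonsing_inv _ hG
  have hHG : G⁻¹ * G = 1 := nonsing_inv_mul _ hG
  set H := G⁻¹ with hH
  have hGHt : Hᵀ * Gᵀ = 1 := by rw [← transpose_mul, hGH, transpose_one]
  have hHGt : Gᵀ * Hᵀ = 1 := by rw [← transpose_mul, hHG, transpose_one]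
  set s := √(∑ k, w k ^ 2) with hs
  have hs0 : 0 ≤ s := Real.sqrt_nonneg _
  have h₀' : H * (1 + O₀) * Hᵀ = 1 + D₀ := by
    rw [← h₀]
    calc H * (G * (1 + D₀) * Gᵀ) * Hᵀ = (H * G) * (1 + D₀) * (Gᵀ * Hᵀ) := by
          simp only [mul_assoc]
      _ = _ := by rw [hHG, hHGt, one_mul, mul_one]
  -- The threshold 0.095 is chosen for this: 1.095 / 0.905 ≤ 1.21.
  have hfrac : (1 + δ) / (1 - δ) ≤ 1.1 ^ 2 := by
    rw [div_le_iff₀ (by linarith)]; linarith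
  have hGn : ‖G‖ ≤ 1.1 := (pow_le_pow_iff_left₀ (norm_nonneg _) (by norm_num) two_ne_zero).1
    ((sq_norm_le_of_congruence (by linarith) h₀ hD₀ hO₀).trans hfrac)
  have hHn : ‖H‖ ≤ 1.1 := (pow_le_pow_iff_left₀ (norm_nonneg _) (by norm_num) two_ne_zero).1
    ((sq_norm_le_of_congruence (by linarith) h₀' hO₀ hD₀).trans hfrac)
  refine ⟨hGn, hHn, ?_⟩
  -- the combination of the third-order relations with weights `a = G⁻ᵀ w`
  set a : Fin d → ℝ := w ᵥ* H with ha
  have haG : a ᵥ* G = w := by rw [ha, vecMul_vecMul, hHG, vecMul_one]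
  set D : Fin d → ℝ := fun i => ∑ ν, a ν * μ ν i with hD
  set Da : Matrix (Fin d) (Fin d) ℝ := ∑ k, w k • Δ k with hDa
  set Oa : Matrix (Fin d) (Fin d) ℝ := ∑ ν, a ν • O ν with hOa
  -- Because aG = w, the inner sum has leading term ∑ w_k m_k e_k e_kᵀ = diag(l).
  have hcomb : G * (diagonal l + Da) * Gᵀ = diagonal D + Oa := by
    have e1 : ∑ ν, a ν • (∑ k, G ν k • (diagonal (Pi.single k (m k)) + Δ k)) =
        diagonal l + Da := by
      simp_rw [Finset.smul_sum, smul_smul]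
      rw [Finset.sum_comm]
      simp_rw [← Finset.sum_smul]
      have e2 : ∀ k, ∑ ν, a ν * G ν k = w k := fun k => congrFun haG k
      simp_rw [e2, smul_add, Finset.sum_add_distrib]
      congr 1
      ext i j
      rw [Matrix.sum_apply]
      by_cases hij : i = j
      · subst hij
        simp only [Matrix.smul_apply, diagonal_apply_eq, smul_eq_mul, hl]
        rw [Finset.sum_eq_single i]
        · simp
        · intro b _ hb; simp [Pi.single_eq_of_ne hb.symm]
        · simp
      · simp [diagonal_apply_ne _ hij]
    have e3 : diagonal D = ∑ ν, a ν • diagonal (μ ν) := by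
      ext i j
      rw [Matrix.sum_apply]
      by_cases hij : i = j
      · subst hij; simp [hD]
      · simp [diagonal_apply_ne _ hij]
    rw [← e1, e3, hOa, ← Finset.sum_add_distrib, Finset.mul_sum, Finset.sum_mul]
    refine Finset.sum_congr rfl fun ν _ => ?_
    rw [mul_smul_comm, smul_mul_assoc, h₃, smul_add]
  refine ⟨D, diagonal l - H * diagonal D * G, ?_, ?_⟩
  · calc G * diagonal l - diagonal D * G = G * diagonal l - (G * H) * diagonal D * G := by
          rw [hGH, one_mul]
      _ = _ := by noncomm_ring
  set Λ := diagonal l with hΛ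
  -- The third-order relation gives Λ + Da = H(D + Oa)Hᵀ, and the second-order one, G(1 + D₀) = (1 +
  -- O₀)Hᵀ, trades Hᵀ for G. The perturbation reappears on the right only multiplied by D₀, so its
  -- norm can be absorbed.
  have hPeq : Λ - H * diagonal D * G =
      Λ * D₀ - Da + H * Oa * Hᵀ - H * diagonal D * O₀ * Hᵀ - (Λ - H * diagonal D * G) * D₀ := by
    have e1 : Λ + Da = H * (diagonal D + Oa) * Hᵀ := by
      rw [← hcomb]
      calc Λ + Da = (H * G) * (Λ + Da) * (Gᵀ * Hᵀ) := by rw [hHG, hHGt, one_mul, mul_one]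
        _ = _ := by simp only [mul_assoc]
    have e2 : G + G * D₀ = Hᵀ + O₀ * Hᵀ := by
      calc G + G * D₀ = G * (1 + D₀) * (Gᵀ * Hᵀ) := by rw [hHGt]; noncomm_ring
        _ = (1 + O₀) * Hᵀ := by rw [← h₀]; simp only [mul_assoc]
        _ = _ := by noncomm_ring
    have e3 : H * diagonal D * G + H * diagonal D * G * D₀ =
        H * diagonal D * Hᵀ + H * diagonal D * O₀ * Hᵀ := by
      calc H * diagonal D * G + H * diagonal D * G * D₀ = H * diagonal D * (G + G * D₀) := by
            noncomm_ring
        _ = _ := by rw [e2]; noncomm_ring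
    have e4 : Λ + Da = H * diagonal D * Hᵀ + H * Oa * Hᵀ := by rw [e1]; noncomm_ring
    have e5 : (Λ - H * diagonal D * G) * D₀ = Λ * D₀ - H * diagonal D * G * D₀ := by noncomm_ring
    rw [e5]
    linear_combination (norm := abel) e4 - e3
  have hDan : ‖Da‖ ≤ s * δ :=
    (norm_sum_smul_le w Δ).trans (mul_le_mul_of_nonneg_left hΔ hs0)
  have han : √(∑ k, a k ^ 2) ≤ ‖H‖ * s := by
    rw [hs]
    refine Real.sqrt_le_iff.2 ⟨by positivity, ?_⟩
    rw [mul_pow, Real.sq_sqrt (Finset.sum_nonneg fun _ _ => sq_nonneg _)]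
    exact sum_vecMul_sq_le H w
  have hOan : ‖Oa‖ ≤ 1.1 * s * δ := by
    refine (norm_sum_smul_le a O).trans (mul_le_mul (han.trans ?_) hO (Real.sqrt_nonneg _)
      (by positivity))
    exact mul_le_mul_of_nonneg_right hHn hs0
  have hΛn : ‖Λ‖ ≤ L := norm_diagonal_le l L hL0 hL
  -- Each O_ν has zero diagonal, so D is exactly the diagonal of G(Λ + Da)Gᵀ and no bound on Oa is
  -- needed.
  have hDn : ‖diagonal D‖ ≤ 1.21 * (L + s * δ) := by
    have hS : ‖G * (Λ + Da) * Gᵀ‖ ≤ 1.21 * (L + s * δ) := by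
      calc ‖G * (Λ + Da) * Gᵀ‖ ≤ ‖G‖ * ‖Λ + Da‖ * ‖Gᵀ‖ :=
            (norm_mul_le _ _).trans (mul_le_mul_of_nonneg_right (norm_mul_le _ _) (norm_nonneg _))
        _ ≤ 1.1 * (L + s * δ) * 1.1 := by
            rw [norm_transpose_eq]
            gcongr
            exact (norm_add_le _ _).trans (add_le_add hΛn hDan)
        _ = _ := by ring
    refine norm_diagonal_le D _ (by positivity) fun i => ?_
    have e : D i = (G * (Λ + Da) * Gᵀ) i i := by
      rw [hcomb, hOa, Matrix.add_apply, Matrix.sum_apply]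
      simp [hOdiag]
    rw [e]
    exact (abs_entry_le_norm _ _ _).trans hS
  set P := Λ - H * diagonal D * G with hP
  have hbound : ‖P‖ ≤ L * δ + s * δ + 1.21 * (1.1 * s * δ) +
      1.21 * (1.21 * (L + s * δ) * δ) + ‖P‖ * δ := by
    have t1 : ‖Λ * D₀‖ ≤ L * δ := (norm_mul_le _ _).trans (by gcongr)
    have t2 : ‖H * Oa * Hᵀ‖ ≤ 1.21 * (1.1 * s * δ) := by
      calc ‖H * Oa * Hᵀ‖ ≤ ‖H‖ * ‖Oa‖ * ‖Hᵀ‖ :=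
            (norm_mul_le _ _).trans (mul_le_mul_of_nonneg_right (norm_mul_le _ _) (norm_nonneg _))
        _ ≤ 1.1 * (1.1 * s * δ) * 1.1 := by
            rw [norm_transpose_eq]
            gcongr
        _ = _ := by ring
    have t3 : ‖H * diagonal D * O₀ * Hᵀ‖ ≤
        1.21 * (1.21 * (L + s * δ) * δ) := by
      calc ‖H * diagonal D * O₀ * Hᵀ‖ ≤ ‖H‖ * ‖diagonal D‖ * ‖O₀‖ * ‖Hᵀ‖ :=
            (norm_mul_le _ _).trans (mul_le_mul_of_nonneg_right ((norm_mul_le _ _).trans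
              (mul_le_mul_of_nonneg_right (norm_mul_le _ _) (norm_nonneg _))) (norm_nonneg _))
        _ ≤ 1.1 * (1.21 * (L + s * δ)) * δ * 1.1 := by
            rw [norm_transpose_eq]
            gcongr
        _ = _ := by ring
    have t4 : ‖P * D₀‖ ≤ ‖P‖ * δ := (norm_mul_le _ _).trans (by gcongr)
    calc ‖P‖ = ‖Λ * D₀ - Da + H * Oa * Hᵀ - H * diagonal D * O₀ * Hᵀ - P * D₀‖ := by
          rw [← hPeq]
      _ ≤ ‖Λ * D₀‖ + ‖Da‖ + ‖H * Oa * Hᵀ‖ + ‖H * diagonal D * O₀ * Hᵀ‖ + ‖P * D₀‖ := by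
          refine (norm_sub_le _ _).trans (add_le_add_left ?_ _)
          refine (norm_sub_le _ _).trans (add_le_add_left ?_ _)
          refine (norm_add_le _ _).trans (add_le_add_left ?_ _)
          exact norm_sub_le _ _
      _ ≤ _ := by linarith
  -- After moving ‖P‖δ to the left, the coefficient of Lδ is 1 + 1.21² ≤ 2.5 and that of sδ is 1 +
  -- 1.331 + 1.4641 δ ≤ 2.5.
  have e : 2.5 * (δ / (1 - δ) * (s + L)) = 2.5 * δ * (s + L) / (1 - δ) := by ring
  rw [e, le_div_iff₀ (by linarith)]
  nlinarith [mul_nonneg hs0 hδ0, mul_nonneg hL0 hδ0, mul_nonneg (mul_nonneg hs0 hδ0) hδ0,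
    mul_nonneg (mul_nonneg hs0 hδ0) (sub_nonneg.2 hδ)]

theorem permMatrix_mul_apply (τ : Equiv.Perm (Fin d)) (X : Matrix (Fin d) (Fin d) ℝ)
    (i j : Fin d) : (τ.permMatrix ℝ * X) i j = X (τ i) j := by
  rw [Equiv.Perm.permMatrix, PEquiv.toMatrix_toPEquiv_mul]
  rfl

/-- A matrix that nearly diagonalises the second- and third-order relations by congruence is a
small perturbation of a monomial matrix. -/
theorem exists_monomial_mul_one_add {G D₀ O₀ : Matrix (Fin d) (Fin d) ℝ}
    {Δ O : Fin d → Matrix (Fin d) (Fin d) ℝ} {m w l : Fin d → ℝ} {μ : Fin d → Fin d → ℝ}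
    {δ L t : ℝ} (hG : IsUnit G.det) (hδ0 : 0 ≤ δ) (hδ : δ ≤ 0.095)
    (h₀ : G * (1 + D₀) * Gᵀ = 1 + O₀)
    (h₃ : ∀ ν, G * (∑ k, G ν k • (diagonal (Pi.single k (m k)) + Δ k)) * Gᵀ =
      diagonal (μ ν) + O ν)
    (hD₀ : ‖D₀‖ ≤ δ) (hO₀ : ‖O₀‖ ≤ δ) (hΔ : √(∑ k, frob (Δ k) ^ 2) ≤ δ)
    (hO : √(∑ k, frob (O k) ^ 2) ≤ δ) (hOdiag : ∀ ν i, O ν i i = 0) (hl : ∀ k, l k = w k * m k)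
    (hL0 : 0 ≤ L) (hL : ∀ k, |l k| ≤ L) (hsep : ∀ i j, i ≠ j → 1 ≤ |l i - l j|)
    (ht : t = δ / (1 - δ) * (√(∑ k, w k ^ 2) + L)) (ht1 : t ≤ 0.1034) :
    ∃ M E : Matrix (Fin d) (Fin d) ℝ, IsMonomial M ∧ G = M * (1 + E) ∧
      frob E ≤ √d * (4 * t) ∧
      ∃ E' : Matrix (Fin d) (Fin d) ℝ, M * E = E' * M ∧ frob E' ≤ √2 * (√d * (4 * t)) := by
  obtain ⟨hGn, hHn, D, P, hP, hPn⟩ := exists_left_eigenvector_equation hG hδ0 hδ h₀ h₃ hD₀ hO₀ hΔ hO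
    hOdiag hl hL0 hL
  rw [← ht] at hPn
  have ht0 : 0 ≤ t := by
    rw [ht]
    have : 0 < 1 - δ := by linarith
    positivity
  obtain ⟨τ, hτ⟩ := exists_perm_of_left_eigenvectors l D G P hG hsep hP (2.5 * t) (by linarith) hPn
  set c : Fin d → ℝ := fun ν => G ν (τ ν) with hc
  have hc0 : ∀ ν, c ν ≠ 0 := fun ν => (hτ ν).1
  -- F is diag(c)⁻¹G minus the permutation matrix of τ, so that G = diag(c)(P_τ + F).
  set F : Fin d → Fin d → ℝ := fun ν j => G ν j / c ν - if τ ν = j then 1 else 0 with hF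
  have hFsq : ∀ ν, ∑ j, F ν j ^ 2 = (∑ j ∈ Finset.univ.erase (τ ν), G ν j ^ 2) / c ν ^ 2 := by
    intro ν
    rw [← Finset.add_sum_erase _ _ (Finset.mem_univ (τ ν)), Finset.sum_div]
    have e1 : F ν (τ ν) = 0 := by simp only [hF, if_true]; rw [div_self (hc0 ν), sub_self]
    rw [e1, zero_pow two_ne_zero, zero_add]
    refine Finset.sum_congr rfl fun j hj => ?_
    simp only [hF]
    rw [if_neg (Finset.ne_of_mem_erase hj).symm, sub_zero, div_pow]
  -- With ρ = 2.5t and t ≤ 0.1034 one has 1 - 2ρ ≥ 0.48, and 2.5² / 0.48 ≤ 4².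
  have hFle : ∀ ν, ∑ j, F ν j ^ 2 ≤ (4 * t) ^ 2 := by
    intro ν
    have hcp : 0 < c ν ^ 2 := by have := hc0 ν; positivity
    rw [hFsq, div_le_iff₀ hcp]
    have h1 := (hτ ν).2
    have h2 : 0 ≤ ∑ j ∈ Finset.univ.erase (τ ν), G ν j ^ 2 :=
      Finset.sum_nonneg fun _ _ => sq_nonneg _
    change _ ≤ _ * c ν ^ 2 at h1
    have h3 : 0.48 * ∑ j ∈ Finset.univ.erase (τ ν), G ν j ^ 2 ≤ (2.5 * t) ^ 2 * c ν ^ 2 :=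
      (mul_le_mul_of_nonneg_right (by linarith) h2).trans h1
    nlinarith [mul_nonneg (sq_nonneg t) hcp.le]
  have hrow : ∀ ν, ∑ j, G ν j ^ 2 = c ν ^ 2 * (1 + ∑ j, F ν j ^ 2) := by
    intro ν
    have hcp : c ν ^ 2 ≠ 0 := pow_ne_zero 2 (hc0 ν)
    rw [hFsq, mul_add, mul_one, mul_div_cancel₀ _ hcp]
    exact (Finset.add_sum_erase _ _ (Finset.mem_univ _)).symm
  have hrow_le : ∀ ν, ∑ j, G ν j ^ 2 ≤ 1.21 := by
    intro ν
    have h1 := sum_vecMul_sq_le G (Pi.single ν 1)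
    rw [single_one_vecMul] at h1
    have h2 : ∑ k, (Pi.single ν (1:ℝ) : Fin d → ℝ) k ^ 2 = 1 := by simp [Pi.single_apply]
    rw [h2, mul_one] at h1
    refine h1.trans ((pow_le_pow_left₀ (norm_nonneg _) hGn 2).trans (by norm_num))
  have hrow_ge : ∀ ν, 1 ≤ 1.21 * ∑ j, G ν j ^ 2 := by
    intro ν
    have h1 := sum_vecMul_sq_le G⁻¹ (G ν)
    have h2 : G ν ᵥ* G⁻¹ = Pi.single ν 1 := by
      have h := vecMul_vecMul (Pi.single ν 1) G G⁻¹
      rwa [single_one_vecMul, mul_nonsing_inv _ hG, vecMul_one] at h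
    have h3 : ∑ k, (Pi.single ν (1:ℝ) : Fin d → ℝ) k ^ 2 = 1 := by simp [Pi.single_apply]
    rw [h2, h3] at h1
    refine h1.trans (mul_le_mul_of_nonneg_right
      ((pow_le_pow_left₀ (norm_nonneg _) hHn 2).trans (by norm_num))
      (Finset.sum_nonneg fun _ _ => sq_nonneg _))
  -- Squared row lengths of G lie between 1/1.21 and 1.21, and c_ν² is a fraction at least 1/1.1711
  -- of them. Comparable pivots keep the conjugate M E M⁻¹ small.
  have hratio : ∀ ν μ, c ν ^ 2 ≤ 2 * c μ ^ 2 := by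
    intro ν μ
    have h1 := hrow_le ν
    have h2 := hrow_ge μ
    rw [hrow] at h1 h2
    have h3 := hFle μ
    have h4 : (4 * t) ^ 2 ≤ 0.1711 := by nlinarith
    have h5 : 0 ≤ ∑ j, F ν j ^ 2 := Finset.sum_nonneg fun _ _ => sq_nonneg _
    have h6 : c ν ^ 2 ≤ 1.21 := by nlinarith [sq_nonneg (c ν)]
    nlinarith [sq_nonneg (c μ)]
  have hsum : ∑ ν, ∑ j, F ν j ^ 2 ≤ d * (4 * t) ^ 2 := by
    refine (Finset.sum_le_sum fun ν _ => hFle ν).trans ?_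
    simp
  -- E = P_τ⁻¹F only permutes the rows of F, while E' = M E M⁻¹ also rescales its entries by c_ν /
  -- c_μ, whence the factor √2.
  refine ⟨diagonal c * τ.permMatrix ℝ, of fun k j => F (τ.symm k) j, ⟨c, τ, hc0, rfl⟩, ?_, ?_,
    of fun ν μ => c ν * F ν (τ μ) / c μ, ?_, ?_⟩
  · ext ν j
    rw [mul_assoc, diagonal_mul, permMatrix_mul_apply, Matrix.add_apply, Matrix.one_apply, of_apply]
    simp only [hF, Equiv.symm_apply_apply]
    have := hc0 ν
    field_simp
    ring
  · refine Real.sqrt_le_iff.2 ⟨by positivity, ?_⟩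
    simp only [of_apply]
    rw [Equiv.sum_comp τ.symm (fun ν => ∑ j, F ν j ^ 2), mul_pow, Real.sq_sqrt (Nat.cast_nonneg d)]
    exact hsum
  · ext ν j
    rw [mul_assoc, diagonal_mul, permMatrix_mul_apply, of_apply, Equiv.symm_apply_apply,
      ← mul_assoc, Matrix.mul_apply, Finset.sum_eq_single (τ.symm j)]
    · rw [Matrix.mul_diagonal, of_apply, Equiv.apply_symm_apply, div_mul_cancel₀ _ (hc0 _)]
      simp [Equiv.Perm.permMatrix, PEquiv.toMatrix_apply]
    · intro b _ hb
      have : τ b ≠ j := fun h => hb (by rw [← h, Equiv.symm_apply_apply])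
      simp [Equiv.Perm.permMatrix, PEquiv.toMatrix_apply, this]
    · simp
  · refine Real.sqrt_le_iff.2 ⟨by positivity, ?_⟩
    simp only [of_apply]
    rw [mul_pow, mul_pow, Real.sq_sqrt zero_le_two, Real.sq_sqrt (Nat.cast_nonneg d)]
    calc ∑ ν, ∑ μ, (c ν * F ν (τ μ) / c μ) ^ 2 ≤ ∑ ν, ∑ μ, 2 * F ν (τ μ) ^ 2 := by
          refine Finset.sum_le_sum fun ν _ => Finset.sum_le_sum fun μ _ => ?_
          have hcp : 0 < c μ ^ 2 := by have := hc0 μ; positivity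
          rw [div_pow, mul_pow, div_le_iff₀ hcp]
          nlinarith [hratio ν μ, sq_nonneg (F ν (τ μ))]
      _ = 2 * ∑ ν, ∑ j, F ν j ^ 2 := by
          rw [Finset.mul_sum]
          refine Finset.sum_congr rfl fun ν _ => ?_
          rw [← Finset.mul_sum, Equiv.sum_comp τ (fun j => F ν j ^ 2)]
      _ ≤ _ := mul_le_mul_of_nonneg_left hsum zero_le_two

end LinearAlgebra

/-! ### Absolutely continuous paths: iterated integrals, shuffle relations, linear maps -/

section Paths

variable {d : ℕ}

theorem LipschitzWith.comp_absolutelyContinuousOnInterval {X Y : Type*} [PseudoMetricSpace X]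
    [PseudoMetricSpace Y] {K : NNReal} {φ : X → Y} (hφ : LipschitzWith K φ) {f : ℝ → X} {a b : ℝ}
    (hf : AbsolutelyContinuousOnInterval f a b) :
    AbsolutelyContinuousOnInterval (fun s => φ (f s)) a b := by
  have h : Filter.Tendsto _ _ _ := hf
  have h2 := h.const_mul (K : ℝ)
  rw [mul_zero] at h2
  refine squeeze_zero (fun t => Finset.sum_nonneg fun _ _ => dist_nonneg) (fun t => ?_) h2
  rw [Finset.mul_sum]
  exact Finset.sum_le_sum fun i _ => hφ.dist_le_mul _ _

/-- The `i`-th coordinate of the constant extension of a path. -/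
noncomputable def coord (x : PathSpace d) (i : Fin d) (s : ℝ) : ℝ :=
  (Set.IccExtend (zero_le_one' ℝ) x s) i

theorem velocity_eq_deriv (x : PathSpace d) (i : Fin d) : velocity x i = deriv (coord x i) := rfl

theorem coord_zero (x : PathSpace d) (i : Fin d) : coord x i 0 = x 0 i := by
  simp only [coord]
  rw [Set.IccExtend_left]; rfl

theorem coord_one (x : PathSpace d) (i : Fin d) : coord x i 1 = x 1 i := by
  simp only [coord]
  rw [Set.IccExtend_right]; rfl

theorem coord_coe (x : PathSpace d) (i : Fin d) (t : unitInterval) : coord x i t = x t i := by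
  simp only [coord]
  rw [Set.IccExtend_val]

theorem IsAbsCont.coord {x : PathSpace d} (hx : IsAbsCont x) (i : Fin d) :
    AbsolutelyContinuousOnInterval (coord x i) 0 1 := by
  have h : LipschitzWith 1 (fun u : State d => u i) :=
    LipschitzWith.of_dist_le_mul fun u v => by
      rw [NNReal.coe_one, one_mul, dist_eq_norm, dist_eq_norm]
      exact PiLp.norm_apply_le (u - v) i
  exact LipschitzWith.comp_absolutelyContinuousOnInterval h hx

theorem uIcc_zero_subset {t : ℝ} (ht : t ∈ Set.Icc (0 : ℝ) 1) :
    Set.uIcc 0 t ⊆ Set.uIcc (0 : ℝ) 1 := by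
  rw [Set.uIcc_of_le ht.1, Set.uIcc_of_le zero_le_one]
  exact Set.Icc_subset_Icc_right ht.2

theorem IsAbsCont.intervalIntegrable_velocity {x : PathSpace d} (hx : IsAbsCont x) (i : Fin d)
    {t : ℝ} (ht : t ∈ Set.Icc (0 : ℝ) 1) : IntervalIntegrable (velocity x i) volume 0 t :=
  ((hx.coord i).mono (uIcc_zero_subset ht)).intervalIntegrable_deriv

theorem IsAbsCont.integral_velocity {x : PathSpace d} (hx : IsAbsCont x) (i : Fin d)
    {t : ℝ} (ht : t ∈ Set.Icc (0 : ℝ) 1) :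
    ∫ s in (0 : ℝ)..t, velocity x i s = RobustICA.coord x i t - RobustICA.coord x i 0 :=
  ((hx.coord i).mono (uIcc_zero_subset ht)).integral_deriv_eq_sub

theorem IsAbsCont.continuousOn_iteratedIntegral {x : PathSpace d} (hx : IsAbsCont x)
    (w : List (Fin d)) : ContinuousOn (iteratedIntegral x w) (Set.Icc 0 1) := by
  induction w with
  | nil => exact continuousOn_const
  | cons i w ih =>
    rw [← Set.uIcc_of_le (zero_le_one' ℝ)] at ih ⊢
    refine intervalIntegral.continuousOn_primitive_interval ?_
    rw [Set.uIcc_of_le (zero_le_one' ℝ), integrableOn_Icc_iff_integrableOn_Ioc,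
      ← intervalIntegrable_iff_integrableOn_Ioc_of_le zero_le_one]
    exact (hx.intervalIntegrable_velocity i ⟨zero_le_one, le_rfl⟩).continuousOn_mul ih

theorem IsAbsCont.intervalIntegrable_iteratedIntegral_mul {x : PathSpace d} (hx : IsAbsCont x)
    (w : List (Fin d)) (i : Fin d) {t : ℝ} (ht : t ∈ Set.Icc (0 : ℝ) 1) :
    IntervalIntegrable (fun s => iteratedIntegral x w s * velocity x i s) volume 0 t := by
  refine (hx.intervalIntegrable_velocity i ht).continuousOn_mul
    ((hx.continuousOn_iteratedIntegral w).mono ?_)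
  rw [Set.uIcc_of_le ht.1]
  exact Set.Icc_subset_Icc_right ht.2

theorem IsAbsCont.iteratedIntegral_singleton {x : PathSpace d} (hx : IsAbsCont x) (i : Fin d)
    {t : ℝ} (ht : t ∈ Set.Icc (0 : ℝ) 1) :
    iteratedIntegral x [i] t = RobustICA.coord x i t - RobustICA.coord x i 0 := by
  simp only [iteratedIntegral, one_mul]
  exact hx.integral_velocity i ht

theorem absolutelyContinuousOnInterval_const (c a b : ℝ) :
    AbsolutelyContinuousOnInterval (fun _ : ℝ => c) a b :=
  (LipschitzWith.const (α := ℝ) c).lipschitzOnWith.absolutelyContinuousOnInterval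

theorem deriv_coord_sub (x : PathSpace d) (i : Fin d) (c : ℝ) :
    deriv (fun s => coord x i s - c) = velocity x i := by
  funext s
  rw [deriv_sub_const]; rfl

theorem IsAbsCont.coord_sub {x : PathSpace d} (hx : IsAbsCont x) (i : Fin d) {t : ℝ}
    (ht : t ∈ Set.Icc (0 : ℝ) 1) :
    AbsolutelyContinuousOnInterval (fun s => RobustICA.coord x i s - RobustICA.coord x i 0) 0 t :=
  ((hx.coord i).mono (uIcc_zero_subset ht)).fun_sub (absolutelyContinuousOnInterval_const _ _ _)

theorem IsAbsCont.iteratedIntegral_pair {x : PathSpace d} (hx : IsAbsCont x) (i j : Fin d)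
    {t : ℝ} (ht : t ∈ Set.Icc (0 : ℝ) 1) :
    iteratedIntegral x [j, i] t =
      ∫ s in (0 : ℝ)..t, (RobustICA.coord x i s - RobustICA.coord x i 0) * velocity x j s := by
  change ∫ s in (0 : ℝ)..t, iteratedIntegral x [i] s * velocity x j s = _
  refine intervalIntegral.integral_congr fun s hs => ?_
  rw [Set.uIcc_of_le ht.1] at hs
  rw [hx.iteratedIntegral_singleton i ⟨hs.1, hs.2.trans ht.2⟩]

/-- The shuffle relation of order two. -/
theorem IsAbsCont.iteratedIntegral_pair_add {x : PathSpace d} (hx : IsAbsCont x) (i j : Fin d)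
    {t : ℝ} (ht : t ∈ Set.Icc (0 : ℝ) 1) :
    iteratedIntegral x [j, i] t + iteratedIntegral x [i, j] t =
      (RobustICA.coord x i t - RobustICA.coord x i 0) *
        (RobustICA.coord x j t - RobustICA.coord x j 0) := by
  rw [hx.iteratedIntegral_pair i j ht, hx.iteratedIntegral_pair j i ht]
  -- Integration by parts for increments from time 0, for which the boundary term at 0 vanishes.
  have h := (hx.coord_sub i ht).integral_mul_deriv_eq_deriv_mul (hx.coord_sub j ht)
  rw [deriv_coord_sub, deriv_coord_sub] at h
  rw [h]
  simp [mul_comm]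

/-- This makes C_μ half the second-moment matrix of the increments over [0,1], hence positive
semidefinite. -/
theorem IsAbsCont.sigCoeff_pair_add {x : PathSpace d} (hx : IsAbsCont x) (i j : Fin d) :
    sigCoeff [i, j] x + sigCoeff [j, i] x = (x 1 i - x 0 i) * (x 1 j - x 0 j) := by
  rw [← coord_one, ← coord_one, ← coord_zero, ← coord_zero]
  exact hx.iteratedIntegral_pair_add i j ⟨zero_le_one, le_rfl⟩

/-- The inner double integral is f²/2 for the increment f, and integrating f²f' by parts gives
f(1)³/3. Thus ⟨μ⟩_iii vanishes exactly when the third incremental moment does, which links the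
source classes of the ICA-condition. -/
theorem IsAbsCont.sigCoeff_triple_self {x : PathSpace d} (hx : IsAbsCont x) (i : Fin d) :
    sigCoeff [i, i, i] x = (x 1 i - x 0 i) ^ 3 / 6 := by
  have h1 : (1 : ℝ) ∈ Set.Icc (0 : ℝ) 1 := ⟨zero_le_one, le_rfl⟩
  set f : ℝ → ℝ := fun s => RobustICA.coord x i s - RobustICA.coord x i 0 with hf
  have hfac : AbsolutelyContinuousOnInterval f 0 1 := hx.coord_sub i h1
  have hfd : deriv f = velocity x i := deriv_coord_sub x i _
  have e1 : sigCoeff [i, i, i] x = ∫ s in (0 : ℝ)..1, (f s * f s) / 2 * velocity x i s := by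
    change ∫ s in (0 : ℝ)..1, iteratedIntegral x [i, i] s * velocity x i s = _
    refine intervalIntegral.integral_congr fun s hs => ?_
    rw [Set.uIcc_of_le zero_le_one] at hs
    have := hx.iteratedIntegral_pair_add i i hs
    simp only [hf]
    rw [← this]; ring
  have h := (hfac.fun_mul hfac).integral_mul_deriv_eq_deriv_mul hfac
  rw [hfd] at h
  have e2 : ∫ s in (0 : ℝ)..1, deriv (fun s => f s * f s) s * f s =
      2 * ∫ s in (0 : ℝ)..1, f s * f s * velocity x i s := by
    rw [← intervalIntegral.integral_const_mul]
    refine intervalIntegral.integral_congr_ae ?_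
    filter_upwards [hfac.ae_differentiableAt] with s hs hs2
    have h4 := (hs (Set.uIoc_subset_uIcc hs2)).hasDerivAt
    have h3 := (h4.mul h4).deriv
    rw [hfd] at h3
    have h5 : deriv (fun s => f s * f s) s = velocity x i s * f s + f s * velocity x i s := h3
    rw [h5]; ring
  rw [e2] at h
  have e3 : f 0 = 0 := by simp [hf]
  have e4 : f 1 = x 1 i - x 0 i := by simp only [hf]; rw [coord_one, coord_zero]
  have e5 : sigCoeff [i, i, i] x = (∫ s in (0 : ℝ)..1, f s * f s * velocity x i s) / 2 := by
    rw [e1, ← intervalIntegral.integral_div]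
    refine intervalIntegral.integral_congr fun s _ => ?_
    ring
  rw [e3, e4] at h
  rw [e5]
  linarith

/-! ### Linear transformations of paths -/

theorem continuous_linMap (A : Matrix (Fin d) (Fin d) ℝ) : Continuous (linMap A) :=
  (Matrix.toEuclideanCLM (n := Fin d) (𝕜 := ℝ) A).continuous

theorem linMap_apply (A : Matrix (Fin d) (Fin d) ℝ) (u : State d) (i : Fin d) :
    linMap A u i = ∑ j, A i j * u j := by
  rw [linMap, Matrix.ofLp_toEuclideanCLM]; rfl

theorem linMap_linMap (A B : Matrix (Fin d) (Fin d) ℝ) (u : State d) :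
    linMap A (linMap B u) = linMap (A * B) u := by
  simp [linMap, map_mul]

theorem linMap_one (u : State d) : linMap (1 : Matrix (Fin d) (Fin d) ℝ) u = u := by
  simp [linMap]

theorem pathMap_apply {f : State d → State d} (hf : Continuous f) (x : PathSpace d)
    (t : unitInterval) : pathMap f x t = f (x t) := by
  rw [pathMap, dif_pos (by fun_prop)]
  rfl

theorem pathMap_linMap_apply (A : Matrix (Fin d) (Fin d) ℝ) (x : PathSpace d)
    (t : unitInterval) : pathMap (linMap A) x t = linMap A (x t) :=
  pathMap_apply (continuous_linMap A) x t

theorem extend_pathMap_linMap (A : Matrix (Fin d) (Fin d) ℝ) (x : PathSpace d) (s : ℝ) :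
    Set.IccExtend (zero_le_one' ℝ) (pathMap (linMap A) x) s =
      linMap A (Set.IccExtend (zero_le_one' ℝ) x s) :=
  pathMap_linMap_apply A x _

theorem coord_pathMap_linMap (A : Matrix (Fin d) (Fin d) ℝ) (x : PathSpace d) (i : Fin d) (s : ℝ) :
    coord (pathMap (linMap A) x) i s = ∑ j, A i j * coord x j s := by
  simp only [coord]
  rw [extend_pathMap_linMap, linMap_apply]

theorem IsAbsCont.pathMap_linMap {x : PathSpace d} (hx : IsAbsCont x)
    (A : Matrix (Fin d) (Fin d) ℝ) : IsAbsCont (pathMap (linMap A) x) := by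
  have h := LipschitzWith.comp_absolutelyContinuousOnInterval
    (Matrix.toEuclideanCLM (n := Fin d) (𝕜 := ℝ) A).lipschitz hx
  have e : Set.IccExtend (zero_le_one' ℝ) (pathMap (linMap A) x) =
      fun s => linMap A (Set.IccExtend (zero_le_one' ℝ) x s) :=
    funext fun s => extend_pathMap_linMap A x s
  rw [IsAbsCont, e]
  exact h

/-- `deriv` is linear only where every coordinate is differentiable, which absolute continuity
ensures almost everywhere; hence the exceptional null set. -/
theorem IsAbsCont.velocity_pathMap_linMap {x : PathSpace d} (hx : IsAbsCont x)
    (A : Matrix (Fin d) (Fin d) ℝ) (i : Fin d) :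
    ∀ᵐ s, s ∈ Set.uIcc (0 : ℝ) 1 →
      velocity (pathMap (linMap A) x) i s = ∑ j, A i j * velocity x j s := by
  have h : ∀ᵐ s, ∀ j, s ∈ Set.uIcc (0 : ℝ) 1 → DifferentiableAt ℝ (RobustICA.coord x j) s :=
    ae_all_iff.2 fun j => (hx.coord j).ae_differentiableAt
  filter_upwards [h] with s hs hs1
  have e : RobustICA.coord (pathMap (linMap A) x) i = fun s => ∑ j, A i j * RobustICA.coord x j s :=
    funext fun s => coord_pathMap_linMap A x i s
  rw [velocity_eq_deriv, e]
  have h2 : HasDerivAt (fun s => ∑ j, A i j * RobustICA.coord x j s)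
      (∑ j, A i j * velocity x j s) s :=
    HasDerivAt.fun_sum fun j _ => ((hs j hs1).hasDerivAt.const_mul (A i j))
  exact h2.deriv

/-- The inductive step of multilinearity, one outer letter at a time. The free index type ι is taken
to be `Unit`, `Fin d` and `Fin d × Fin d` for words of length one, two and three. -/
theorem IsAbsCont.iteratedIntegral_pathMap_cons {ι : Type*} [Fintype ι] {x : PathSpace d}
    (hx : IsAbsCont x) (A : Matrix (Fin d) (Fin d) ℝ) (w : List (Fin d)) (c : ι → ℝ)
    (W : ι → List (Fin d))
    (h : ∀ s ∈ Set.Icc (0 : ℝ) 1, iteratedIntegral (pathMap (linMap A) x) w s =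
      ∑ a, c a * iteratedIntegral x (W a) s) (i : Fin d) {t : ℝ} (ht : t ∈ Set.Icc (0 : ℝ) 1) :
    iteratedIntegral (pathMap (linMap A) x) (i :: w) t =
      ∑ a, ∑ j, c a * A i j * iteratedIntegral x (j :: W a) t := by
  have e : iteratedIntegral (pathMap (linMap A) x) (i :: w) t =
      ∫ s in (0 : ℝ)..t, ∑ a, ∑ j, c a * A i j * (iteratedIntegral x (W a) s * velocity x j s) := by
    refine intervalIntegral.integral_congr_ae ?_
    filter_upwards [hx.velocity_pathMap_linMap A i] with s hs hs1
    have hs2 : s ∈ Set.uIcc (0 : ℝ) 1 := uIcc_zero_subset ht (Set.uIoc_subset_uIcc hs1)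
    have hs3 := hs2
    rw [Set.uIcc_of_le zero_le_one] at hs3
    rw [hs hs2, h s hs3, Finset.sum_mul_sum]
    refine Finset.sum_congr rfl fun a _ => Finset.sum_congr rfl fun j _ => ?_
    ring
  have hint : ∀ a j, IntervalIntegrable
      (fun s => c a * A i j * (iteratedIntegral x (W a) s * velocity x j s)) volume 0 t :=
    fun a j => (hx.intervalIntegrable_iteratedIntegral_mul (W a) j ht).const_mul _
  rw [e, intervalIntegral.integral_finsetSum fun a _ => ?_]
  · refine Finset.sum_congr rfl fun a _ => ?_
    rw [intervalIntegral.integral_finsetSum fun j _ => hint a j]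
    refine Finset.sum_congr rfl fun j _ => ?_
    rw [intervalIntegral.integral_const_mul]
    rfl
  · have := IntervalIntegrable.sum (μ := volume) (a := 0) (b := t) Finset.univ
      (f := fun j s => c a * A i j * (iteratedIntegral x (W a) s * velocity x j s))
      fun j _ => hint a j
    simpa only [Finset.sum_fn] using this

theorem IsAbsCont.iteratedIntegral_pathMap_singleton {x : PathSpace d} (hx : IsAbsCont x)
    (A : Matrix (Fin d) (Fin d) ℝ) (i : Fin d) {t : ℝ} (ht : t ∈ Set.Icc (0 : ℝ) 1) :
    iteratedIntegral (pathMap (linMap A) x) [i] t = ∑ a, A i a * iteratedIntegral x [a] t := by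
  rw [hx.iteratedIntegral_pathMap_cons (ι := Unit) A [] (fun _ => 1) (fun _ => [])
    (fun s _ => by simp [iteratedIntegral]) i ht]
  simp

theorem IsAbsCont.iteratedIntegral_pathMap_pair {x : PathSpace d} (hx : IsAbsCont x)
    (A : Matrix (Fin d) (Fin d) ℝ) (i j : Fin d) {t : ℝ} (ht : t ∈ Set.Icc (0 : ℝ) 1) :
    iteratedIntegral (pathMap (linMap A) x) [j, i] t =
      ∑ a, ∑ b, A i a * A j b * iteratedIntegral x [b, a] t :=
  hx.iteratedIntegral_pathMap_cons A [i] (fun a => A i a) (fun a => [a])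
    (fun _ hs => hx.iteratedIntegral_pathMap_singleton A i hs) j ht

theorem IsAbsCont.sigCoeff_pathMap_pair {x : PathSpace d} (hx : IsAbsCont x)
    (A : Matrix (Fin d) (Fin d) ℝ) (i j : Fin d) :
    sigCoeff [i, j] (pathMap (linMap A) x) = ∑ a, ∑ b, A i a * A j b * sigCoeff [a, b] x :=
  hx.iteratedIntegral_pathMap_pair A i j ⟨zero_le_one, le_rfl⟩

theorem IsAbsCont.sigCoeff_pathMap_triple {x : PathSpace d} (hx : IsAbsCont x)
    (A : Matrix (Fin d) (Fin d) ℝ) (i j k : Fin d) :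
    sigCoeff [i, j, k] (pathMap (linMap A) x) =
      ∑ a, ∑ b, ∑ c, A i a * A j b * A k c * sigCoeff [a, b, c] x := by
  have h := hx.iteratedIntegral_pathMap_cons (ι := Fin d × Fin d) A [j, i]
    (fun p => A i p.1 * A j p.2) (fun p => [p.2, p.1])
    (fun s hs => by
      rw [hx.iteratedIntegral_pathMap_pair A i j hs, Fintype.sum_prod_type]) k
    (t := 1) ⟨zero_le_one, le_rfl⟩
  rw [Fintype.sum_prod_type] at h
  exact h

end Paths

/-! ### Tensor transformation of signature moments and positivity of C_μ -/

section Moments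

variable {d : ℕ}

theorem measurable_pathMap {f : State d → State d} (hf : Continuous f) :
    Measurable (pathMap f) := by
  have e : pathMap f = ContinuousMap.comp (⟨f, hf⟩ : C(State d, State d)) := by
    funext x
    ext1 t
    exact pathMap_apply hf x t
  rw [e]
  exact (ContinuousMap.continuous_postcomp _).measurable

theorem pathMap_linMap_pathMap_linMap (A B : Matrix (Fin d) (Fin d) ℝ) (x : PathSpace d) :
    pathMap (linMap A) (pathMap (linMap B) x) = pathMap (linMap (A * B)) x := by
  ext1 t
  simp only [pathMap_linMap_apply, linMap_linMap]

theorem pathMap_linMap_one (x : PathSpace d) : pathMap (linMap 1) x = x := by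
  ext1 t
  simp only [pathMap_linMap_apply, linMap_one]

/-- The action of an invertible matrix on path space. -/
noncomputable def pathEquiv (A : Matrix (Fin d) (Fin d) ℝ) (hA : IsUnit A.det) :
    PathSpace d ≃ᵐ PathSpace d where
  toFun := pathMap (linMap A)
  invFun := pathMap (linMap A⁻¹)
  left_inv x := by rw [pathMap_linMap_pathMap_linMap, nonsing_inv_mul _ hA, pathMap_linMap_one]
  right_inv x := by rw [pathMap_linMap_pathMap_linMap, mul_nonsing_inv _ hA, pathMap_linMap_one]
  measurable_toFun := measurable_pathMap (continuous_linMap A)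
  measurable_invFun := measurable_pathMap (continuous_linMap A⁻¹)

/-- Change of variables along a measurable embedding requires no measurability of the integrand, so
none has to be shown for signature coefficients. -/
theorem measurableEmbedding_pathMap_linMap {A : Matrix (Fin d) (Fin d) ℝ} (hA : IsUnit A.det) :
    MeasurableEmbedding (pathMap (linMap A)) :=
  (pathEquiv A hA).measurableEmbedding

theorem push_linMap_push_linMap (A B : Matrix (Fin d) (Fin d) ℝ) (μ : Measure (PathSpace d)) :
    push (linMap A) (push (linMap B) μ) = push (linMap (A * B)) μ := by
  rw [push, push, Measure.map_map (measurable_pathMap (continuous_linMap A))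
    (measurable_pathMap (continuous_linMap B))]
  congr 1
  funext x
  exact pathMap_linMap_pathMap_linMap A B x

theorem push_linMap_one (μ : Measure (PathSpace d)) : push (linMap 1) μ = μ := by
  have e : pathMap (linMap (1 : Matrix (Fin d) (Fin d) ℝ)) = id := funext pathMap_linMap_one
  rw [push, e, Measure.map_id]

/-- Signals whose second- and third-order signature moments exist. -/
def HasCoredinates (μ : Measure (PathSpace d)) : Prop :=
  μ ∈ signals d ∧ (∀ i j, Integrable (sigCoeff [i, j]) μ) ∧
    ∀ i j k, Integrable (sigCoeff [i, j, k]) μ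

theorem mem_coreSignals_iff {μ : Measure (PathSpace d)} :
    μ ∈ coreSignals d ↔ HasCoredinates μ ∧ ∀ i, sigMoment μ [i, i] ≠ 0 :=
  ⟨fun h => ⟨⟨h.1, h.2.1, h.2.2.1⟩, h.2.2.2⟩, fun h => ⟨h.1.1, h.1.2.1, h.1.2.2, h.2⟩⟩

theorem push_mem_signals {μ : Measure (PathSpace d)} (hμ : μ ∈ signals d)
    {A : Matrix (Fin d) (Fin d) ℝ} (hA : IsUnit A.det) : push (linMap A) μ ∈ signals d := by
  obtain ⟨h1, h2⟩ := hμ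
  refine ⟨Measure.isProbabilityMeasure_map
    (measurable_pathMap (continuous_linMap A)).aemeasurable, ?_⟩
  rw [push, (measurableEmbedding_pathMap_linMap hA).ae_map_iff]
  filter_upwards [h2] with x hx using hx.pathMap_linMap A

theorem HasCoredinates.push_linMap {μ : Measure (PathSpace d)} (hμ : HasCoredinates μ)
    {A : Matrix (Fin d) (Fin d) ℝ} (hA : IsUnit A.det) : HasCoredinates (push (linMap A) μ) := by
  refine ⟨push_mem_signals hμ.1 hA, fun i j => ?_, fun i j k => ?_⟩
  · rw [push, (measurableEmbedding_pathMap_linMap hA).integrable_map_iff]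
    have h : Integrable (fun x => ∑ a, ∑ b, A i a * A j b * sigCoeff [a, b] x) μ :=
      integrable_finsetSum _ fun a _ => integrable_finsetSum _ fun b _ =>
        (hμ.2.1 a b).const_mul _
    refine h.congr ?_
    filter_upwards [hμ.1.2] with x hx using (hx.sigCoeff_pathMap_pair A i j).symm
  · rw [push, (measurableEmbedding_pathMap_linMap hA).integrable_map_iff]
    have h : Integrable (fun x => ∑ a, ∑ b, ∑ c, A i a * A j b * A k c * sigCoeff [a, b, c] x) μ :=
      integrable_finsetSum _ fun a _ => integrable_finsetSum _ fun b _ =>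
        integrable_finsetSum _ fun c _ => (hμ.2.2 a b c).const_mul _
    refine h.congr ?_
    filter_upwards [hμ.1.2] with x hx using (hx.sigCoeff_pathMap_triple A i j k).symm

theorem HasCoredinates.sigMoment_push_pair {μ : Measure (PathSpace d)} (hμ : HasCoredinates μ)
    {A : Matrix (Fin d) (Fin d) ℝ} (hA : IsUnit A.det) (i j : Fin d) :
    sigMoment (push (linMap A) μ) [i, j] = ∑ a, ∑ b, A i a * A j b * sigMoment μ [a, b] := by
  rw [sigMoment, push, (measurableEmbedding_pathMap_linMap hA).integral_map]
  rw [integral_congr_ae (g := fun x => ∑ a, ∑ b, A i a * A j b * sigCoeff [a, b] x)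
    (by filter_upwards [hμ.1.2] with x hx using hx.sigCoeff_pathMap_pair A i j)]
  rw [integral_finsetSum _ fun a _ => integrable_finsetSum _ fun b _ => (hμ.2.1 a b).const_mul _]
  refine Finset.sum_congr rfl fun a _ => ?_
  rw [integral_finsetSum _ fun b _ => (hμ.2.1 a b).const_mul _]
  refine Finset.sum_congr rfl fun b _ => ?_
  rw [integral_const_mul]; rfl

theorem HasCoredinates.sigMoment_push_triple {μ : Measure (PathSpace d)} (hμ : HasCoredinates μ)
    {A : Matrix (Fin d) (Fin d) ℝ} (hA : IsUnit A.det) (i j k : Fin d) :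
    sigMoment (push (linMap A) μ) [i, j, k] =
      ∑ a, ∑ b, ∑ c, A i a * A j b * A k c * sigMoment μ [a, b, c] := by
  rw [sigMoment, push, (measurableEmbedding_pathMap_linMap hA).integral_map]
  rw [integral_congr_ae
    (g := fun x => ∑ a, ∑ b, ∑ c, A i a * A j b * A k c * sigCoeff [a, b, c] x)
    (by filter_upwards [hμ.1.2] with x hx using hx.sigCoeff_pathMap_triple A i j k)]
  rw [integral_finsetSum _ fun a _ => integrable_finsetSum _ fun b _ =>
    integrable_finsetSum _ fun c _ => (hμ.2.2 a b c).const_mul _]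
  refine Finset.sum_congr rfl fun a _ => ?_
  rw [integral_finsetSum _ fun b _ => integrable_finsetSum _ fun c _ =>
    (hμ.2.2 a b c).const_mul _]
  refine Finset.sum_congr rfl fun b _ => ?_
  rw [integral_finsetSum _ fun c _ => (hμ.2.2 a b c).const_mul _]
  refine Finset.sum_congr rfl fun c _ => ?_
  rw [integral_const_mul]; rfl

theorem HasCoredinates.core₀_push {μ : Measure (PathSpace d)} (hμ : HasCoredinates μ)
    {A : Matrix (Fin d) (Fin d) ℝ} (hA : IsUnit A.det) :
    core₀ (push (linMap A) μ) = A * core₀ μ * Aᵀ := by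
  ext i j
  rw [core₀, of_apply, hμ.sigMoment_push_pair hA, Matrix.mul_apply, Finset.sum_comm]
  refine Finset.sum_congr rfl fun b _ => ?_
  rw [Matrix.mul_apply, Finset.sum_mul]
  refine Finset.sum_congr rfl fun a _ => ?_
  simp only [core₀, of_apply, transpose_apply]; ring

/-- The first two tensor slots are acted on by congruence and the third by mixing the slices with
row ν of A. This produces the joint diagonalisation problem. -/
theorem HasCoredinates.core_push {μ : Measure (PathSpace d)} (hμ : HasCoredinates μ)
    {A : Matrix (Fin d) (Fin d) ℝ} (hA : IsUnit A.det) (ν : Fin d) :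
    core (push (linMap A) μ) ν = A * (∑ k, A ν k • core μ k) * Aᵀ := by
  rw [Finset.mul_sum, Finset.sum_mul]
  ext i j
  rw [core, of_apply, hμ.sigMoment_push_triple hA, Matrix.sum_apply]
  have e : ∀ k, (A * A ν k • core μ k * Aᵀ) i j =
      ∑ a, ∑ b, A i a * A j b * A ν k * sigMoment μ [a, b, k] := by
    intro k
    rw [Matrix.mul_apply, Finset.sum_comm]
    refine Finset.sum_congr rfl fun b _ => ?_
    rw [Matrix.mul_apply, Finset.sum_mul]
    refine Finset.sum_congr rfl fun a _ => ?_
    simp only [core, Matrix.smul_apply, of_apply, transpose_apply, smul_eq_mul]; ring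
  simp_rw [e]
  rw [Finset.sum_comm]
  conv_rhs => rw [Finset.sum_comm]; enter [2, a]; rw [Finset.sum_comm]
  rw [Finset.sum_comm]

theorem HasCoredinates.symCore_push {μ : Measure (PathSpace d)} (hμ : HasCoredinates μ)
    {A : Matrix (Fin d) (Fin d) ℝ} (hA : IsUnit A.det) :
    symCore (push (linMap A) μ) = A * symCore μ * Aᵀ := by
  rw [symCore, hμ.core₀_push hA, symCore, transpose_mul, transpose_mul, transpose_transpose,
    mul_smul_comm, smul_mul_assoc, mul_add, add_mul, mul_assoc A (core₀ μ)ᵀ]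

theorem HasCoredinates.integrable_increment_mul {μ : Measure (PathSpace d)}
    (hμ : HasCoredinates μ) (i j : Fin d) :
    Integrable (fun x : PathSpace d => (x 1 i - x 0 i) * (x 1 j - x 0 j)) μ := by
  refine ((hμ.2.1 i j).add (hμ.2.1 j i)).congr ?_
  filter_upwards [hμ.1.2] with x hx using hx.sigCoeff_pair_add i j

theorem HasCoredinates.symCore_apply {μ : Measure (PathSpace d)}
    (hμ : HasCoredinates μ) (i j : Fin d) :
    symCore μ i j = 1 / 2 * ∫ x, (x 1 i - x 0 i) * (x 1 j - x 0 j) ∂μ := by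
  have e : symCore μ i j = 1 / 2 * (sigMoment μ [i, j] + sigMoment μ [j, i]) := rfl
  rw [e, sigMoment, sigMoment, ← integral_add (hμ.2.1 i j) (hμ.2.1 j i)]
  congr 1
  refine integral_congr_ae ?_
  filter_upwards [hμ.1.2] with x hx using hx.sigCoeff_pair_add i j

/-- The quadratic form uᵀC_μu is half the expected square of ∑ u_i (x₁ⁱ - x₀ⁱ). Hence the square
roots in the whitening and in N_μ are genuine ones. -/
theorem HasCoredinates.posSemidef_symCore {μ : Measure (PathSpace d)}
    (hμ : HasCoredinates μ) : (symCore μ).PosSemidef := by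
  refine Matrix.posSemidef_iff_dotProduct_mulVec.2 ⟨symCore_isHermitian μ, fun u => ?_⟩
  have e : star u ⬝ᵥ (symCore μ *ᵥ u) =
      1 / 2 * ∫ x, (∑ i, u i * (x 1 i - x 0 i)) ^ 2 ∂μ := by
    have e1 : ∀ x : PathSpace d, (∑ i, u i * (x 1 i - x 0 i)) ^ 2 =
        ∑ i, ∑ j, u i * u j * ((x 1 i - x 0 i) * (x 1 j - x 0 j)) := by
      intro x
      rw [sq, Finset.sum_mul_sum]
      refine Finset.sum_congr rfl fun i _ => Finset.sum_congr rfl fun j _ => ?_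
      ring
    simp_rw [e1]
    rw [integral_finsetSum _ fun i _ => integrable_finsetSum _ fun j _ =>
      (hμ.integrable_increment_mul i j).const_mul _, Finset.mul_sum]
    simp only [dotProduct, mulVec, star_trivial]
    refine Finset.sum_congr rfl fun i _ => ?_
    rw [integral_finsetSum _ fun j _ => (hμ.integrable_increment_mul i j).const_mul _,
      Finset.mul_sum, Finset.mul_sum]
    refine Finset.sum_congr rfl fun j _ => ?_
    rw [integral_const_mul, hμ.symCore_apply]
    ring
  rw [e]
  exact mul_nonneg (by norm_num) (integral_nonneg fun x => sq_nonneg _)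

theorem HasCoredinates.sigMoment_triple_self {μ : Measure (PathSpace d)}
    (hμ : HasCoredinates μ) (i : Fin d) :
    sigMoment μ [i, i, i] = (∫ x, (x 1 i - x 0 i) ^ 3 ∂μ) / 6 := by
  rw [sigMoment, ← integral_div]
  refine integral_congr_ae ?_
  filter_upwards [hμ.1.2] with x hx using hx.sigCoeff_triple_self i

theorem symCore_diag (μ : Measure (PathSpace d)) (i : Fin d) :
    symCore μ i i = sigMoment μ [i, i] := by
  have e : symCore μ i i = 1 / 2 * (sigMoment μ [i, i] + sigMoment μ [i, i]) := rfl
  rw [e]; ring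

/-! ### The whitening matrix C_μ^{-1/2} -/

section Whitening

variable {μ : Measure (PathSpace d)}

theorem transpose_whitening (μ : Measure (PathSpace d)) : (whitening μ)ᵀ = whitening μ := by
  simp only [whitening, transpose_mul, transpose_transpose, diagonal_transpose, mul_assoc]

theorem HasCoredinates.eigenvalues_pos (hμ : HasCoredinates μ) (hC : IsUnit (symCore μ).det)
    (i : Fin d) : 0 < (symCore_isHermitian μ).eigenvalues i := by
  refine lt_of_le_of_ne (hμ.posSemidef_symCore.eigenvalues_nonneg i) fun h => ?_
  refine hC.ne_zero ?_
  rw [(symCore_isHermitian μ).det_eq_prod_eigenvalues]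
  exact Finset.prod_eq_zero (Finset.mem_univ i) (by simp [← h])

theorem HasCoredinates.whitening_mul_symCore_mul (hμ : HasCoredinates μ)
    (hC : IsUnit (symCore μ).det) : whitening μ * symCore μ * whitening μ = 1 := by
  have hs := (symCore_isHermitian μ).spectral_theorem
  rw [Unitary.conjStarAlgAut_apply] at hs
  set Q : Matrix (Fin d) (Fin d) ℝ := (symCore_isHermitian μ).eigenvectorUnitary.1 with hQ
  set ev := (symCore_isHermitian μ).eigenvalues with hev
  have hQQ : Qᵀ * Q = 1 := by
    have := (Unitary.mem_iff.1 (symCore_isHermitian μ).eigenvectorUnitary.2).1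
    rwa [Matrix.star_eq_conjTranspose, conjTranspose_eq_transpose_of_trivial] at this
  have hQQ' : Q * Qᵀ = 1 := mul_eq_one_comm.1 hQQ
  have hs' : symCore μ = Q * diagonal ev * Qᵀ := by
    rw [hs]
    simp only [Matrix.star_eq_conjTranspose, conjTranspose_eq_transpose_of_trivial]
    rfl
  have hW : whitening μ = Q * diagonal (fun i => (√(ev i))⁻¹) * Qᵀ := rfl
  rw [hW, hs']
  calc Q * diagonal (fun i => (√(ev i))⁻¹) * Qᵀ * (Q * diagonal ev * Qᵀ) *
        (Q * diagonal (fun i => (√(ev i))⁻¹) * Qᵀ)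
      = Q * (diagonal (fun i => (√(ev i))⁻¹) * (Qᵀ * Q) * diagonal ev * (Qᵀ * Q) *
          diagonal (fun i => (√(ev i))⁻¹)) * Qᵀ := by simp only [mul_assoc]
    _ = Q * 1 * Qᵀ := by
        rw [hQQ, mul_one, mul_one, diagonal_mul_diagonal, diagonal_mul_diagonal]
        congr 2
        rw [← diagonal_one]
        congr 1
        funext i
        have hp : 0 < ev i := hμ.eigenvalues_pos hC i
        have h2 : √(ev i) * √(ev i) = ev i := Real.mul_self_sqrt hp.le
        have h3 : √(ev i) ≠ 0 := (Real.sqrt_pos.2 hp).ne'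
        field_simp
        rw [sq, h2]
    _ = 1 := by rw [mul_one, hQQ']

theorem HasCoredinates.isUnit_det_whitening (hμ : HasCoredinates μ)
    (hC : IsUnit (symCore μ).det) : IsUnit (whitening μ).det := by
  have h := hμ.whitening_mul_symCore_mul hC
  rw [mul_assoc] at h
  exact (Matrix.isUnit_iff_isUnit_det _).1 (IsUnit.of_mul_eq_one _ h)

end Whitening

end Moments

/-! ### Orthogonality of regular signals with independent components -/

section IndependentComponents

variable {d : ℕ}

theorem measurable_velocity (i : Fin d) :
    Measurable fun p : PathSpace d × ℝ => velocity p.1 i p.2 := by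
  have hc : Continuous (Function.uncurry fun (x : PathSpace d) (s : ℝ) => coord x i s) := by
    have h1 : Continuous fun p : PathSpace d × ℝ => p.1 (Set.projIcc 0 1 zero_le_one p.2) := by
      fun_prop
    exact (PiLp.continuous_apply 2 (fun _ : Fin d => ℝ) i).comp h1
  exact measurable_deriv_with_param hc

/-- Independence is stated for the component paths, so the velocity at a fixed time has to be a
measurable function of a scalar path alone. -/
theorem measurable_scalar_velocity (t : ℝ) :
    Measurable fun y : C(unitInterval, ℝ) => deriv (Set.IccExtend (zero_le_one' ℝ) y) t := by
  have hc : Continuous (Function.uncurry fun (y : C(unitInterval, ℝ)) (s : ℝ) =>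
      Set.IccExtend (zero_le_one' ℝ) y s) := by
    have h1 : Continuous fun p : C(unitInterval, ℝ) × ℝ =>
        p.1 (Set.projIcc 0 1 zero_le_one p.2) := by fun_prop
    exact h1
  exact (measurable_deriv_with_param hc).comp measurable_prodMk_right

theorem measurable_component (i : Fin d) :
    Measurable fun x : PathSpace d => (⟨fun t => x t i, by fun_prop⟩ : C(unitInterval, ℝ)) := by
  have h := ContinuousMap.continuous_postcomp (X := unitInterval)
    (⟨fun u : State d => u i, PiLp.continuous_apply 2 (fun _ : Fin d => ℝ) i⟩ : C(State d, ℝ))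
  exact h.measurable

/-- The restriction of Lebesgue measure to the time interval. -/
noncomputable abbrev timeMeasure : Measure ℝ := volume.restrict (Set.Icc (0 : ℝ) 1)

theorem lintegral_velocity_le_oneVar (x : PathSpace d) (i : Fin d) :
    ∫⁻ t, ‖velocity x i t‖ₑ ∂timeMeasure ≤ oneVar x := by
  refine le_trans (lintegral_mono fun t => ?_) le_add_self
  rw [← ofReal_norm, Real.norm_eq_abs]
  refine ENNReal.ofReal_le_ofReal (Real.abs_le_sqrt ?_)
  exact Finset.single_le_sum (f := fun j => velocity x j t ^ 2) (fun _ _ => sq_nonneg _)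
    (Finset.mem_univ i)

theorem integral_timeMeasure (g : ℝ → ℝ) :
    ∫ s in (0 : ℝ)..1, g s = ∫ s, g s ∂timeMeasure := by
  rw [intervalIntegral.integral_of_le zero_le_one, integral_Icc_eq_integral_Ioc]

theorem intervalIntegral_eq_integral_timeMeasure (g : ℝ → ℝ) {t : ℝ}
    (ht : t ∈ Set.Icc (0 : ℝ) 1) :
    ∫ s in (0 : ℝ)..t, g s = ∫ s, (Set.Iic t).indicator g s ∂timeMeasure := by
  rw [integral_indicator measurableSet_Iic, timeMeasure,
    Measure.restrict_restrict measurableSet_Iic,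
    intervalIntegral.integral_of_le ht.1, ← integral_Icc_eq_integral_Ioc]
  congr 2
  ext s
  simp only [Set.mem_inter_iff, Set.mem_Iic, Set.mem_Icc]
  exact ⟨fun h => ⟨h.2, h.1, h.2.trans ht.2⟩, fun h => ⟨h.2.1, h.1⟩⟩

section Expectation

variable {μ : Measure (PathSpace d)}

theorem lintegral_oneVar_pow_lt_top [IsProbabilityMeasure μ]
    (h3 : ∫⁻ x, oneVar x ^ 3 ∂μ < ∞) {n : ℕ} (hn : n ≤ 3) :
    ∫⁻ x, oneVar x ^ n ∂μ < ∞ := by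
  have h : ∫⁻ x, oneVar x ^ n ∂μ ≤ ∫⁻ x, (1 + oneVar x ^ 3) ∂μ := by
    refine lintegral_mono fun x => ?_
    rcases le_total (oneVar x) 1 with hx | hx
    · exact (pow_le_one₀ zero_le hx).trans le_self_add
    · exact (pow_le_pow_right₀ hx hn).trans le_add_self
  refine h.trans_lt ?_
  rw [lintegral_add_left measurable_const]
  simpa using h3

theorem integrable_velocity_prod [IsProbabilityMeasure μ]
    (h3 : ∫⁻ x, oneVar x ^ 3 ∂μ < ∞) (i : Fin d) :
    Integrable (fun p : PathSpace d × ℝ => velocity p.1 i p.2) (μ.prod timeMeasure) := by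
  refine ⟨(measurable_velocity i).aestronglyMeasurable, ?_⟩
  rw [hasFiniteIntegral_iff_enorm, lintegral_prod _ (measurable_velocity i).enorm.aemeasurable]
  refine (lintegral_mono fun x => lintegral_velocity_le_oneVar x i).trans_lt ?_
  simpa using lintegral_oneVar_pow_lt_top h3 (n := 1) (by norm_num)

theorem measurable_velocity_left (i : Fin d) (t : ℝ) :
    Measurable fun x : PathSpace d => velocity x i t :=
  (measurable_velocity i).comp measurable_prodMk_right

theorem measurable_velocity_right (x : PathSpace d) (i : Fin d) : Measurable (velocity x i) :=
  (measurable_velocity i).comp measurable_prodMk_left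

theorem IsMeanStationary.integral_increment (hm : IsMeanStationary μ) (i : Fin d)
    (t : unitInterval) : ∫ x : PathSpace d, (x t i - x 0 i) ∂μ = 0 := by
  have hcomp : ∀ s : unitInterval, Integrable (fun x : PathSpace d => x s i) μ ∧
      ∫ x : PathSpace d, x s i ∂μ = (∫ x : PathSpace d, x s ∂μ) i := by
    intro s
    exact ⟨(EuclideanSpace.proj (𝕜 := ℝ) i).integrable_comp (hm s).1,
      (EuclideanSpace.proj (𝕜 := ℝ) i).integral_comp_comm (hm s).1⟩
  rw [integral_sub (hcomp t).1 (hcomp 0).1, (hcomp t).2, (hcomp 0).2, (hm t).2, sub_self]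

/-- By Fubini and mean-stationarity, ∫₀ᵗ E ẋ_s ds = E(x_t - x_0) = 0 for every t in [0,1]; Lebesgue
differentiation removes the integral. -/
theorem ae_integral_velocity_eq_zero [IsProbabilityMeasure μ]
    (hac : ∀ᵐ x ∂μ, IsAbsCont x) (hm : IsMeanStationary μ)
    (h3 : ∫⁻ x, oneVar x ^ 3 ∂μ < ∞) (i : Fin d) :
    ∀ᵐ t ∂timeMeasure, ∫ x, velocity x i t ∂μ = 0 := by
  have hint := integrable_velocity_prod h3 i
  set h : ℝ → ℝ := fun t => ∫ x, velocity x i t ∂μ with hh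
  have hhint : Integrable h timeMeasure := hint.integral_prod_right
  have hprim : ∀ t ∈ Set.Icc (0 : ℝ) 1, ∫ s in (0 : ℝ)..t, h s = 0 := by
    intro t ht
    have hsub : volume.restrict (Set.Ioc 0 t) ≤ timeMeasure :=
      Measure.restrict_mono
        (show Set.Ioc 0 t ⊆ Set.Icc 0 1 from fun s hs => ⟨hs.1.le, hs.2.trans ht.2⟩) le_rfl
    have hint' : Integrable (fun p : PathSpace d × ℝ => velocity p.1 i p.2)
        (μ.prod (volume.restrict (Set.Ioc 0 t))) :=
      hint.mono_measure (Measure.prod_mono le_rfl hsub)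
    rw [intervalIntegral.integral_of_le ht.1]
    have hswap := integral_integral_swap (f := fun x s => velocity x i s) hint'
    refine hswap.symm.trans ((integral_congr_ae ?_).trans (hm.integral_increment i ⟨t, ht⟩))
    filter_upwards [hac] with x hx
    rw [← intervalIntegral.integral_of_le ht.1, hx.integral_velocity i ht, ← coord_zero,
      ← coord_coe]
  have hII : IntervalIntegrable h volume 0 1 := by
    rw [intervalIntegrable_iff_integrableOn_Icc_of_le zero_le_one]
    exact hhint
  rw [ae_restrict_iff' measurableSet_Icc]
  -- The primitive is known to vanish only on [0,1], so the two endpoints are discarded to have a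
  -- full neighbourhood.
  filter_upwards [hII.ae_hasDerivAt_integral, Measure.ae_ne volume (0 : ℝ),
    Measure.ae_ne volume (1 : ℝ)] with t ht h0 h1 htm
  have hd := ht (by rwa [Set.uIcc_of_le zero_le_one]) 0 (by simp)
  have hnhds : Set.Icc (0 : ℝ) 1 ∈ nhds t :=
    Icc_mem_nhds (lt_of_le_of_ne htm.1 h0.symm) (lt_of_le_of_ne htm.2 h1)
  have hd0 : HasDerivAt (fun s => ∫ u in (0 : ℝ)..s, h u) 0 t :=
    (hasDerivAt_const t (0 : ℝ)).congr_of_eventuallyEq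
      (Filter.eventually_of_mem hnhds fun s hs => hprim s hs)
  exact hd.unique hd0

/-- The pair of components i, j (possibly equal) is independent of component k, so the mean-zero
velocity of k factors out. Any non-constant triple contains an index different from the other two,
so this treats all mixed third moments. -/
theorem IsIC.integral_velocity_mul (hic : IsIC μ) {i j k : Fin d} (hik : i ≠ k) (hjk : j ≠ k)
    {r s t : ℝ} (ht : ∫ x, velocity x k t ∂μ = 0) :
    ∫ x, velocity x i r * velocity x j s * velocity x k t ∂μ = 0 := by
  have hind := hic.indepFun_prodMk (fun i => measurable_component i) i j k hik hjk
  have hind2 := hind.comp (φ := fun p : C(unitInterval, ℝ) × C(unitInterval, ℝ) =>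
      deriv (Set.IccExtend (zero_le_one' ℝ) p.1) r * deriv (Set.IccExtend (zero_le_one' ℝ) p.2) s)
    (ψ := fun y : C(unitInterval, ℝ) => deriv (Set.IccExtend (zero_le_one' ℝ) y) t)
    (((measurable_scalar_velocity r).comp measurable_fst).mul
      ((measurable_scalar_velocity s).comp measurable_snd)) (measurable_scalar_velocity t)
  have h := IndepFun.integral_fun_mul_eq_mul_integral
    (X := fun x : PathSpace d => velocity x i r * velocity x j s)
    (Y := fun x : PathSpace d => velocity x k t) hind2
    ((measurable_velocity_left i r).mul (measurable_velocity_left j s)).aestronglyMeasurable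
    (measurable_velocity_left k t).aestronglyMeasurable
  rw [h, ht, mul_zero]

theorem IsIC.integral_velocity_mul_pair (hic : IsIC μ) {i k : Fin d} (hik : i ≠ k)
    {r t : ℝ} (ht : ∫ x, velocity x k t ∂μ = 0) :
    ∫ x, velocity x i r * velocity x k t ∂μ = 0 := by
  have hind2 := (hic.indepFun hik).comp (φ := fun y : C(unitInterval, ℝ) =>
      deriv (Set.IccExtend (zero_le_one' ℝ) y) r)
    (ψ := fun y : C(unitInterval, ℝ) => deriv (Set.IccExtend (zero_le_one' ℝ) y) t)
    (measurable_scalar_velocity r) (measurable_scalar_velocity t)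
  have h := IndepFun.integral_fun_mul_eq_mul_integral
    (X := fun x : PathSpace d => velocity x i r)
    (Y := fun x : PathSpace d => velocity x k t) hind2
    (measurable_velocity_left i r).aestronglyMeasurable
    (measurable_velocity_left k t).aestronglyMeasurable
  rw [h, ht, mul_zero]

/-- One integral over the simplex, written as an indicator on the square with the later time first;
in this form Fubini exchanges it with the expectation. -/
theorem sigCoeff_pair_eq_integral (x : PathSpace d) (i j : Fin d)
    (hint : Integrable (fun p : ℝ × ℝ => {p : ℝ × ℝ | p.2 ≤ p.1}.indicator
      (fun p => velocity x j p.1 * velocity x i p.2) p) (timeMeasure.prod timeMeasure)) :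
    sigCoeff [i, j] x = ∫ p : ℝ × ℝ, {p : ℝ × ℝ | p.2 ≤ p.1}.indicator
      (fun p => velocity x j p.1 * velocity x i p.2) p ∂(timeMeasure.prod timeMeasure) := by
  rw [integral_prod _ hint]
  change ∫ s in (0 : ℝ)..1, iteratedIntegral x [i] s * velocity x j s = _
  rw [integral_timeMeasure]
  refine setIntegral_congr_fun measurableSet_Icc fun s hs => ?_
  have e : iteratedIntegral x [i] s = ∫ r, (Set.Iic s).indicator (velocity x i) r ∂timeMeasure := by
    rw [← intervalIntegral_eq_integral_timeMeasure _ hs]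
    simp [iteratedIntegral]
  rw [e, mul_comm, ← integral_const_mul]
  refine integral_congr_ae (Filter.Eventually.of_forall fun r => ?_)
  by_cases hr : r ≤ s <;> simp [Set.indicator, hr]

theorem sigCoeff_triple_eq_integral (x : PathSpace d) (i j k : Fin d)
    (hint : Integrable (fun p : ℝ × ℝ × ℝ => {p : ℝ × ℝ × ℝ | p.2.1 ≤ p.1 ∧ p.2.2 ≤ p.2.1}.indicator
      (fun p => velocity x k p.1 * (velocity x j p.2.1 * velocity x i p.2.2)) p)
      (timeMeasure.prod (timeMeasure.prod timeMeasure))) :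
    sigCoeff [i, j, k] x =
      ∫ p : ℝ × ℝ × ℝ, {p : ℝ × ℝ × ℝ | p.2.1 ≤ p.1 ∧ p.2.2 ≤ p.2.1}.indicator
        (fun p => velocity x k p.1 * (velocity x j p.2.1 * velocity x i p.2.2)) p
        ∂(timeMeasure.prod (timeMeasure.prod timeMeasure)) := by
  rw [integral_prod _ hint]
  change ∫ t in (0 : ℝ)..1, iteratedIntegral x [j, i] t * velocity x k t = _
  rw [integral_timeMeasure]
  refine integral_congr_ae ?_
  filter_upwards [hint.prod_right_ae, ae_restrict_mem measurableSet_Icc] with t hti ht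
  rw [integral_prod _ hti]
  have e : iteratedIntegral x [j, i] t = ∫ s, (Set.Iic t).indicator
      (fun s => iteratedIntegral x [i] s * velocity x j s) s ∂timeMeasure := by
    rw [← intervalIntegral_eq_integral_timeMeasure _ ht]
    rfl
  rw [e, mul_comm, ← integral_const_mul]
  refine setIntegral_congr_fun measurableSet_Icc fun s hs => ?_
  have e2 : iteratedIntegral x [i] s =
      ∫ r, (Set.Iic s).indicator (velocity x i) r ∂timeMeasure := by
    rw [← intervalIntegral_eq_integral_timeMeasure _ hs]
    simp [iteratedIntegral]
  by_cases hst : s ≤ t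
  · rw [Set.indicator_of_mem (show s ∈ Set.Iic t from hst), e2, mul_comm _ (velocity x j s),
      ← mul_assoc, ← integral_const_mul]
    refine integral_congr_ae (Filter.Eventually.of_forall fun r => ?_)
    by_cases hr : r ≤ s <;> simp [Set.indicator, hr, hst, mul_assoc]
  · simp [Set.indicator, hst]

theorem integrable_indicator_velocity_pair [IsProbabilityMeasure μ]
    (h3 : ∫⁻ x, oneVar x ^ 3 ∂μ < ∞) (i j : Fin d) :
    Integrable (fun q : PathSpace d × ℝ × ℝ => {p : ℝ × ℝ | p.2 ≤ p.1}.indicator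
      (fun p => velocity q.1 j p.1 * velocity q.1 i p.2) q.2)
      (μ.prod (timeMeasure.prod timeMeasure)) := by
  have hS : MeasurableSet {q : PathSpace d × ℝ × ℝ | q.2.2 ≤ q.2.1} :=
    measurableSet_le (by fun_prop) (by fun_prop)
  have hm : Measurable fun q : PathSpace d × ℝ × ℝ =>
      velocity q.1 j q.2.1 * velocity q.1 i q.2.2 :=
    ((measurable_velocity j).comp (by fun_prop : Measurable fun q : PathSpace d × ℝ × ℝ =>
      (q.1, q.2.1))).mul ((measurable_velocity i).comp
        (by fun_prop : Measurable fun q : PathSpace d × ℝ × ℝ => (q.1, q.2.2)))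
  have hI : Integrable (fun q : PathSpace d × ℝ × ℝ => velocity q.1 j q.2.1 * velocity q.1 i q.2.2)
      (μ.prod (timeMeasure.prod timeMeasure)) := by
    refine ⟨hm.aestronglyMeasurable, ?_⟩
    rw [hasFiniteIntegral_iff_enorm, lintegral_prod _ hm.enorm.aemeasurable]
    refine (lintegral_mono fun x => ?_).trans_lt
      (lintegral_oneVar_pow_lt_top h3 (n := 2) (by norm_num))
    simp_rw [enorm_mul]
    rw [lintegral_prod_mul (measurable_velocity_right x j).enorm.aemeasurable
      (measurable_velocity_right x i).enorm.aemeasurable, sq]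
    exact mul_le_mul' (lintegral_velocity_le_oneVar x j) (lintegral_velocity_le_oneVar x i)
  exact hI.indicator hS

/-- Without the indicator, the time integral of the absolute value splits into three one-dimensional
integrals, each at most `oneVar x`. This is where the third moment of the 1-variation norm enters.
-/
theorem integrable_indicator_velocity_triple [IsProbabilityMeasure μ]
    (h3 : ∫⁻ x, oneVar x ^ 3 ∂μ < ∞) (i j k : Fin d) :
    Integrable (fun q : PathSpace d × ℝ × ℝ × ℝ =>
      {p : ℝ × ℝ × ℝ | p.2.1 ≤ p.1 ∧ p.2.2 ≤ p.2.1}.indicator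
      (fun p => velocity q.1 k p.1 * (velocity q.1 j p.2.1 * velocity q.1 i p.2.2)) q.2)
      (μ.prod (timeMeasure.prod (timeMeasure.prod timeMeasure))) := by
  have hS : MeasurableSet {q : PathSpace d × ℝ × ℝ × ℝ | q.2.2.1 ≤ q.2.1 ∧ q.2.2.2 ≤ q.2.2.1} :=
    MeasurableSet.inter (s₁ := {q : PathSpace d × ℝ × ℝ × ℝ | q.2.2.1 ≤ q.2.1})
      (s₂ := {q : PathSpace d × ℝ × ℝ × ℝ | q.2.2.2 ≤ q.2.2.1})
      (measurableSet_le (by fun_prop) (by fun_prop)) (measurableSet_le (by fun_prop) (by fun_prop))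
  have hm : Measurable fun q : PathSpace d × ℝ × ℝ × ℝ =>
      velocity q.1 k q.2.1 * (velocity q.1 j q.2.2.1 * velocity q.1 i q.2.2.2) :=
    ((measurable_velocity k).comp (by fun_prop : Measurable fun q : PathSpace d × ℝ × ℝ × ℝ =>
      (q.1, q.2.1))).mul (((measurable_velocity j).comp
        (by fun_prop : Measurable fun q : PathSpace d × ℝ × ℝ × ℝ => (q.1, q.2.2.1))).mul
        ((measurable_velocity i).comp
        (by fun_prop : Measurable fun q : PathSpace d × ℝ × ℝ × ℝ => (q.1, q.2.2.2))))
  have hI : Integrable (fun q : PathSpace d × ℝ × ℝ × ℝ =>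
      velocity q.1 k q.2.1 * (velocity q.1 j q.2.2.1 * velocity q.1 i q.2.2.2))
      (μ.prod (timeMeasure.prod (timeMeasure.prod timeMeasure))) := by
    refine ⟨hm.aestronglyMeasurable, ?_⟩
    rw [hasFiniteIntegral_iff_enorm, lintegral_prod _ hm.enorm.aemeasurable]
    refine (lintegral_mono fun x => ?_).trans_lt h3
    simp_rw [enorm_mul]
    have hmm : Measurable fun p : ℝ × ℝ => ‖velocity x j p.1‖ₑ * ‖velocity x i p.2‖ₑ :=
      ((measurable_velocity_right x j).enorm.comp measurable_fst).mul
        ((measurable_velocity_right x i).enorm.comp measurable_snd)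
    rw [lintegral_prod_mul (measurable_velocity_right x k).enorm.aemeasurable hmm.aemeasurable,
      lintegral_prod_mul (measurable_velocity_right x j).enorm.aemeasurable
      (measurable_velocity_right x i).enorm.aemeasurable, pow_succ', sq]
    exact mul_le_mul' (lintegral_velocity_le_oneVar x k)
      (mul_le_mul' (lintegral_velocity_le_oneVar x j) (lintegral_velocity_le_oneVar x i))
  exact hI.indicator hS

theorem integral_eq_zero_of_ae_slices [IsProbabilityMeasure μ]
    {Y : Type*} [MeasurableSpace Y] {σ : Measure Y} [SFinite σ]
    {f : PathSpace d × Y → ℝ} (hf : Integrable f (μ.prod σ)) {S : PathSpace d → ℝ}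
    (hS : ∀ᵐ x ∂μ, S x = ∫ y, f (x, y) ∂σ) (h0 : ∀ᵐ y ∂σ, ∫ x, f (x, y) ∂μ = 0) :
    ∫ x, S x ∂μ = 0 := by
  rw [integral_congr_ae hS, integral_integral_swap (f := fun x y => f (x, y)) hf,
    integral_congr_ae h0, integral_zero]

/-- Regular signals with independent components have diagonal second- and third-order moments. -/
theorem IsIC.isOrthogonal [IsProbabilityMeasure μ]
    (hic : IsIC μ) (hac : ∀ᵐ x ∂μ, IsAbsCont x) (hm : IsMeanStationary μ)
    (h3 : ∫⁻ x, oneVar x ^ 3 ∂μ < ∞) : IsOrthogonal μ := by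
  have hz : ∀ᵐ t ∂timeMeasure, ∀ i : Fin d, ∫ x, velocity x i t ∂μ = 0 :=
    ae_all_iff.2 fun i => ae_integral_velocity_eq_zero hac hm h3 i
  refine ⟨fun i j hij => ?_, fun i j k hijk => ?_⟩
  · have hint := integrable_indicator_velocity_pair (μ := μ) h3 i j
    refine integral_eq_zero_of_ae_slices hint ?_ ?_
    · filter_upwards [hint.prod_right_ae] with x hx using sigCoeff_pair_eq_integral x i j hx
    · filter_upwards [Measure.quasiMeasurePreserving_fst.ae hz] with p hp
      by_cases hpS : p.2 ≤ p.1
      · simp only [Set.indicator, Set.mem_ofPred_eq, hpS, if_true]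
        rw [← hic.integral_velocity_mul_pair hij (r := p.2) (hp j)]
        refine integral_congr_ae (Filter.Eventually.of_forall fun x => ?_)
        simp only [mul_comm]
      · simp [Set.indicator, hpS]
  · have hint := integrable_indicator_velocity_triple (μ := μ) h3 i j k
    refine integral_eq_zero_of_ae_slices hint ?_ ?_
    · filter_upwards [hint.prod_right_ae] with x hx using sigCoeff_triple_eq_integral x i j k hx
    · filter_upwards [Measure.quasiMeasurePreserving_fst.ae hz,
        Measure.quasiMeasurePreserving_snd.ae (Measure.quasiMeasurePreserving_fst.ae hz),
        Measure.quasiMeasurePreserving_snd.ae (Measure.quasiMeasurePreserving_snd.ae hz)]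
        with p h1 h2 h3'
      by_cases hpS : p.2.1 ≤ p.1 ∧ p.2.2 ≤ p.2.1
      · simp only [Set.indicator, Set.mem_ofPred_eq, hpS, and_self, if_true]
        -- Find the index that differs from the other two: j if i = k, then i if j = k, and
        -- otherwise k.
        by_cases hik : i = k
        · have hkj : k ≠ j := fun h => hijk ⟨hik.trans h, h.symm⟩
          rw [← hic.integral_velocity_mul (hik ▸ hkj) hkj (r := p.2.2) (s := p.1) (h2 j)]
          refine integral_congr_ae (Filter.Eventually.of_forall fun x => ?_)
          simp only; ring
        · by_cases hjk : j = k
          · have hki : k ≠ i := fun h => hik h.symm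
            rw [← hic.integral_velocity_mul (hjk ▸ hki) hki (r := p.2.1) (s := p.1) (h3' i)]
            refine integral_congr_ae (Filter.Eventually.of_forall fun x => ?_)
            simp only; ring
          · rw [← hic.integral_velocity_mul hik hjk (r := p.2.2) (s := p.2.1) (h1 k)]
            refine integral_congr_ae (Filter.Eventually.of_forall fun x => ?_)
            simp only; ring
      · simp [Set.indicator, hpS]

end Expectation

end IndependentComponents

/-! ### The contrast: compact domain, minimisers, and consequences of low contrast -/

section Contrast

open scoped Matrix.Norms.L2Operator

variable {d : ℕ}

theorem cond₂_eq (A : Matrix (Fin d) (Fin d) ℝ) : cond₂ A = ‖A‖ * ‖A⁻¹‖ := rfl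

theorem frob_mul_le (A B : Matrix (Fin d) (Fin d) ℝ) : frob (A * B) ≤ frob A * frob B := by
  refine Real.sqrt_le_iff.2 ⟨mul_nonneg (frob_nonneg A) (frob_nonneg B), ?_⟩
  rw [mul_pow, frob_sq, frob_sq, Finset.sum_mul]
  refine Finset.sum_le_sum fun i _ => ?_
  rw [Finset.sum_comm (s := (Finset.univ : Finset (Fin d))) (f := fun k j => B k j ^ 2),
    Finset.mul_sum]
  exact Finset.sum_le_sum fun j _ =>
    Finset.sum_mul_sq_le_sq_mul_sq Finset.univ (A i) (fun k => B k j)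

theorem frob_eq_zero {A : Matrix (Fin d) (Fin d) ℝ} (h : frob A ≤ 0) : A = 0 := by
  ext i j
  exact abs_nonpos_iff.1 ((abs_entry_le_frob A i j).trans h)

/-- Removing the full diagonal is the best diagonal approximation. The defect removes a single entry
from each [ζ]_ν and therefore dominates the off-diagonality. -/
theorem offDiag_sq_le (X : Matrix (Fin d) (Fin d) ℝ) (v : Fin d → ℝ) :
    offDiag X ^ 2 ≤ frob (X - diagonal v) ^ 2 := by
  rw [offDiag, frob_sq, frob_sq]
  refine Finset.sum_le_sum fun i _ => Finset.sum_le_sum fun j _ => ?_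
  by_cases hij : i = j
  · subst hij; simp [sq_nonneg]
  · simp [diagonal_apply_ne _ hij]

theorem of_ite_eq_diagonal_single (ν : Fin d) (f : Fin d → Fin d → ℝ) :
    (Matrix.of fun i j => if i = j ∧ j = ν then f i j else 0) =
      diagonal (Pi.single ν (f ν ν)) := by
  ext i j
  by_cases hij : i = j
  · subst hij
    by_cases hi : i = ν
    · subst hi; simp
    · simp [hi]
  · simp [hij]

theorem continuous_norm_matrix : Continuous fun M : Matrix (Fin d) (Fin d) ℝ => ‖M‖ :=
  continuous_norm

theorem isCompact_setOf_entries_mem (c : ℝ) :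
    IsCompact {M : Matrix (Fin d) (Fin d) ℝ | ∀ i j, M i j ∈ Set.Icc (-c) c} := by
  have h : IsCompact (Set.univ.pi fun _ => Set.univ.pi fun _ => Set.Icc (-c) c :
      Set (Fin d → Fin d → ℝ)) :=
    isCompact_univ_pi fun _ => isCompact_univ_pi fun _ => isCompact_Icc
  have h2 : IsCompact ((fun v => Matrix.of v) '' (Set.univ.pi fun _ => Set.univ.pi fun _ =>
      Set.Icc (-c) c : Set (Fin d → Fin d → ℝ))) :=
    h.image continuous_id
  refine h2.of_isClosed_subset ?_ fun M hM => ⟨fun i j => M i j, ?_, rfl⟩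
  · have e : {M : Matrix (Fin d) (Fin d) ℝ | ∀ i j, M i j ∈ Set.Icc (-c) c} =
        ⋂ i, ⋂ j, {M | M i j ∈ Set.Icc (-c) c} := by
      ext M; simp
    rw [e]
    exact isClosed_iInter fun i => isClosed_iInter fun j =>
      isClosed_Icc.preimage (by fun_prop : Continuous fun M : Matrix (Fin d) (Fin d) ℝ => M i j)
  · exact fun i _ j _ => hM i j

theorem isClosed_setOf_unit_rows :
    IsClosed {M : Matrix (Fin d) (Fin d) ℝ | ∀ i, √(∑ j, M i j ^ 2) = 1} := by
  have e : {M : Matrix (Fin d) (Fin d) ℝ | ∀ i, √(∑ j, M i j ^ 2) = 1} =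
      ⋂ i, {M | √(∑ j, M i j ^ 2) = 1} := by
    ext M; simp
  rw [e]
  exact isClosed_iInter fun i => isClosed_eq (by fun_prop) continuous_const

theorem one_le_norm_of_unit_rows {θ : Matrix (Fin d) (Fin d) ℝ}
    (h : ∀ i, √(∑ j, θ i j ^ 2) = 1) (i : Fin d) : 1 ≤ ‖θ‖ := by
  have h1 := sum_vecMul_sq_le θ (Pi.single i 1)
  rw [single_one_vecMul] at h1
  have h2 : ∑ k, (Pi.single i (1:ℝ) : Fin d → ℝ) k ^ 2 = 1 := by simp [Pi.single_apply]
  have h3 := Real.sqrt_eq_one.1 (h i)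
  rw [h2, mul_one] at h1
  exact (one_le_sq_iff₀ (norm_nonneg θ)).1 (h3 ▸ h1)

/-- The optimisation domain is compact. -/
theorem isCompact_domainXi (κ₀ : ℝ) : IsCompact (domainXi d κ₀) := by
  -- Invertibility is not a closed condition, so θ is paired with its inverse: θη = 1 and ‖θ‖‖η‖ ≤
  -- κ₀ are closed conditions, and unit rows give ‖θ‖ ≥ 1, hence ‖η‖ ≤ κ₀. The domain is a
  -- projection of this compact set.
  set K : Set (Matrix (Fin d) (Fin d) ℝ × Matrix (Fin d) (Fin d) ℝ) :=
    {p | (∀ i, √(∑ j, p.1 i j ^ 2) = 1) ∧ p.1 * p.2 = 1 ∧ ‖p.1‖ * ‖p.2‖ ≤ κ₀} with hK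
  have hKclosed : IsClosed K := by
    have h1 := isClosed_setOf_unit_rows (d := d).preimage
      (continuous_fst (X := Matrix (Fin d) (Fin d) ℝ) (Y := Matrix (Fin d) (Fin d) ℝ))
    have h2 : IsClosed {p : Matrix (Fin d) (Fin d) ℝ × Matrix (Fin d) (Fin d) ℝ |
        p.1 * p.2 = 1} := isClosed_eq (by fun_prop) continuous_const
    have h3 : IsClosed {p : Matrix (Fin d) (Fin d) ℝ × Matrix (Fin d) (Fin d) ℝ |
        ‖p.1‖ * ‖p.2‖ ≤ κ₀} :=
      isClosed_le ((continuous_norm_matrix.comp continuous_fst).mul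
        (continuous_norm_matrix.comp continuous_snd)) continuous_const
    exact h1.inter (h2.inter h3)
  have hKcompact : IsCompact K := by
    refine ((isCompact_setOf_entries_mem 1).prod
      (isCompact_setOf_entries_mem κ₀)).of_isClosed_subset hKclosed fun p hp => ⟨?_, ?_⟩
    · intro i j
      refine abs_le.1 ?_
      rw [← hp.1 i]
      exact Real.abs_le_sqrt (Finset.single_le_sum (f := fun j => p.1 i j ^ 2)
        (fun _ _ => sq_nonneg _) (Finset.mem_univ j))
    · refine fun i j => abs_le.1 ((abs_entry_le_norm p.2 i j).trans (le_trans ?_ hp.2.2))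
      exact le_mul_of_one_le_left (norm_nonneg _) (one_le_norm_of_unit_rows hp.1 i)
  have e : domainXi d κ₀ = Prod.fst '' K := by
    ext θ
    constructor
    · exact fun hθ => ⟨(θ, θ⁻¹), ⟨hθ.1, mul_nonsing_inv _ hθ.2.1, hθ.2.2⟩, rfl⟩
    · rintro ⟨p, hp, rfl⟩
      refine ⟨hp.1, (Matrix.isUnit_iff_isUnit_det _).1 (IsUnit.of_mul_eq_one _ hp.2.1), ?_⟩
      rw [cond₂_eq, Matrix.inv_eq_right_inv hp.2.1]
      exact hp.2.2
  rw [e]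
  exact hKcompact.image continuous_fst

section Observable

variable {χ : Measure (PathSpace d)}

theorem stdMatrix_eq_one {μ : Measure (PathSpace d)} (h : ∀ i, sigMoment μ [i, i] = 1) :
    stdMatrix μ = 1 := by
  simp [stdMatrix, h]

/-- (θR)C_χ(θR)ᵀ = θθᵀ, whose diagonal is 1 for unit rows. Hence the normalisations in the contrast
disappear on Ξ₁. -/
theorem HasCoredinates.sigMoment_whitened (hχ : HasCoredinates χ) (hC : IsUnit (symCore χ).det)
    {θ : Matrix (Fin d) (Fin d) ℝ} (hrow : ∀ i, √(∑ j, θ i j ^ 2) = 1) (hdet : IsUnit θ.det)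
    (i : Fin d) : sigMoment (push (linMap (θ * whitening χ)) χ) [i, i] = 1 := by
  have hu : IsUnit (θ * whitening χ).det := by
    rw [det_mul]; exact hdet.mul (hχ.isUnit_det_whitening hC)
  rw [← symCore_diag, hχ.symCore_push hu, transpose_mul, transpose_whitening]
  have e : θ * whitening χ * symCore χ * (whitening χ * θᵀ) = θ * θᵀ := by
    calc θ * whitening χ * symCore χ * (whitening χ * θᵀ) =
        θ * (whitening χ * symCore χ * whitening χ) * θᵀ := by simp only [mul_assoc]
      _ = _ := by rw [hχ.whitening_mul_symCore_mul hC, mul_one]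
  rw [e, Matrix.mul_apply]
  have h := hrow i
  rw [Real.sqrt_eq_one] at h
  simpa [sq] using h

theorem HasCoredinates.contrast_eq (hχ : HasCoredinates χ) (hC : IsUnit (symCore χ).det)
    {θ : Matrix (Fin d) (Fin d) ℝ} (hrow : ∀ i, √(∑ j, θ i j ^ 2) = 1) (hdet : IsUnit θ.det) :
    contrast χ θ = offDiag (core₀ (push (linMap (θ * whitening χ)) χ)) ^ 2 +
      ∑ ν, offDiag (core (push (linMap (θ * whitening χ)) χ) ν) ^ 2 := by
  have h1 := hχ.sigMoment_whitened hC hrow hdet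
  have h2 := stdMatrix_eq_one h1
  simp only [contrast, stat₀, stat, h1, h2, inv_one, one_mul, mul_one, Real.sqrt_one, one_smul]

theorem HasCoredinates.exists_minimiser (hχ : HasCoredinates χ) (hC : IsUnit (symCore χ).det)
    {κ₀ : ℝ} (hne : (domainXi d κ₀).Nonempty) :
    ∃ θ ∈ domainXi d κ₀, ∀ η ∈ domainXi d κ₀, contrast χ θ ≤ contrast χ η := by
  set R := whitening χ with hR
  have hRu : IsUnit R.det := hχ.isUnit_det_whitening hC
  -- On the domain the contrast agrees with this expression, which contains no normalisation and is
  -- continuous on all matrices.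
  set F : Matrix (Fin d) (Fin d) ℝ → ℝ := fun θ =>
    offDiag (θ * core₀ (push (linMap R) χ) * θᵀ) ^ 2 +
      ∑ ν, offDiag (θ * (∑ k, θ ν k • core (push (linMap R) χ) k) * θᵀ) ^ 2 with hF
  have hFeq : ∀ θ ∈ domainXi d κ₀, contrast χ θ = F θ := by
    intro θ hθ
    rw [hχ.contrast_eq hC hθ.1 hθ.2.1, ← push_linMap_push_linMap,
      (hχ.push_linMap hRu).core₀_push hθ.2.1]
    simp only [hF]
    congr 1
    refine Finset.sum_congr rfl fun ν _ => ?_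
    rw [(hχ.push_linMap hRu).core_push hθ.2.1]
  have hFc : Continuous F := by
    simp only [hF, offDiag, frob]
    fun_prop
  obtain ⟨θ, hθ, hmin⟩ := (isCompact_domainXi κ₀).exists_isMinOn hne hFc.continuousOn
  refine ⟨θ, hθ, fun η hη => ?_⟩
  rw [hFeq _ hθ, hFeq _ hη]
  exact hmin hη

end Observable

/-! ### The whitened unmixing matrix as a competitor -/

section StandardisedCause

variable {z : Measure (PathSpace d)} {A : Matrix (Fin d) (Fin d) ℝ}

theorem HasCoredinates.isUnit_det_symCore_push (hz : HasCoredinates z)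
    (hC : IsUnit (symCore z).det) (hA : IsUnit A.det) :
    IsUnit (symCore (push (linMap A) z)).det := by
  rw [hz.symCore_push hA, det_mul, det_mul, det_transpose]
  exact (hA.mul hC).mul hA

theorem HasCoredinates.isUnit_det_whitenedMixing (hz : HasCoredinates z)
    (hC : IsUnit (symCore z).det) (hA : IsUnit A.det) : IsUnit (whitenedMixing z A).det := by
  rw [whitenedMixing, det_mul]
  exact ((hz.push_linMap hA).isUnit_det_whitening (hz.isUnit_det_symCore_push hC hA)).mul hA

theorem HasCoredinates.whitenedUnmixing_mul_whitening (hz : HasCoredinates z)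
    (hC : IsUnit (symCore z).det) (hA : IsUnit A.det) :
    whitenedUnmixing z A * whitening (push (linMap A) z) = A⁻¹ := by
  have hR := (hz.push_linMap hA).isUnit_det_whitening (hz.isUnit_det_symCore_push hC hA)
  rw [whitenedUnmixing, whitenedMixing, Matrix.mul_inv_rev, mul_assoc, nonsing_inv_mul _ hR, mul_one]

/-- W = RA satisfies W C_z Wᵀ = 1; inverting W gives the claim. In particular the squared row
lengths of B_R are the moments ⟨z⟩_ii, so a standardised source has B_R with unit rows. -/
theorem HasCoredinates.whitenedUnmixing_mul_transpose (hz : HasCoredinates z)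
    (hC : IsUnit (symCore z).det) (hA : IsUnit A.det) :
    whitenedUnmixing z A * (whitenedUnmixing z A)ᵀ = symCore z := by
  have hX := hz.push_linMap hA
  have h := hX.whitening_mul_symCore_mul (hz.isUnit_det_symCore_push hC hA)
  have hu := hz.isUnit_det_whitenedMixing hC hA
  set W := whitenedMixing z A with hW
  have h' : W * symCore z * Wᵀ = 1 := by
    rw [← h, hz.symCore_push hA, hW, whitenedMixing, transpose_mul, transpose_whitening]
    simp only [mul_assoc]
  have hBW : whitenedUnmixing z A * W = 1 := nonsing_inv_mul _ hu
  have hWB : Wᵀ * (whitenedUnmixing z A)ᵀ = 1 := by rw [← transpose_mul, hBW, transpose_one]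
  calc whitenedUnmixing z A * (whitenedUnmixing z A)ᵀ =
      whitenedUnmixing z A * (W * symCore z * Wᵀ) * (whitenedUnmixing z A)ᵀ := by
        rw [h', mul_one]
    _ = (whitenedUnmixing z A * W) * symCore z * (Wᵀ * (whitenedUnmixing z A)ᵀ) := by
        simp only [mul_assoc]
    _ = _ := by rw [hBW, hWB, one_mul, mul_one]

theorem HasCoredinates.sum_whitenedUnmixing_sq (hz : HasCoredinates z)
    (hC : IsUnit (symCore z).det) (hA : IsUnit A.det) (i : Fin d) :
    ∑ j, whitenedUnmixing z A i j ^ 2 = sigMoment z [i, i] := by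
  rw [← symCore_diag, ← hz.whitenedUnmixing_mul_transpose hC hA, Matrix.mul_apply]
  simp [sq]

theorem isUnit_det_whitenedUnmixing (hz : HasCoredinates z)
    (hC : IsUnit (symCore z).det) (hA : IsUnit A.det) : IsUnit (whitenedUnmixing z A).det :=
  isUnit_nonsing_inv_det _ (hz.isUnit_det_whitenedMixing hC hA)

/-- The squared distance of the coredinates of a standardised signal from their diagonals. -/
noncomputable def defectSq (z : Measure (PathSpace d)) : ℝ :=
  frob (core₀ z - 1) ^ 2 +
    ∑ ν, frob (core z ν - diagonal (Pi.single ν (sigMoment z [ν, ν, ν]))) ^ 2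

theorem defectSq_nonneg (z : Measure (PathSpace d)) : 0 ≤ defectSq z :=
  add_nonneg (sq_nonneg _) (Finset.sum_nonneg fun _ _ => sq_nonneg _)

theorem HasCoredinates.whitenedUnmixing_mem_domainXi (hz : HasCoredinates z)
    (hC : IsUnit (symCore z).det) (hunit : ∀ i, sigMoment z [i, i] = 1) (hA : IsUnit A.det)
    {κ₀ : ℝ} (hκ : cond₂ (whitenedUnmixing z A) ≤ κ₀) : whitenedUnmixing z A ∈ domainXi d κ₀ := by
  refine ⟨fun i => ?_, isUnit_det_whitenedUnmixing hz hC hA, hκ⟩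
  rw [hz.sum_whitenedUnmixing_sq hC hA, hunit, Real.sqrt_one]

/-- Since B_R R = A⁻¹, this competitor recovers z itself, and its contrast is the off-diagonality of
the coredinates of z. -/
theorem HasCoredinates.contrast_whitenedUnmixing_le (hz : HasCoredinates z)
    (hC : IsUnit (symCore z).det) (hunit : ∀ i, sigMoment z [i, i] = 1) (hA : IsUnit A.det) :
    contrast (push (linMap A) z) (whitenedUnmixing z A) ≤ defectSq z := by
  have hrow : ∀ i, √(∑ j, whitenedUnmixing z A i j ^ 2) = 1 := fun i => by
    rw [hz.sum_whitenedUnmixing_sq hC hA, hunit, Real.sqrt_one]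
  rw [(hz.push_linMap hA).contrast_eq (hz.isUnit_det_symCore_push hC hA) hrow
    (isUnit_det_whitenedUnmixing hz hC hA), hz.whitenedUnmixing_mul_whitening hC hA,
    push_linMap_push_linMap, nonsing_inv_mul _ hA, push_linMap_one]
  refine add_le_add ?_ (Finset.sum_le_sum fun ν _ => offDiag_sq_le _ _)
  rw [← diagonal_one]
  exact offDiag_sq_le _ _

/-- Points of low contrast are small perturbations of monomial multiples of the inverse mixing. -/
theorem HasCoredinates.exists_monomial_of_contrast_le (hz : HasCoredinates z)
    (hC : IsUnit (symCore z).det) (hA : IsUnit A.det)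
    {θ : Matrix (Fin d) (Fin d) ℝ} (hrow : ∀ i, √(∑ j, θ i j ^ 2) = 1) (hθ : IsUnit θ.det)
    {δ L t : ℝ} {l w : Fin d → ℝ} (hδ0 : 0 ≤ δ) (hδ : δ ≤ 0.095) (hdef : defectSq z ≤ δ ^ 2)
    (hcon : contrast (push (linMap A) z) θ ≤ δ ^ 2) (hl : ∀ k, l k = w k * sigMoment z [k, k, k])
    (hL0 : 0 ≤ L) (hL : ∀ k, |l k| ≤ L) (hsep : ∀ i j, i ≠ j → 1 ≤ |l i - l j|)
    (ht : t = δ / (1 - δ) * (√(∑ k, w k ^ 2) + L)) (ht1 : t ≤ 0.1034) :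
    ∃ M E : Matrix (Fin d) (Fin d) ℝ, IsMonomial M ∧
      θ * whitening (push (linMap A) z) = M * (1 + E) * A⁻¹ ∧ frob E ≤ √d * (4 * t) ∧
      ∃ E' : Matrix (Fin d) (Fin d) ℝ, M * E = E' * M ∧ frob E' ≤ √2 * (√d * (4 * t)) := by
  have hX := hz.push_linMap hA
  have hXC := hz.isUnit_det_symCore_push hC hA
  set R := whitening (push (linMap A) z) with hR
  have hRu : IsUnit R.det := hX.isUnit_det_whitening hXC
  set G := θ * R * A with hG
  have hGu : IsUnit G.det := by
    rw [hG, det_mul, det_mul]; exact (hθ.mul hRu).mul hA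
  have hpush : push (linMap (θ * R)) (push (linMap A) z) = push (linMap G) z :=
    push_linMap_push_linMap _ _ _
  have hone : ∀ i, sigMoment (push (linMap G) z) [i, i] = 1 := fun i => by
    rw [← hpush]; exact hX.sigMoment_whitened hXC hrow hθ i
  rw [hX.contrast_eq hXC hrow hθ, hpush] at hcon
  have hsq : ∀ {a b : ℝ}, 0 ≤ b → a + b ≤ δ ^ 2 → a ≤ δ ^ 2 := fun hb h => by linarith
  have hsumn : ∀ f : Fin d → ℝ, 0 ≤ ∑ ν, f ν ^ 2 := fun f =>
    Finset.sum_nonneg fun _ _ => sq_nonneg _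
  have hnle : ∀ X : Matrix (Fin d) (Fin d) ℝ, frob X ^ 2 ≤ δ ^ 2 → ‖X‖ ≤ δ := fun X h =>
    (norm_le_frob X).trans ((pow_le_pow_iff_left₀ (frob_nonneg X) hδ0 two_ne_zero).1 h)
  -- D₀ and Δ are the diagonality errors of z, bounded by the defect; O₀ and O are those of G·z,
  -- bounded by the contrast.
  obtain ⟨M, E, hM, hGM, hE, hE'⟩ := exists_monomial_mul_one_add (G := G) (D₀ := core₀ z - 1)
    (O₀ := core₀ (push (linMap G) z) - 1)
    (Δ := fun k => core z k - diagonal (Pi.single k (sigMoment z [k, k, k])))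
    (O := fun ν => core (push (linMap G) z) ν -
      diagonal fun i => core (push (linMap G) z) ν i i)
    (m := fun k => sigMoment z [k, k, k]) (w := w) (l := l)
    (μ := fun ν i => core (push (linMap G) z) ν i i) hGu hδ0 hδ
    (by rw [add_sub_cancel, add_sub_cancel, hz.core₀_push hGu])
    (fun ν => by
      rw [add_sub_cancel, hz.core_push hGu]
      simp only [add_sub_cancel])
    (hnle _ (hsq (hsumn _) hdef))
    (hnle _ (by
      -- The diagonal of [G·z]₀ is exactly 1, so subtracting the identity leaves the off-diagonal
      -- part.
      have h1 : offDiag (core₀ (push (linMap G) z)) = frob (core₀ (push (linMap G) z) - 1) := by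
        rw [offDiag, ← diagonal_one]
        congr 3
        funext i
        exact hone i
      rw [← h1]
      exact hsq (hsumn _) hcon))
    (Real.sqrt_le_iff.2 ⟨hδ0, (le_add_of_nonneg_left (sq_nonneg _)).trans hdef⟩)
    (Real.sqrt_le_iff.2 ⟨hδ0, (le_add_of_nonneg_left (sq_nonneg _)).trans hcon⟩)
    (fun ν i => by simp) hl hL0 hL hsep ht ht1
  refine ⟨M, E, hM, ?_, hE, hE'⟩
  rw [← hGM, hG, mul_assoc, mul_nonsing_inv _ hA, mul_one]

end StandardisedCause

/-- Weights that turn the third-order moments into a well-separated spectrum. -/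
theorem exists_separating_weights (m : Fin d → ℝ) (σ : Equiv.Perm (Fin d))
    (hσ : ∀ i : Fin d, (i : ℕ) ≠ 0 → m (σ i) ≠ 0) :
    ∃ l w : Fin d → ℝ, (∀ k, l k = w k * m k) ∧
      (1 ≤ d → ∀ k, |l k| ≤ (d : ℝ) - 1) ∧
      (∀ i j, i ≠ j → 1 ≤ |l i - l j|) ∧ ∀ i, w (σ i) = (i : ℕ) / m (σ i) := by
  -- The spectrum is l_σ(i) = i, counted from 0, so the one component whose moment may vanish
  -- receives l = 0 and weight 0.
  refine ⟨fun k => ((σ.symm k : ℕ) : ℝ), fun k => ((σ.symm k : ℕ) : ℝ) / m k, fun k => ?_,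
    fun _ k => ?_, fun i j hij => ?_, fun i => ?_⟩
  · by_cases hk : m k = 0
    · have h0 : (σ.symm k : ℕ) = 0 := by
        by_contra h
        exact hσ _ h (by rwa [Equiv.apply_symm_apply])
      simp [h0]
    · rw [div_mul_cancel₀ _ hk]
  · rw [Nat.abs_cast, le_sub_iff_add_le]
    exact_mod_cast (σ.symm k).2
  · have hne : (σ.symm i : ℕ) ≠ (σ.symm j : ℕ) := fun h =>
      hij (σ.symm.injective (Fin.ext h))
    have h1 : (1 : ℤ) ≤ |((σ.symm i : ℕ) : ℤ) - ((σ.symm j : ℕ) : ℤ)| :=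
      Int.one_le_abs (sub_ne_zero.2 (by exact_mod_cast hne))
    have h2 : ((1 : ℤ) : ℝ) ≤ ((|((σ.symm i : ℕ) : ℤ) - ((σ.symm j : ℕ) : ℤ)| : ℤ) : ℝ) :=
      Int.cast_le.2 h1
    rw [Int.cast_abs, Int.cast_sub, Int.cast_one, Int.cast_natCast, Int.cast_natCast] at h2
    exact h2
  · simp

end Contrast

/-! ### Reduction to a source with unit second moments -/

section Standardisation

variable {d : ℕ} {ζ : Measure (PathSpace d)} {A : Matrix (Fin d) (Fin d) ℝ}

theorem sigMoment_pair_self_pos (hζ : ζ ∈ coreSignals d) (i : Fin d) :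
    0 < sigMoment ζ [i, i] := by
  obtain ⟨h1, h2⟩ := mem_coreSignals_iff.1 hζ
  refine lt_of_le_of_ne ?_ (h2 i).symm
  rw [← symCore_diag]
  exact h1.posSemidef_symCore.diag_nonneg

theorem isUnit_det_stdMatrix (hζ : ζ ∈ coreSignals d) : IsUnit (stdMatrix ζ).det := by
  rw [stdMatrix, det_diagonal, isUnit_iff_ne_zero]
  exact Finset.prod_ne_zero_iff.2 fun i _ => (Real.sqrt_pos.2 (sigMoment_pair_self_pos hζ i)).ne'

theorem isUnit_det_inv_stdMatrix (hζ : ζ ∈ coreSignals d) : IsUnit (stdMatrix ζ)⁻¹.det :=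
  isUnit_nonsing_inv_det _ (isUnit_det_stdMatrix hζ)

theorem inv_diagonal_of_ne_zero {v : Fin d → ℝ} (hv : ∀ i, v i ≠ 0) :
    (diagonal v)⁻¹ = diagonal fun i => (v i)⁻¹ := by
  refine Matrix.inv_eq_right_inv ?_
  rw [diagonal_mul_diagonal, ← diagonal_one]
  congr 1
  funext i
  exact mul_inv_cancel₀ (hv i)

theorem inv_stdMatrix (hζ : ζ ∈ coreSignals d) :
    (stdMatrix ζ)⁻¹ = diagonal fun i => (√(sigMoment ζ [i, i]))⁻¹ :=
  inv_diagonal_of_ne_zero fun i => (Real.sqrt_pos.2 (sigMoment_pair_self_pos hζ i)).ne'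

theorem hasCoredinates_stdSource (hζ : ζ ∈ coreSignals d) : HasCoredinates (stdSource ζ) :=
  (mem_coreSignals_iff.1 hζ).1.push_linMap (isUnit_det_inv_stdMatrix hζ)

theorem core₀_stdSource (hζ : ζ ∈ coreSignals d) :
    core₀ (stdSource ζ) = (stdMatrix ζ)⁻¹ * core₀ ζ * (stdMatrix ζ)⁻¹ := by
  rw [stdSource, (mem_coreSignals_iff.1 hζ).1.core₀_push (isUnit_det_inv_stdMatrix hζ),
    inv_stdMatrix hζ, diagonal_transpose]

theorem core_stdSource (hζ : ζ ∈ coreSignals d) (ν : Fin d) :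
    core (stdSource ζ) ν =
      (stdMatrix ζ)⁻¹ * ((√(sigMoment ζ [ν, ν]))⁻¹ • core ζ ν) * (stdMatrix ζ)⁻¹ := by
  rw [stdSource, (mem_coreSignals_iff.1 hζ).1.core_push (isUnit_det_inv_stdMatrix hζ),
    inv_stdMatrix hζ, diagonal_transpose]
  congr 2
  rw [Finset.sum_eq_single ν]
  · rw [diagonal_apply_eq]
  · intro k _ hk
    rw [diagonal_apply_ne _ hk.symm, zero_smul]
  · simp

theorem sigMoment_pair_stdSource (hζ : ζ ∈ coreSignals d) (i : Fin d) :
    sigMoment (stdSource ζ) [i, i] = 1 := by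
  have h : core₀ (stdSource ζ) i i = sigMoment (stdSource ζ) [i, i] := rfl
  rw [← h, core₀_stdSource hζ, inv_stdMatrix hζ, mul_diagonal, diagonal_mul]
  have hp := sigMoment_pair_self_pos hζ i
  have h2 := Real.mul_self_sqrt hp.le
  have h3 := (Real.sqrt_pos.2 hp).ne'
  change (√(sigMoment ζ [i, i]))⁻¹ * sigMoment ζ [i, i] * (√(sigMoment ζ [i, i]))⁻¹ = 1
  field_simp
  rw [sq, h2]

theorem isUnit_det_symCore_stdSource (hζ : ζ ∈ coreSignals d) (hC : IsUnit (symCore ζ).det) :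
    IsUnit (symCore (stdSource ζ)).det :=
  (mem_coreSignals_iff.1 hζ).1.isUnit_det_symCore_push hC (isUnit_det_inv_stdMatrix hζ)

theorem sigMoment_triple_stdSource (hζ : ζ ∈ coreSignals d) (i : Fin d) :
    sigMoment (stdSource ζ) [i, i, i] = (√(sigMoment ζ [i, i]))⁻¹ ^ 3 * sigMoment ζ [i, i, i] := by
  have h : core (stdSource ζ) i i i = sigMoment (stdSource ζ) [i, i, i] := rfl
  rw [← h, core_stdSource hζ, inv_stdMatrix hζ, mul_diagonal, diagonal_mul]
  change (√(sigMoment ζ [i, i]))⁻¹ * ((√(sigMoment ζ [i, i]))⁻¹ * sigMoment ζ [i, i, i]) *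
    (√(sigMoment ζ [i, i]))⁻¹ = _
  ring

theorem sigMoment_triple_stdSource_eq_zero_iff (hζ : ζ ∈ coreSignals d) (i : Fin d) :
    sigMoment (stdSource ζ) [i, i, i] = 0 ↔ sigMoment ζ [i, i, i] = 0 := by
  rw [sigMoment_triple_stdSource hζ]
  have h3 := (Real.sqrt_pos.2 (sigMoment_pair_self_pos hζ i)).ne'
  simp [h3]

/-- The factors N_ζ⁻¹ in the defect are precisely the action of the standardisation on the
coredinates, under which the removed second-order diagonal becomes the identity. -/
theorem icDefect_eq (hζ : ζ ∈ coreSignals d) : icDefect ζ = √(defectSq (stdSource ζ)) := by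
  rw [icDefect, defectSq]
  congr 2
  · congr 2
    rw [mul_sub, sub_mul, ← core₀_stdSource hζ]
    congr 1
    have h1 : (Matrix.of fun i j => if i = j then sigMoment ζ [i, j] else 0) =
        diagonal fun i => sigMoment ζ [i, i] := by
      ext i j
      by_cases hij : i = j
      · subst hij; simp
      · simp [hij]
    rw [h1, inv_stdMatrix hζ, diagonal_mul_diagonal, diagonal_mul_diagonal, ← diagonal_one]
    congr 1
    funext i
    have hp := sigMoment_pair_self_pos hζ i
    have h2 := Real.mul_self_sqrt hp.le
    have h3 := (Real.sqrt_pos.2 hp).ne'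
    field_simp
    rw [sq, h2]
  · refine Finset.sum_congr rfl fun ν _ => ?_
    congr 2
    rw [smul_sub, mul_sub, sub_mul, ← core_stdSource hζ]
    congr 1
    rw [of_ite_eq_diagonal_single ν fun i j => sigMoment ζ [i, j, ν],
      sigMoment_triple_stdSource hζ, inv_stdMatrix hζ]
    ext i j
    rw [mul_diagonal, diagonal_mul, Matrix.smul_apply]
    by_cases hij : i = j
    · subst hij
      rw [diagonal_apply_eq, diagonal_apply_eq]
      by_cases hi : i = ν
      · subst hi
        simp only [Pi.single_eq_same, smul_eq_mul]
        ring
      · simp [hi]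
    · simp [diagonal_apply_ne _ hij]

theorem push_stdMixing_stdSource (hζ : ζ ∈ coreSignals d) :
    push (linMap (stdMixing ζ A)) (stdSource ζ) = push (linMap A) ζ := by
  rw [stdSource, push_linMap_push_linMap, stdMixing, mul_assoc,
    mul_nonsing_inv _ (isUnit_det_stdMatrix hζ), mul_one]

theorem isUnit_det_stdMixing (hζ : ζ ∈ coreSignals d) (hA : IsUnit A.det) :
    IsUnit (stdMixing ζ A).det := by
  rw [stdMixing, det_mul]
  exact hA.mul (isUnit_det_stdMatrix hζ)

/-- Rescaling the rows of the whitened unmixing matrix standardises the cause. -/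
theorem unitRows_whitenedUnmixing (hζ : ζ ∈ coreSignals d) (hC : IsUnit (symCore ζ).det)
    (hA : IsUnit A.det) :
    unitRows (whitenedUnmixing ζ A) = whitenedUnmixing (stdSource ζ) (stdMixing ζ A) := by
  have h1 : ∀ i, ∑ j, whitenedUnmixing ζ A i j ^ 2 = sigMoment ζ [i, i] :=
    (mem_coreSignals_iff.1 hζ).1.sum_whitenedUnmixing_sq hC hA
  rw [unitRows]
  simp_rw [h1]
  rw [whitenedUnmixing, whitenedUnmixing, whitenedMixing, whitenedMixing,
    push_stdMixing_stdSource hζ, stdMixing, ← mul_assoc, Matrix.mul_inv_rev _ (stdMatrix ζ)]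
  rfl

end Standardisation

/-! ### Estimates for the constants -/

section Constants

open scoped Matrix.Norms.L2Operator

variable {d : ℕ} {z : Measure (PathSpace d)} {A : Matrix (Fin d) (Fin d) ℝ}

theorem abs_dotProduct_mulVec_le (b : Fin d → ℝ) (X : Matrix (Fin d) (Fin d) ℝ)
    (hb : ∑ i, b i ^ 2 = 1) : |b ⬝ᵥ (X *ᵥ b)| ≤ ‖X‖ := by
  refine abs_le_of_sq_le_sq ?_ (norm_nonneg _)
  calc (b ⬝ᵥ (X *ᵥ b)) ^ 2 ≤ (∑ i, b i ^ 2) * ∑ i, (X *ᵥ b) i ^ 2 :=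
        Finset.sum_mul_sq_le_sq_mul_sq Finset.univ b (X *ᵥ b)
    _ ≤ ‖X‖ ^ 2 := by
        have := sum_mulVec_sq_le X b
        rw [hb, mul_one] at this
        rwa [hb, one_mul]

/-- As z = B_R·(A_R·z), this moment is the cubic form of A_R·z evaluated at row k of B_R, a unit
vector; Cauchy–Schwarz bounds it by ξ. -/
theorem abs_sigMoment_triple_le_xiConst (hz : HasCoredinates z) (hC : IsUnit (symCore z).det)
    (hunit : ∀ i, sigMoment z [i, i] = 1) (hA : IsUnit A.det) (k : Fin d) :
    |sigMoment z [k, k, k]| ≤ xiConst z A := by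
  have hu := hz.isUnit_det_whitenedMixing hC hA
  have hB := isUnit_det_whitenedUnmixing hz hC hA
  have hrow : ∀ i, ∑ j, whitenedUnmixing z A i j ^ 2 = 1 := fun i => by
    rw [hz.sum_whitenedUnmixing_sq hC hA, hunit]
  set Y := push (linMap (whitenedMixing z A)) z with hY
  have e : push (linMap (whitenedUnmixing z A)) Y = z := by
    rw [hY, push_linMap_push_linMap, whitenedUnmixing, nonsing_inv_mul _ hu, push_linMap_one]
  set b : Fin d → ℝ := fun j => whitenedUnmixing z A k j with hb
  have h1 : sigMoment z [k, k, k] = b ⬝ᵥ ((∑ c, b c • core Y c) *ᵥ b) := by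
    have h2 : sigMoment z [k, k, k] = core (push (linMap (whitenedUnmixing z A)) Y) k k k := by
      rw [e]; rfl
    rw [h2, (hz.push_linMap hu).core_push hB, mul_assoc, Matrix.mul_apply]
    rfl
  rw [h1]
  refine (abs_dotProduct_mulVec_le b _ (hrow k)).trans ((norm_sum_smul_le b _).trans ?_)
  rw [hrow k, Real.sqrt_one, one_mul]
  exact le_rfl

theorem one_le_cond₂ (hd : 0 < d) {B : Matrix (Fin d) (Fin d) ℝ} (hB : IsUnit B.det) :
    1 ≤ cond₂ B := by
  rw [cond₂_eq]
  refine le_trans ?_ (norm_mul_le B B⁻¹)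
  rw [mul_nonsing_inv _ hB]
  have h := abs_entry_le_norm (1 : Matrix (Fin d) (Fin d) ℝ) ⟨0, hd⟩ ⟨0, hd⟩
  simpa using h

theorem kConst_pos (hd : 2 ≤ d) : 0 < kConst d := by
  rw [kConst]
  refine Real.sqrt_pos.2 ?_
  have : (2 : ℝ) ≤ d := by exact_mod_cast hd
  have h1 : 0 < (d : ℝ) - 1 := by linarith
  have h2 : 0 < 2 * (d : ℝ) - 1 := by linarith
  positivity

/-- The elementary lower bound on the constant `k_d r₀`. -/
theorem kConst_mul_r₀Const_ge (hd : 2 ≤ d) (hz : HasCoredinates z) (hC : IsUnit (symCore z).det)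
    (hunit : ∀ i, sigMoment z [i, i] = 1) (hA : IsUnit A.det) {κ₀ : ℝ}
    (hκ : cond₂ (whitenedUnmixing z A) ≤ κ₀) (σ : Equiv.Perm (Fin d)) {w : Fin d → ℝ}
    (hσ : ∀ i : Fin d, (i : ℕ) ≠ 0 → sigMoment z [σ i, σ i, σ i] ≠ 0)
    (hw : ∀ i, w (σ i) = (i : ℕ) / sigMoment z [σ i, σ i, σ i]) :
    3 * (√(∑ k, w k ^ 2) + (d - 1)) ≤ kConst d * r₀Const κ₀ σ z A := by
  have hd0 : 0 < d := by omega
  have hdR : (2 : ℝ) ≤ d := by exact_mod_cast hd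
  have hκ2 := one_le_cond₂ hd0 (isUnit_det_whitenedUnmixing hz hC hA)
  set κ₂ := cond₂ (whitenedUnmixing z A) with hκ₂
  have hκ0 : 1 ≤ κ₀ := hκ2.trans hκ
  set s := √(∑ k, w k ^ 2) with hs
  have hs0 : 0 ≤ s := Real.sqrt_nonneg _
  have hk := kConst_pos hd
  -- With unit second moments the factor k_d cancels and k_d ς₁ is the length of the weight vector.
  have hς₁ : kConst d * varsigma₁ σ z = s := by
    rw [varsigma₁, ← mul_assoc, mul_inv_cancel₀ hk.ne', one_mul, hs,
      ← Equiv.sum_comp σ (fun k => w k ^ 2)]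
    congr 1
    refine Finset.sum_congr rfl fun i _ => ?_
    rw [hunit, hw, div_pow, one_pow, mul_one]
  have hfrob : frob (whitenedUnmixing z A) / √d = 1 := by
    have h1 : frob (whitenedUnmixing z A) = √d := by
      rw [frob]
      congr 1
      simp_rw [hz.sum_whitenedUnmixing_sq hC hA, hunit]
      simp
    rw [h1]
    exact div_self (Real.sqrt_pos.2 (by linarith)).ne'
  set ξ := xiConst z A with hξ
  have hξ0 : 0 ≤ ξ := Real.sqrt_nonneg _
  set ς := varsigma z with hς
  have hς0 : 0 ≤ ς := Real.sqrt_nonneg _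
  -- the last component of the enumeration
  set i₀ : Fin d := ⟨d - 1, by omega⟩ with hi₀
  have hi₀R : ((i₀ : ℕ) : ℝ) = d - 1 := by
    simp only [hi₀]; rw [Nat.cast_sub (by omega), Nat.cast_one]
  set m₀ := sigMoment z [σ i₀, σ i₀, σ i₀] with hm₀
  have hm₀0 : m₀ ≠ 0 := hσ i₀ (by simp only [hi₀]; omega)
  have hws : |w (σ i₀)| ≤ s := Real.abs_le_sqrt (Finset.single_le_sum (f := fun k => w k ^ 2)
    (fun _ _ => sq_nonneg _) (Finset.mem_univ _))
  -- The largest spectral value d - 1 is the product of a weight and a third moment, hence at most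
  -- sξ and at most sς.
  have hwm : (d : ℝ) - 1 = |w (σ i₀)| * |m₀| := by
    rw [← abs_mul, hw, div_mul_cancel₀ _ hm₀0, hi₀R, abs_of_nonneg (by linarith)]
  have hsξ : (d : ℝ) - 1 ≤ s * ξ := by
    rw [hwm]
    exact mul_le_mul hws (abs_sigMoment_triple_le_xiConst hz hC hunit hA _) (abs_nonneg _) hs0
  have hsς : (d : ℝ) - 1 ≤ s * ς := by
    rw [hwm]
    refine mul_le_mul hws ?_ (abs_nonneg _) hs0
    rw [hς, varsigma]
    refine Real.abs_le_sqrt ?_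
    simp_rw [hunit, one_pow, div_one]
    exact Finset.single_le_sum (f := fun i => sigMoment z [i, i, i] ^ 2)
      (fun _ _ => sq_nonneg _) (Finset.mem_univ (σ i₀))
  have e : kConst d * r₀Const κ₀ σ z A =
      κ₀ * s * (1 + κ₀ + (1 + ξ * d) * κ₀ * κ₂ + κ₂ * ς) := by
    rw [r₀Const, hfrob, ← hς₁]; ring
  rw [e]
  have hκκ : 1 ≤ κ₀ * κ₂ := one_le_mul_of_one_le_of_one_le hκ0 hκ2
  have hinner : 3 + ξ * d + ς ≤ 1 + κ₀ + (1 + ξ * d) * κ₀ * κ₂ + κ₂ * ς := by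
    have h1 : 1 + ξ * d ≤ (1 + ξ * d) * κ₀ * κ₂ := by
      rw [mul_assoc]
      exact le_mul_of_one_le_right (by positivity) hκκ
    have h2 : ς ≤ κ₂ * ς := le_mul_of_one_le_left hς0 hκ2
    linarith
  -- sξd + sς ≥ d(d-1) + (d-1) ≥ 3(d-1), because d ≥ 2.
  calc 3 * (s + (d - 1)) ≤ s * (3 + ξ * d + ς) := by nlinarith
    _ ≤ (κ₀ * s) * (3 + ξ * d + ς) :=
        mul_le_mul_of_nonneg_right (le_mul_of_one_le_left hs0 hκ0) (by positivity)
    _ ≤ _ := mul_le_mul_of_nonneg_left hinner (by positivity)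

/-- The threshold on the defect, in terms of the abstract constant `K = k_d r₀`. -/
theorem defect_bounds {K S δ : ℝ} (hδ0 : 0 ≤ δ) (hS : 1 ≤ S) (hK : 3 * S ≤ K)
    (hδ : δ ≤ ((1 + √5) * K)⁻¹ / (1 + ((1 + √5) * K)⁻¹)) :
    δ ≤ 0.095 ∧ 0 ≤ δ / (1 - δ) ∧ δ / (1 - δ) * S ≤ 0.1034 ∧
      3 * (δ / (1 - δ) * S) ≤ K * (δ / (1 - δ)) := by
  have h5 : 2.236 ≤ √5 := Real.le_sqrt_of_sq_le (by norm_num)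
  have hKpos : 0 < K := by linarith
  have hgK : 0 < (1 + √5) * K := by positivity
  set q₀ := ((1 + √5) * K)⁻¹ with hq₀
  have hq₀pos : 0 < q₀ := inv_pos.2 hgK
  have h1 : δ * (1 + q₀) ≤ q₀ := (le_div_iff₀ (by linarith)).1 hδ
  have hδ1 : δ < 1 := by nlinarith
  have hq : δ / (1 - δ) ≤ q₀ := by
    rw [div_le_iff₀ (by linarith)]; linarith
  have hqnn : 0 ≤ δ / (1 - δ) := div_nonneg hδ0 (by linarith)
  set q := δ / (1 - δ) with hqdef
  have hδq : δ = q * (1 - δ) := by rw [hqdef, div_mul_cancel₀ _ (by linarith)]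
  -- The threshold says q = δ/(1-δ) ≤ q₀, so Kq ≤ 1/(1+√5) ≤ 0.3091. Dividing by 3 gives qS ≤
  -- 0.1034, and δ = q/(1+q) with q ≤ qS gives δ ≤ 0.095.
  have hKq : K * q ≤ 0.3091 := by
    have h2 : (1 + √5) * K * q ≤ 1 := by
      calc (1 + √5) * K * q ≤ (1 + √5) * K * q₀ := mul_le_mul_of_nonneg_left hq hgK.le
        _ = 1 := mul_inv_cancel₀ hgK.ne'
    have h3 : 0 ≤ K * q := by positivity
    nlinarith
  have h3 : 3 * (q * S) ≤ K * q := by nlinarith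
  have hqS : q ≤ q * S := le_mul_of_one_le_right hqnn hS
  refine ⟨by nlinarith, hqnn, by linarith, h3⟩

end Constants

/-! ### Part (a): robust blind inversion -/

section BlindInversion

variable {d : ℕ} {ζ : Measure (PathSpace d)} {A : Matrix (Fin d) (Fin d) ℝ}

theorem isMonomial_mul_diagonal {M : Matrix (Fin d) (Fin d) ℝ} (hM : IsMonomial M) {e : Fin d → ℝ}
    (he : ∀ i, e i ≠ 0) : IsMonomial (M * diagonal e) := by
  obtain ⟨c, τ, hc, rfl⟩ := hM
  refine ⟨fun i => c i * e (τ i), τ, fun i => mul_ne_zero (hc i) (he _), ?_⟩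
  ext i j
  rw [mul_diagonal, diagonal_mul, diagonal_mul]
  by_cases h : τ i = j
  · subst h; ring
  · simp [Equiv.Perm.permMatrix, PEquiv.toMatrix_apply, h]

theorem isMonomial_diagonal_mul {M : Matrix (Fin d) (Fin d) ℝ} (hM : IsMonomial M) {e : Fin d → ℝ}
    (he : ∀ i, e i ≠ 0) : IsMonomial (diagonal e * M) := by
  obtain ⟨c, τ, hc, rfl⟩ := hM
  refine ⟨fun i => e i * c i, τ, fun i => mul_ne_zero (he i) (hc i), ?_⟩
  rw [← mul_assoc, diagonal_mul_diagonal]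

theorem isMonomial_mul_inv_stdMatrix (hζ : ζ ∈ coreSignals d) {M : Matrix (Fin d) (Fin d) ℝ}
    (hM : IsMonomial M) : IsMonomial (M * (stdMatrix ζ)⁻¹) := by
  rw [inv_stdMatrix hζ]
  exact isMonomial_mul_diagonal hM fun i =>
    inv_ne_zero (Real.sqrt_pos.2 (sigMoment_pair_self_pos hζ i)).ne'

theorem norm_linMap_le (E : Matrix (Fin d) (Fin d) ℝ) (u : State d) :
    ‖linMap E u‖ ≤ frob E * ‖u‖ :=
  ((Matrix.toEuclideanCLM (n := Fin d) (𝕜 := ℝ) E).le_opNorm u).trans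
    (mul_le_mul_of_nonneg_right (norm_le_frob E) (norm_nonneg _))

theorem linMap_sub_linMap (B C : Matrix (Fin d) (Fin d) ℝ) (u : State d) :
    linMap B u - linMap C u = linMap (B - C) u := by
  simp [linMap, map_sub]

/-- With v = 0 the error at u is E(Mu), which is compared with |Mu|. This is why the perturbation is
needed to the left of the monomial matrix. -/
theorem deviance_le_of_relative_error {κ₀ c : ℝ}
    (h : ∀ θ ∈ icaInverse κ₀ (push (linMap A) ζ), ∃ M E : Matrix (Fin d) (Fin d) ℝ,
      IsMonomial M ∧ θ * A = (1 + E) * M ∧ frob E ≤ c) :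
    deviance (icaInverseMaps κ₀) ζ (linMap A) ≤ ENNReal.ofReal c := by
  refine iSup₂_le fun B hB => ?_
  obtain ⟨θ, hθ, rfl⟩ := hB
  obtain ⟨M, E, hM, hE, hc⟩ := h θ hθ
  refine (iInf₂_le M hM).trans ((iInf_le _ 0).trans (iSup₂_le fun u _ => ?_))
  refine ENNReal.ofReal_le_ofReal (div_le_of_le_mul₀ (norm_nonneg _)
    ((frob_nonneg E).trans hc) ?_)
  have e : linMap θ (linMap A (u - 0)) - linMap M u = linMap E (linMap M u) := by
    rw [sub_zero, linMap_linMap, linMap_linMap, linMap_sub_linMap, hE, add_mul, one_mul,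
      add_sub_cancel_left]
  rw [e]
  exact (norm_linMap_le E _).trans (mul_le_mul_of_nonneg_right hc (norm_nonneg _))

theorem icaInverse_nonempty (hζ : ζ ∈ coreSignals d) (hC : IsUnit (symCore ζ).det)
    (hA : IsUnit A.det) {κ₀ : ℝ} (hκ : cond₂ (unitRows (whitenedUnmixing ζ A)) ≤ κ₀) :
    (icaInverse κ₀ (push (linMap A) ζ)).Nonempty := by
  rw [unitRows_whitenedUnmixing hζ hC hA] at hκ
  have hz := hasCoredinates_stdSource hζ
  have hzC := isUnit_det_symCore_stdSource hζ hC
  have hÃ := isUnit_det_stdMixing hζ hA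
  have hmem := hz.whitenedUnmixing_mem_domainXi hzC (sigMoment_pair_stdSource hζ) hÃ hκ
  obtain ⟨θ, hθ, hmin⟩ := (hz.push_linMap hÃ).exists_minimiser
    (hz.isUnit_det_symCore_push hzC hÃ) ⟨_, hmem⟩
  rw [push_stdMixing_stdSource hζ] at hmin
  exact ⟨_, θ, hθ, hmin, rfl⟩

/-- The elements of the inversion map are monomial perturbations of the inverse mixing. -/
theorem exists_monomial_of_mem_icaInverse (hζ : ζ ∈ coreSignals d) (hC : IsUnit (symCore ζ).det)
    (hA : IsUnit A.det) {κ₀ : ℝ} (hκ : cond₂ (unitRows (whitenedUnmixing ζ A)) ≤ κ₀)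
    {δ L t : ℝ} {l w : Fin d → ℝ} (hδ0 : 0 ≤ δ) (hδ : δ ≤ 0.095) (hdef : icDefect ζ = δ)
    (hl : ∀ k, l k = w k * sigMoment (stdSource ζ) [k, k, k])
    (hL0 : 0 ≤ L) (hL : ∀ k, |l k| ≤ L) (hsep : ∀ i j, i ≠ j → 1 ≤ |l i - l j|)
    (ht : t = δ / (1 - δ) * (√(∑ k, w k ^ 2) + L)) (ht1 : t ≤ 0.1034)
    {θ : Matrix (Fin d) (Fin d) ℝ} (hθ : θ ∈ icaInverse κ₀ (push (linMap A) ζ)) :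
    ∃ M E : Matrix (Fin d) (Fin d) ℝ, IsMonomial M ∧ θ = M * (1 + E) * (stdMixing ζ A)⁻¹ ∧
      frob E ≤ √d * (4 * t) ∧
      ∃ E' : Matrix (Fin d) (Fin d) ℝ, M * E = E' * M ∧ frob E' ≤ √2 * (√d * (4 * t)) := by
  rw [unitRows_whitenedUnmixing hζ hC hA] at hκ
  have hz := hasCoredinates_stdSource hζ
  have hzC := isUnit_det_symCore_stdSource hζ hC
  have hÃ := isUnit_det_stdMixing hζ hA
  have hmem := hz.whitenedUnmixing_mem_domainXi hzC (sigMoment_pair_stdSource hζ) hÃ hκ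
  have hdefSq : defectSq (stdSource ζ) ≤ δ ^ 2 := by
    rw [← hdef, icDefect_eq hζ, Real.sq_sqrt (defectSq_nonneg _)]
  have hcon := hz.contrast_whitenedUnmixing_le hzC (sigMoment_pair_stdSource hζ) hÃ
  obtain ⟨η, hη, hmin, rfl⟩ := hθ
  rw [← push_stdMixing_stdSource hζ] at hmin ⊢
  -- A minimiser does no worse than B_R, whose contrast is at most the squared defect.
  exact hz.exists_monomial_of_contrast_le hzC hÃ hη.1 hη.2.1 hδ0 hδ hdefSq
    ((hmin _ hmem).trans (hcon.trans hdefSq)) hl hL0 hL hsep ht ht1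

theorem inv_stdMixing_mul (hA : IsUnit A.det) :
    (stdMixing ζ A)⁻¹ * A = (stdMatrix ζ)⁻¹ := by
  rw [stdMixing, Matrix.mul_inv_rev, mul_assoc, nonsing_inv_mul _ hA, mul_one]

theorem mul_one_add_mul_eq {M E E' X : Matrix (Fin d) (Fin d) ℝ} (h : M * E = E' * M) :
    M * (1 + E) * X = (1 + E') * (M * X) := by
  rw [mul_add, mul_one, h]; noncomm_ring

/-- Blind inversion: robust recovery of the unmixing transformation under a small defect. -/
theorem blind_inversion (hd : 2 ≤ d) (hζ : ζ ∈ sources d) (hA : IsUnit A.det) {κ₀ : ℝ}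
    (hκ : cond₂ (unitRows (whitenedUnmixing ζ A)) ≤ κ₀) (σ : Equiv.Perm (Fin d))
    (hσ : ∀ i : Fin d, (i : ℕ) ≠ 0 → sigMoment ζ [σ i, σ i, σ i] ≠ 0)
    (hδ : icDefect ζ ≤ ε₀Const κ₀ σ (stdSource ζ) (stdMixing ζ A)) :
    (icaInverse κ₀ (push (linMap A) ζ)).Nonempty ∧
    (∀ θ ∈ icaInverse κ₀ (push (linMap A) ζ), ∃ M E : Matrix (Fin d) (Fin d) ℝ, IsMonomial M ∧
      θ = M * (1 + E) * (stdMixing ζ A)⁻¹ ∧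
      frob E ≤ c₁Const κ₀ σ (stdSource ζ) (stdMixing ζ A) * (icDefect ζ / (1 - icDefect ζ)) ∧
      frob (θ - M * (stdMixing ζ A)⁻¹) / frob (M * (stdMixing ζ A)⁻¹) ≤
        c₂Const κ₀ σ (stdSource ζ) (stdMixing ζ A) * (icDefect ζ / (1 - icDefect ζ))) ∧
    deviance (icaInverseMaps κ₀) ζ (linMap A) ≤
      ENNReal.ofReal (c₂Const κ₀ σ (stdSource ζ) (stdMixing ζ A) *
        (icDefect ζ / (1 - icDefect ζ))) := by
  obtain ⟨hcore, hC, -⟩ := hζ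
  set z := stdSource ζ with hzdef
  set Ã := stdMixing ζ A with hÃdef
  have hz : HasCoredinates z := hasCoredinates_stdSource hcore
  have hzC := isUnit_det_symCore_stdSource hcore hC
  have hÃ : IsUnit Ã.det := isUnit_det_stdMixing hcore hA
  have hunit := sigMoment_pair_stdSource hcore
  have hκ' : cond₂ (whitenedUnmixing z Ã) ≤ κ₀ := by
    rwa [unitRows_whitenedUnmixing hcore hC hA] at hκ
  have hσ' : ∀ i : Fin d, (i : ℕ) ≠ 0 → sigMoment z [σ i, σ i, σ i] ≠ 0 := fun i hi h =>
    hσ i hi ((sigMoment_triple_stdSource_eq_zero_iff hcore _).1 h)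
  obtain ⟨l, w, hl, hL, hsep, hw⟩ :=
    exists_separating_weights (fun k => sigMoment z [k, k, k]) σ hσ'
  have hdR : (2 : ℝ) ≤ d := by exact_mod_cast hd
  have hK := kConst_mul_r₀Const_ge hd hz hzC hunit hÃ hκ' σ hσ' hw
  set K := kConst d * r₀Const κ₀ σ z Ã with hKdef
  set S := √(∑ k, w k ^ 2) + ((d : ℝ) - 1) with hS
  have hS1 : 1 ≤ S := by
    have := Real.sqrt_nonneg (∑ k, w k ^ 2)
    linarith
  set δ := icDefect ζ with hδdef
  have hδ0 : 0 ≤ δ := Real.sqrt_nonneg _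
  have hδ' : δ ≤ ((1 + √5) * K)⁻¹ / (1 + ((1 + √5) * K)⁻¹) := by
    rw [hKdef, ← mul_assoc]
    exact hδ
  obtain ⟨hδ1, hq0, ht1, h3t⟩ := defect_bounds hδ0 hS1 hK hδ'
  set q := δ / (1 - δ) with hq
  have ht0 : 0 ≤ q * S := mul_nonneg hq0 (by linarith)
  have hsqrtd : √(d : ℝ) ≤ d := Real.sqrt_le_iff.2 ⟨by linarith, by nlinarith⟩
  have hc₁ : c₁Const κ₀ σ z Ã = 2 * d * K := by rw [c₁Const, hKdef]; ring
  have hbound₁ : √(d : ℝ) * (4 * (q * S)) ≤ c₁Const κ₀ σ z Ã * q := by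
    rw [hc₁]
    calc √(d : ℝ) * (4 * (q * S)) ≤ d * (4 * (q * S)) :=
          mul_le_mul_of_nonneg_right hsqrtd (by positivity)
      _ ≤ d * (2 * (K * q)) := mul_le_mul_of_nonneg_left (by linarith) (by linarith)
      _ = _ := by ring
  have hκ2 := one_le_cond₂ (by omega) (isUnit_det_whitenedUnmixing hz hzC hÃ)
  -- √2 · 4 ≤ 6, so the factor √2 is paid for by 6qS ≤ 2Kq; the remaining κ₂(B_R) ≥ 1 and d ≥ 1 are
  -- to spare.
  have hbound₂ : √2 * (√(d : ℝ) * (4 * (q * S))) ≤ c₂Const κ₀ σ z Ã * q := by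
    have h2 : √2 ≤ 3 / 2 := Real.sqrt_le_iff.2 ⟨by norm_num, by norm_num⟩
    have hKq : 0 ≤ K * q := by linarith
    rw [c₂Const, hc₁]
    calc √2 * (√(d : ℝ) * (4 * (q * S))) ≤ 3 / 2 * (√(d : ℝ) * (4 * (q * S))) :=
          mul_le_mul_of_nonneg_right h2 (by positivity)
      _ = √(d : ℝ) * 1 * (2 * (3 * (q * S))) := by ring
      _ ≤ √(d : ℝ) * cond₂ (whitenedUnmixing z Ã) * (2 * d * (K * q)) := by
          refine mul_le_mul (mul_le_mul_of_nonneg_left hκ2 (Real.sqrt_nonneg _)) ?_ (by linarith)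
            (mul_nonneg (Real.sqrt_nonneg _) (by linarith))
          nlinarith
      _ = _ := by ring
  have hmain : ∀ θ ∈ icaInverse κ₀ (push (linMap A) ζ), ∃ M E : Matrix (Fin d) (Fin d) ℝ,
      IsMonomial M ∧ θ = M * (1 + E) * Ã⁻¹ ∧ frob E ≤ √(d : ℝ) * (4 * (q * S)) ∧
      ∃ E' : Matrix (Fin d) (Fin d) ℝ, M * E = E' * M ∧
        frob E' ≤ √2 * (√(d : ℝ) * (4 * (q * S))) := fun θ hθ =>
    exists_monomial_of_mem_icaInverse hcore hC hA hκ hδ0 hδ1 rfl hl (by linarith)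
      (hL (by omega)) hsep rfl ht1 hθ
  refine ⟨icaInverse_nonempty hcore hC hA hκ, fun θ hθ => ?_, ?_⟩
  · obtain ⟨M, E, hM, hθM, hE, E', hE'M, hE'⟩ := hmain θ hθ
    refine ⟨M, E, hM, hθM, hE.trans hbound₁, ?_⟩
    refine (div_le_of_le_mul₀ (frob_nonneg _) (frob_nonneg E') ?_).trans (hE'.trans hbound₂)
    -- The absolute error is a left multiple of the reference matrix, so submultiplicativity of the
    -- Frobenius norm bounds the relative error by that of E'.
    have e : θ - M * Ã⁻¹ = E' * (M * Ã⁻¹) := by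
      rw [hθM, mul_one_add_mul_eq hE'M, add_mul, one_mul, add_sub_cancel_left]
    rw [e]
    exact frob_mul_le _ _
  · refine deviance_le_of_relative_error fun θ hθ => ?_
    obtain ⟨M, E, hM, hθM, hE, E', hE'M, hE'⟩ := hmain θ hθ
    refine ⟨M * (stdMatrix ζ)⁻¹, E', isMonomial_mul_inv_stdMatrix hcore hM, ?_,
      hE'.trans hbound₂⟩
    rw [hθM, mul_assoc, inv_stdMixing_mul hA, mul_one_add_mul_eq hE'M]

end BlindInversion

/-! ### Orthogonal sources: exact identifiability and exact inversion -/

section OrthogonalSources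

variable {d : ℕ} {ζ μ : Measure (PathSpace d)} {A M : Matrix (Fin d) (Fin d) ℝ}

theorem IsMonomial.isUnit_det (hM : IsMonomial M) : IsUnit M.det := by
  obtain ⟨c, τ, hc, rfl⟩ := hM
  rw [det_mul, det_diagonal, det_permutation, isUnit_iff_ne_zero]
  refine mul_ne_zero (Finset.prod_ne_zero_iff.2 fun i _ => hc i) ?_
  exact_mod_cast (Equiv.Perm.sign τ).ne_zero

theorem isMonomial_one : IsMonomial (1 : Matrix (Fin d) (Fin d) ℝ) :=
  ⟨1, 1, fun _ => one_ne_zero, by simp⟩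

theorem diagonal_mul_permMatrix_apply (c : Fin d → ℝ) (τ : Equiv.Perm (Fin d)) (i a : Fin d) :
    (diagonal c * τ.permMatrix ℝ) i a = if τ i = a then c i else 0 := by
  rw [diagonal_mul]
  simp [Equiv.Perm.permMatrix, PEquiv.toMatrix_apply, eq_comm]

theorem HasCoredinates.sigMoment_push_monomial_pair (hμ : HasCoredinates μ) {c : Fin d → ℝ}
    {τ : Equiv.Perm (Fin d)} (h : IsMonomial (diagonal c * τ.permMatrix ℝ)) (i j : Fin d) :
    sigMoment (push (linMap (diagonal c * τ.permMatrix ℝ)) μ) [i, j] =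
      c i * c j * sigMoment μ [τ i, τ j] := by
  rw [hμ.sigMoment_push_pair h.isUnit_det]
  simp only [diagonal_mul_permMatrix_apply, ite_mul, mul_ite, zero_mul, mul_zero,
    Finset.sum_ite_eq, Finset.mem_univ, if_true]

theorem HasCoredinates.sigMoment_push_monomial_triple (hμ : HasCoredinates μ) {c : Fin d → ℝ}
    {τ : Equiv.Perm (Fin d)} (h : IsMonomial (diagonal c * τ.permMatrix ℝ)) (i j k : Fin d) :
    sigMoment (push (linMap (diagonal c * τ.permMatrix ℝ)) μ) [i, j, k] =
      c i * c j * c k * sigMoment μ [τ i, τ j, τ k] := by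
  rw [hμ.sigMoment_push_triple h.isUnit_det]
  simp only [diagonal_mul_permMatrix_apply, ite_mul, mul_ite, zero_mul, mul_zero,
    Finset.sum_ite_eq, Finset.mem_univ, if_true]

theorem IsOrthogonal.push_monomial (hμ : HasCoredinates μ) (h : IsOrthogonal μ)
    (hM : IsMonomial M) : IsOrthogonal (push (linMap M) μ) := by
  have hM' := hM
  obtain ⟨c, τ, hc, rfl⟩ := hM
  refine ⟨fun i j hij => ?_, fun i j k hijk => ?_⟩
  · rw [hμ.sigMoment_push_monomial_pair hM', h.1 _ _ (τ.injective.ne hij), mul_zero]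
  · rw [hμ.sigMoment_push_monomial_triple hM', h.2 _ _ _ (by simpa using hijk), mul_zero]

theorem push_monomial_mem_orthogonalSources (hμ : μ ∈ orthogonalSources d) (hM : IsMonomial M) :
    push (linMap M) μ ∈ orthogonalSources d := by
  obtain ⟨⟨hcore, hC, hcard⟩, horth⟩ := hμ
  obtain ⟨hμ, hne⟩ := mem_coreSignals_iff.1 hcore
  refine ⟨⟨mem_coreSignals_iff.2 ⟨hμ.push_linMap hM.isUnit_det, ?_⟩,
    hμ.isUnit_det_symCore_push hC hM.isUnit_det, ?_⟩, horth.push_monomial hμ hM⟩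
  · have hM' := hM
    obtain ⟨c, τ, hc, rfl⟩ := hM
    intro i
    rw [hμ.sigMoment_push_monomial_pair hM']
    exact mul_ne_zero (mul_ne_zero (hc i) (hc i)) (hne _)
  · have hM' := hM
    obtain ⟨c, τ, hc, rfl⟩ := hM
    have e : {i : Fin d | sigMoment (push (linMap (diagonal c * τ.permMatrix ℝ)) μ) [i, i, i] = 0} =
        τ ⁻¹' {i | sigMoment μ [i, i, i] = 0} := by
      ext i
      simp only [Set.mem_ofPred_eq, Set.mem_preimage]
      rw [hμ.sigMoment_push_monomial_triple hM']
      simp [hc i]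
    rwa [e, Set.ncard_preimage_of_injective_subset_range τ.injective (by simp)]

theorem IsOrthogonal.core₀_eq (h : IsOrthogonal μ) :
    core₀ μ = diagonal fun i => sigMoment μ [i, i] := by
  ext i j
  rw [core₀, of_apply, diagonal_apply]
  split_ifs with hij
  · rw [hij]
  · exact h.1 i j hij

theorem IsOrthogonal.core_eq (h : IsOrthogonal μ) (k : Fin d) :
    core μ k = diagonal (Pi.single k (sigMoment μ [k, k, k])) := by
  rw [← of_ite_eq_diagonal_single k fun i j => sigMoment μ [i, j, k]]
  ext i j
  rw [core, of_apply, of_apply]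
  split_ifs with hij
  · rfl
  · exact h.2 i j k hij

theorem isOrthogonal_stdSource (hζ : ζ ∈ orthogonalSources d) : IsOrthogonal (stdSource ζ) := by
  have h := isMonomial_mul_inv_stdMatrix hζ.1.1 (isMonomial_one (d := d))
  rw [one_mul] at h
  exact hζ.2.push_monomial (mem_coreSignals_iff.1 hζ.1.1).1 h

theorem core₀_stdSource_eq_one (hζ : ζ ∈ orthogonalSources d) : core₀ (stdSource ζ) = 1 := by
  rw [(isOrthogonal_stdSource hζ).core₀_eq, ← diagonal_one]
  exact congrArg diagonal (funext fun i => sigMoment_pair_stdSource hζ.1.1 i)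

theorem frob_zero : frob (0 : Matrix (Fin d) (Fin d) ℝ) = 0 := by
  simp [frob]

theorem icDefect_eq_zero (hζ : ζ ∈ orthogonalSources d) : icDefect ζ = 0 := by
  rw [icDefect_eq hζ.1.1, defectSq, core₀_stdSource_eq_one hζ]
  simp only [(isOrthogonal_stdSource hζ).core_eq, sub_self, frob_zero]
  simp

theorem exists_perm_forall_ne_zero {m : Fin d → ℝ} (h : {i | m i = 0}.ncard ≤ 1) :
    ∃ σ : Equiv.Perm (Fin d), ∀ i : Fin d, (i : ℕ) ≠ 0 → m (σ i) ≠ 0 := by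
  rw [Set.ncard_le_one_iff] at h
  by_cases hk : ∃ k, m k = 0
  · obtain ⟨k, hk⟩ := hk
    have hd : 0 < d := k.pos
    refine ⟨Equiv.swap ⟨0, hd⟩ k, fun i hi hm => ?_⟩
    have e : Equiv.swap ⟨0, hd⟩ k i = Equiv.swap ⟨0, hd⟩ k ⟨0, hd⟩ := by
      rw [Equiv.swap_apply_left]
      exact h hm hk
    exact hi (congrArg Fin.val ((Equiv.swap _ k).injective e))
  · exact ⟨1, fun i _ hm => hk ⟨_, hm⟩⟩

/-- Separating weights for sources at most one of whose third moments vanishes. -/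
theorem exists_bounded_separating_weights (hζ : ζ ∈ sources d) :
    ∃ (l w : Fin d → ℝ) (L : ℝ), (∀ k, l k = w k * sigMoment (stdSource ζ) [k, k, k]) ∧ 0 ≤ L ∧
      (∀ k, |l k| ≤ L) ∧ ∀ i j, i ≠ j → 1 ≤ |l i - l j| := by
  obtain ⟨σ, hσ⟩ := exists_perm_forall_ne_zero (m := fun i => sigMoment ζ [i, i, i]) hζ.2.2
  obtain ⟨l, w, hl, -, hsep, -⟩ := exists_separating_weights
    (fun k => sigMoment (stdSource ζ) [k, k, k]) σ fun i hi h =>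
      hσ i hi ((sigMoment_triple_stdSource_eq_zero_iff hζ.1 _).1 h)
  -- Any bound on l will do, as it is later multiplied by δ = 0; this one is nonnegative also for d
  -- = 0, where d - 1 is not.
  exact ⟨l, w, ∑ k, |l k|, hl, Finset.sum_nonneg fun _ _ => abs_nonneg _, fun k =>
    Finset.single_le_sum (f := fun k => |l k|) (fun _ _ => abs_nonneg _) (Finset.mem_univ k), hsep⟩

/-- Orthogonal sources are identifiable up to monomial transformations. -/
theorem isMonomial_of_push_mem_orthogonalSources (hζ : ζ ∈ orthogonalSources d)
    (hA : IsUnit A.det) (hζ' : push (linMap A) ζ ∈ orthogonalSources d) : IsMonomial A := by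
  obtain ⟨l, w, L, hl, hL0, hL, hsep⟩ := exists_bounded_separating_weights hζ.1
  set ζ' := push (linMap A) ζ with hζ'def
  have hz := hasCoredinates_stdSource hζ.1.1
  have hN := isUnit_det_stdMatrix hζ.1.1
  have hN' := isUnit_det_stdMatrix hζ'.1.1
  -- G carries one standardised source to the other. Both are exactly diagonal, so the
  -- diagonalisation result applies with δ = t = 0 and forces E = 0.
  set G := (stdMatrix ζ')⁻¹ * A * stdMatrix ζ with hG
  have hGu : IsUnit G.det := by
    rw [hG, det_mul, det_mul]
    exact ((isUnit_det_inv_stdMatrix hζ'.1.1).mul hA).mul hN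
  have hpush : push (linMap G) (stdSource ζ) = stdSource ζ' := by
    rw [stdSource, push_linMap_push_linMap, hG, mul_assoc, mul_nonsing_inv _ hN, mul_one,
      stdSource, hζ'def, push_linMap_push_linMap]
  obtain ⟨M, E, hM, hGM, hE, -⟩ := exists_monomial_mul_one_add (G := G) (D₀ := 0) (O₀ := 0)
    (Δ := fun _ => 0) (O := fun _ => 0) (m := fun k => sigMoment (stdSource ζ) [k, k, k])
    (w := w) (l := l)
    (μ := fun ν => Pi.single ν (sigMoment (stdSource ζ') [ν, ν, ν])) (δ := 0) (L := L) (t := 0)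
    hGu le_rfl (by norm_num)
    (by
      have h := hz.core₀_push hGu
      rw [hpush, core₀_stdSource_eq_one hζ, core₀_stdSource_eq_one hζ'] at h
      simp only [add_zero, ← h])
    (fun ν => by
      have h := hz.core_push hGu ν
      rw [hpush, (isOrthogonal_stdSource hζ').core_eq] at h
      simp only [(isOrthogonal_stdSource hζ).core_eq] at h
      simp only [add_zero, ← h])
    ((norm_le_frob _).trans_eq frob_zero) ((norm_le_frob _).trans_eq frob_zero)
    (by simp [frob_zero]) (by simp [frob_zero])
    (fun _ _ => rfl) hl hL0 hL hsep (by simp) (by norm_num)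
  have hE0 : E = 0 := frob_eq_zero (hE.trans (by simp))
  rw [hE0, add_zero, mul_one] at hGM
  have e : A = stdMatrix ζ' * (M * (stdMatrix ζ)⁻¹) := by
    rw [← hGM, hG, mul_assoc, mul_assoc, mul_nonsing_inv _ hN, mul_one, ← mul_assoc,
      mul_nonsing_inv _ hN', one_mul]
  rw [e]
  exact isMonomial_diagonal_mul (isMonomial_mul_inv_stdMatrix hζ.1.1 hM) fun i =>
    (Real.sqrt_pos.2 (sigMoment_pair_self_pos hζ'.1.1 i)).ne'

/-- The standardised source has C = 1, hence B_R is orthogonal. So every κ₀ ≥ 1 admits the true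
unmixing matrix; equality fails only for d = 0. -/
theorem cond₂_whitenedUnmixing_le_one (hζ : ζ ∈ orthogonalSources d) (hA : IsUnit A.det) :
    cond₂ (unitRows (whitenedUnmixing ζ A)) ≤ 1 := by
  have hC := hζ.1.2.1
  rw [unitRows_whitenedUnmixing hζ.1.1 hC hA]
  set B := whitenedUnmixing (stdSource ζ) (stdMixing ζ A)
  have hB : B * Bᵀ = 1 := by
    rw [(hasCoredinates_stdSource hζ.1.1).whitenedUnmixing_mul_transpose
      (isUnit_det_symCore_stdSource hζ.1.1 hC) (isUnit_det_stdMixing hζ.1.1 hA), symCore,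
      core₀_stdSource_eq_one hζ, transpose_one, ← two_smul ℝ, smul_smul]
    norm_num
  rw [cond₂_eq, inv_eq_right_inv hB, norm_transpose_eq, ← sq, ← norm_mul_transpose_self, hB]
  exact norm_one_le

/-- The defect is zero, so the perturbation E of the monomial matrix has norm zero. -/
theorem isMonomial_mul_of_mem_icaInverse (hζ : ζ ∈ orthogonalSources d) (hA : IsUnit A.det)
    {κ₀ : ℝ} (hκ : 1 ≤ κ₀) {θ : Matrix (Fin d) (Fin d) ℝ}
    (hθ : θ ∈ icaInverse κ₀ (push (linMap A) ζ)) : IsMonomial (θ * A) := by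
  obtain ⟨l, w, L, hl, hL0, hL, hsep⟩ := exists_bounded_separating_weights hζ.1
  obtain ⟨M, E, hM, rfl, hE, -⟩ := exists_monomial_of_mem_icaInverse hζ.1.1 hζ.1.2.1 hA
    ((cond₂_whitenedUnmixing_le_one hζ hA).trans hκ) le_rfl (by norm_num) (icDefect_eq_zero hζ)
    hl hL0 hL hsep (t := 0) (by simp) (by norm_num) hθ
  have hE0 : E = 0 := frob_eq_zero (hE.trans (by simp))
  rw [hE0, add_zero, mul_one, mul_assoc, inv_stdMixing_mul hA]
  exact isMonomial_mul_inv_stdMatrix hζ.1.1 hM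

end OrthogonalSources

/-! ### Part (b): the ICA-solution -/

section Solution

variable {d : ℕ} {μ : Measure (PathSpace d)} {A : Matrix (Fin d) (Fin d) ℝ}

theorem linMap_injective :
    Function.Injective (linMap : Matrix (Fin d) (Fin d) ℝ → State d → State d) := fun _ _ h =>
  (Matrix.toEuclideanCLM (n := Fin d) (𝕜 := ℝ)).injective
    (ContinuousLinearMap.ext fun u => congrFun h u)

theorem isHomeoOn_linMap (hA : IsUnit A.det) (D : Set (State d)) : IsHomeoOn (linMap A) D := by
  have h : Topology.IsEmbedding (linMap A) :=
    Function.LeftInverse.isEmbedding (f := linMap A⁻¹)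
      (fun u => by rw [linMap_linMap, nonsing_inv_mul _ hA, linMap_one])
      (continuous_linMap _) (continuous_linMap _)
  exact h.comp Topology.IsEmbedding.subtypeVal

/-- At each fixed time this holds almost surely. A countable dense set of times, continuity of paths
and closedness of D_μ give all times at once. Hence the action of a map depends only on its
restriction to D_μ. -/
theorem ae_forall_mem_spatialSupport (μ : Measure (PathSpace d)) :
    ∀ᵐ x ∂μ, ∀ t, x t ∈ spatialSupport μ := by
  have h : ∀ᵐ x ∂μ, ∀ n, x (TopologicalSpace.denseSeq unitInterval n) ∈ spatialSupport μ := by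
    refine ae_all_iff.2 fun n => ?_
    set t := TopologicalSpace.denseSeq unitInterval n
    have ht : Measurable fun x : PathSpace d => x t :=
      (continuous_eval_const t).measurable
    have hs : ∀ᵐ u ∂(μ.map fun x : PathSpace d => x t),
        u ∈ (μ.map fun x : PathSpace d => x t).support := Measure.support_mem_ae
    filter_upwards [ae_of_ae_map ht.aemeasurable hs] with x hx
    exact subset_closure (Set.mem_iUnion.2 ⟨t, hx⟩)
  filter_upwards [h] with x hx t
  exact (TopologicalSpace.denseRange_denseSeq unitInterval).induction_on
    (p := fun t => x t ∈ spatialSupport μ) t (isClosed_closure.preimage x.continuous) hx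

theorem pathMap_congr {f g : State d → State d} {x : PathSpace d} (h : ∀ t, f (x t) = g (x t)) :
    pathMap f x = pathMap g x := by
  have e : (fun t => f (x t)) = fun t => g (x t) := funext h
  by_cases hg : Continuous fun t => g (x t)
  · have hf : Continuous fun t => f (x t) := e ▸ hg
    rw [pathMap, pathMap, dif_pos hf, dif_pos hg]
    exact ContinuousMap.ext h
  · have hf : ¬ Continuous fun t => f (x t) := e ▸ hg
    rw [pathMap, pathMap, dif_neg hf, dif_neg hg]

theorem push_congr {f g : State d → State d} (h : Set.EqOn f g (spatialSupport μ)) :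
    push f μ = push g μ := by
  refine Measure.map_congr ?_
  filter_upwards [ae_forall_mem_spatialSupport μ] with x hx
  exact pathMap_congr fun t => h (hx t)

theorem regular_subset_orthogonalSources :
    smoothICSignals d ∩ regularSignals d ⊆ orthogonalSources d := by
  rintro μ ⟨⟨hprob, hic, hcard, -⟩, hcore, hstat, h3⟩
  obtain ⟨hμ, hne⟩ := mem_coreSignals_iff.1 hcore
  have horth : IsOrthogonal μ := hic.isOrthogonal hμ.1.2 hstat h3
  refine ⟨⟨hcore, ?_, ?_⟩, horth⟩
  · rw [symCore, horth.core₀_eq, diagonal_transpose, ← two_smul ℝ, smul_smul, isUnit_iff_ne_zero]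
    norm_num [det_diagonal, Finset.prod_ne_zero_iff, hne]
  · simpa [hμ.sigMoment_triple_self] using hcard

theorem isSufficient_orthogonalSources :
    IsSufficient monomialOrbit (orthogonalSources d ×ˢ linearMixings d) := by
  rintro X S f ⟨-, rfl, hS, A, hA, rfl⟩ S' ⟨g, h, -, hgh, rfl, hS', A', hA', rfl⟩
  -- On D_X the left inverse of g is the linear map A', so g coincides there with A'⁻¹.
  have e : push g (push (linMap A) S) = push (linMap (A'⁻¹ * A)) S := by
    rw [← push_linMap_push_linMap]
    refine push_congr fun u hu => ?_
    have h1 := congrArg (linMap A'⁻¹) (hgh u hu)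
    rwa [linMap_linMap, nonsing_inv_mul _ hA', linMap_one] at h1
  have hu : IsUnit (A'⁻¹ * A).det := by
    rw [det_mul]
    exact ((isUnit_nonsing_inv_det_iff).2 hA').mul hA
  refine ⟨A'⁻¹ * A, isMonomial_of_push_mem_orthogonalSources hS hu ?_, e⟩
  rw [← e]
  exact hS'

theorem isICACondition_orthogonalSources :
    IsICACondition (orthogonalSources d ×ˢ linearMixings d) := by
  refine ⟨⟨_, rfl, regular_subset_orthogonalSources⟩, ?_, isSufficient_orthogonalSources⟩
  rintro ⟨S, f⟩ ⟨hS, A, hA, hf⟩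
  have hf' : f = linMap A := hf
  subst hf'
  exact ⟨hS.1.1.1.1, isHomeoOn_linMap hA _⟩

theorem icaInverse_nonempty_of_mem_orthogonalSources (hμ : μ ∈ orthogonalSources d)
    (hA : IsUnit A.det) {κ₀ : ℝ} (hκ : 1 ≤ κ₀) : (icaInverse κ₀ (push (linMap A) μ)).Nonempty :=
  icaInverse_nonempty hμ.1.1 hμ.1.2.1 hA ((cond₂_whitenedUnmixing_le_one hμ hA).trans hκ)

theorem isICAInversion_icaInverseMaps {κ₀ : ℝ} (hκ : 1 ≤ κ₀) :
    IsICAInversion (orthogonalSources d ×ˢ linearMixings d) (icaInverseMaps (d := d) κ₀) := by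
  refine ⟨?_, ?_⟩
  · rintro X B ⟨θ, -, rfl⟩
    exact (continuous_linMap θ).measurable
  · rintro S f ⟨hS, A, hA, hf⟩
    have hf' : f = linMap A := hf
    subst hf'
    refine ⟨(icaInverse_nonempty_of_mem_orthogonalSources hS hA hκ).image _, ?_⟩
    rintro B ⟨θ, hθ, rfl⟩
    refine ⟨θ * A, 0, isMonomial_mul_of_mem_icaInverse hS hA hκ hθ, funext fun u => ?_⟩
    rw [Function.comp_apply, linMap_linMap, add_zero]

theorem isInversionMap_icaInverseMaps {κ₀ : ℝ} (hκ : 1 ≤ κ₀) :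
    IsInversionMap (orthogonalSources d ×ˢ linearMixings d)
      fun X => (fun B => push B X) '' icaInverseMaps κ₀ X := by
  rintro X S f ⟨-, rfl, hS, A, hA, hf⟩
  have hf' : f = linMap A := hf
  subst hf'
  refine ⟨((icaInverse_nonempty_of_mem_orthogonalSources hS hA hκ).image _).image _, ?_⟩
  rintro _ ⟨_, ⟨θ, hθ, rfl⟩, rfl⟩
  have hM := isMonomial_mul_of_mem_icaInverse hS hA hκ hθ
  -- θA is monomial, so θ is invertible and θ⁻¹ is an admissible mixing for the recovered signal.
  have hθu : IsUnit θ.det := isUnit_of_mul_isUnit_left (by rw [← det_mul]; exact hM.isUnit_det)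
  refine ⟨linMap θ, linMap θ⁻¹, isHomeoOn_linMap hθu _, fun u _ => ?_, rfl, ?_,
    θ⁻¹, (isUnit_nonsing_inv_det_iff).2 hθu, rfl⟩
  · rw [linMap_linMap, nonsing_inv_mul _ hθu, linMap_one]
  · change push (linMap θ) (push (linMap A) S) ∈ orthogonalSources d
    rw [push_linMap_push_linMap]
    exact push_monomial_mem_orthogonalSources hS hM

end Solution

end RobustICA

open RobustICA in
theorem theorem4p3 (d : ℕ) (κ₀ : ℝ) :
    (2 ≤ d →
      ∀ (χ ζ : Measure (PathSpace d)) (A : Matrix (Fin d) (Fin d) ℝ),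
        IsBSSTripleOn (sources d ×ˢ linearMixings d) χ ζ (linMap A) →
        cond₂ (unitRows (whitenedUnmixing ζ A)) ≤ κ₀ →
        ∀ σ : Equiv.Perm (Fin d),
          (∀ i : Fin d, (i : ℕ) ≠ 0 → sigMoment ζ [σ i, σ i, σ i] ≠ 0) →
          icDefect ζ ≤ ε₀Const κ₀ σ (stdSource ζ) (stdMixing ζ A) →
          (icaInverse κ₀ χ).Nonempty ∧
          (∀ θ ∈ icaInverse κ₀ χ, ∃ M E : Matrix (Fin d) (Fin d) ℝ, IsMonomial M ∧
            θ = M * (1 + E) * (stdMixing ζ A)⁻¹ ∧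
            frob E ≤ c₁Const κ₀ σ (stdSource ζ) (stdMixing ζ A) *
              (icDefect ζ / (1 - icDefect ζ)) ∧
            frob (θ - M * (stdMixing ζ A)⁻¹) / frob (M * (stdMixing ζ A)⁻¹) ≤
              c₂Const κ₀ σ (stdSource ζ) (stdMixing ζ A) *
                (icDefect ζ / (1 - icDefect ζ))) ∧
          deviance (icaInverseMaps κ₀) ζ (linMap A) ≤
            ENNReal.ofReal (c₂Const κ₀ σ (stdSource ζ) (stdMixing ζ A) *
              (icDefect ζ / (1 - icDefect ζ)))) ∧
    (1 ≤ κ₀ →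
      IsICASolution (orthogonalSources d ×ˢ linearMixings d) (icaInverseMaps (d := d) κ₀)) := by
  refine ⟨?_, fun hκ => ⟨isICACondition_orthogonalSources, isICAInversion_icaInverseMaps hκ,
    isInversionMap_icaInverseMaps hκ⟩⟩
  rintro hd χ ζ A ⟨-, rfl, hζ, A', hA', hAA'⟩ hκ σ hσ hδ
  -- Membership in the product only supplies some invertible matrix inducing the same map as A.
  obtain rfl : A = A' := linMap_injective hAA'
  exact blind_inversion hd hζ hA' hκ σ hσ hδ
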